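/- Let $A$ and $B$ be finite alphabets and $\boxdot$ a blank symbol. The convolution $\mathrm{conv}(x,y)$ of two strings is the string of length $\max(|x|,|y|)$ whose $i$-th symbol is the pair of the $i$-th symbols of $x$ and $y$, with $\boxdot$ in place of a missing symbol. A family $\{L_e : e\in I\}$ of languages $L_e\subseteq A^*$ with $I\subseteq B^*$ is *automatic* if $I$ and $\{\mathrm{conv}(e,x) : e\in I,\ x\in L_e\}$ are regular. A *text* for $L$ is an infinite sequence of strings, with repetitions allowed, whose set of members is exactly $L$. A *recursive learner* is a computable total map $M:(\text{old memory},\text{datum})\mapsto(\text{new memory},\text{conjecture})$ together with an initial memory. A learner *learns* the family if for every $e\in I$ and every text $w_0,w_1,\dots$ for $L_e$, its conjectures $e_0,e_1,\dots$ (one after each datum) are eventually constant, equal to some $d\in I$ with $L_d=L_e$. A *Turing machine learner with one additional work tape* is a deterministic Turing machine with two one-sided infinite tapes, the base tape (Tape $0$) and a work tape (Tape $1$). Cell $0$ of each tape carries an unmodifiable left-end marker, and the cells $1,2,\dots$ are blank or carry symbols of a finite alphabet. Initially the work tape is blank with its head on cell $0$. The machine works in cycles. Each cycle begins in the start state, with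 the head of the base tape on cell $0$ and the base tape containing, from cell $1$ on, the convolution of the current datum and the old long-term memory (a string over a finite alphabet; a fixed string before the first cycle), followed by blanks. The cycle ends when the machine enters a final state; the base tape then has to contain, from cell $1$ on, the convolution of the hypothesis and the new long-term memory, followed by blanks. The contents and the head position of the work tape are kept between cycles. The update time of a cycle is its number of steps. **Theorem.** Let $\{L_e : e\in I\}$ be an automatic family in which every $L_e$ is infinite, and let $M$ be a recursive learner which learns this family. Let $f,g:\mathbb N\to\mathbb N$ be recursive functions such that $f(n)\ge m$ whenever $n\ge g(m)$. Then there are a Turing machine learner $N$ with one additional work tape which learns this family, and a constant $C$, such that on every sequence of data from $A^*$ every cycle of $N$ halts with an output of the required form and the following holds in each cycle, where $n$ is the length of the longest datum seen so far (the current one included): throughout the cycle only the cells number $1,\dots,n$ of Tape $0$ can be non-blank (apart from the marker in cell $0$), and the update time is at most $C\cdot(n\cdot f(n)+1)$, that is, $O(n\cdot f(n))$. -/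

import Mathlib

namespace AutoLearn

universe u v w

/-! ### Convolution, automatic families, texts, learning in the limit -/

/-- Convolution of two strings: the symbols at equal positions are paired, and the shorter string is
padded with `none` (the symbol `⊡`) up to the length of the longer one. -/
def conv {A : Type u} {B : Type v} (x : List A) (y : List B) : List (Option A × Option B) :=
  (List.range (max x.length y.length)).map fun i => (x[i]?, y[i]?)

/-- The family `{L e : e ∈ I}` (indices are strings over `B`, the languages are over `A`) is
automatic: `I` and `{conv(e, x) : e ∈ I, x ∈ L e}` are regular. The values `L e` for `e ∉ I` play no
role. -/
def IsAutomaticFamily {A : Type u} {B : Type v} (I : Language B) (L : List B → Language A) : Prop :=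
  I.IsRegular ∧
    Language.IsRegular
      ({z | ∃ e ∈ I, ∃ x ∈ L e, z = conv e x} : Language (Option B × Option A))

/-- `T` is a text for `K`: it lists all elements of `K` and no others, in any order, with repetitions
allowed. -/
def IsText {A : Type u} (T : ℕ → List A) (K : Language A) : Prop :=
  ∀ x, x ∈ K ↔ ∃ i, T i = x

/-- The sequence `h` of conjectures converges to one single index (in `I`) of the language `K`. -/
def ConvergesToIndex {A : Type u} {B : Type v} (I : Language B) (L : List B → Language A)
    (K : Language A) (h : ℕ → List B) : Prop :=
  ∃ d ∈ I, L d = K ∧ ∃ k, ∀ j, k ≤ j → h j = d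

/-- The memory, before cycle `k`, of a learner that is given as a mapping
(old memory, new datum) ↦ (new memory, new conjecture) with initial memory `m₀`. -/
def memory {A : Type u} {B : Type v} {S : Type w} (M : S × List A → S × List B) (m₀ : S)
    (T : ℕ → List A) : ℕ → S
  | 0 => m₀
  | k + 1 => (M (memory M m₀ T k, T k)).1

/-- The conjecture which that learner outputs in cycle `k`. -/
def conjecture {A : Type u} {B : Type v} {S : Type w} (M : S × List A → S × List B) (m₀ : S)
    (T : ℕ → List A) (k : ℕ) : List B :=
  (M (memory M m₀ T k, T k)).2

/-- The mapping `M` with initial memory `m₀` learns the family `{L e : e ∈ I}` from all texts. -/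
def MapLearns {A : Type u} {B : Type v} {S : Type w} (M : S × List A → S × List B) (m₀ : S)
    (I : Language B) (L : List B → Language A) : Prop :=
  ∀ e ∈ I, ∀ T : ℕ → List A, IsText T (L e) → ConvergesToIndex I L (L e) (conjecture M m₀ T)

/-- The length of the longest datum among `T 0, …, T k`: the data seen so far in cycle `k`, the
current datum included. -/
def longest {A : Type u} (T : ℕ → List A) (k : ℕ) : ℕ :=
  (Finset.range (k + 1)).sup fun i => (T i).length

/-! ### Tapes -/

/-- What a head can see: the left end marker `⊞`, the blank `⊡`, or a symbol. -/
inductive Cell (Γ : Type u) : Type u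
  | leftEnd
  | blank
  | sym (a : Γ)

/-- Moves of a head. -/
inductive Move : Type
  | left
  | stay
  | right

/-- A one-sided infinite tape. Cell number `0` carries `⊞`, and `cell i` is the content of cell number
`i` for `i ≥ 1`, where `none` is the blank `⊡` (the value `cell 0` is never looked at). -/
structure Tape (Γ : Type u) where
  head : ℕ
  cell : ℕ → Option Γ

/-- The symbol under the head. -/
def Tape.read {Γ : Type u} (t : Tape Γ) : Cell Γ :=
  if t.head = 0 then Cell.leftEnd
  else match t.cell t.head with
    | none => Cell.blank
    | some a => Cell.sym a

/-- Write at the head (`⊞` cannot be modified), then move (not beyond the left end). -/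
def Tape.act {Γ : Type u} (t : Tape Γ) (s : Option Γ) (d : Move) : Tape Γ where
  head := match d with
    | Move.left => t.head - 1
    | Move.stay => t.head
    | Move.right => t.head + 1
  cell := if t.head = 0 then t.cell else Function.update t.cell t.head s

/-- The tape `⊞ z ⊡ ⊡ ⊡ …` with its head on `⊞`. -/
def Tape.ofList {Γ : Type u} (z : List Γ) : Tape Γ where
  head := 0
  cell := fun i => if i = 0 then none else z[i - 1]?

/-! ### Turing machine learners -/

/-- Symbols of the base tape: the convolution symbols (datum, memory), the convolution symbols
(hypothesis, memory), and auxiliary symbols for use during a cycle. -/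
inductive BaseSym (A : Type u) (B : Type v) (Δ X : Type) : Type (max u v)
  | input (p : Option A × Option Δ)
  | output (p : Option B × Option Δ)
  | aux (c : X)

/-- A deterministic Turing machine learner with base tape (Tape `0`) and `k` additional work tapes,
for data over `A` and hypotheses over `B`. `Δ` is the alphabet of the long term memory on the base
tape, `X` holds auxiliary base tape symbols, `W` is the alphabet of the work tapes. All of these, and
the set `Q` of control states, are finite. -/
structure Learner (A : Type u) (B : Type v) (k : ℕ) where
  Q : Type
  Δ : Type
  X : Type
  W : Type
  finQ : Finite Q
  finΔ : Finite Δ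
  finX : Finite X
  finW : Finite W
  /-- control state at the beginning of every cycle -/
  start : Q
  /-- final states: the machine halts on entering one, which ends the cycle -/
  final : Q → Bool
  /-- initial long term memory on the base tape -/
  init : List Δ
  /-- transition table: new control state; symbol to write and move on the base tape; and the same on
  each work tape -/
  trans : Q → Cell (BaseSym A B Δ X) → (Fin k → Cell W) →
    Q × (Option (BaseSym A B Δ X) × Move) × (Fin k → Option W × Move)

namespace Learner

variable {A : Type u} {B : Type v} {k : ℕ}

/-- Configurations within a cycle. -/
structure Config (N : Learner A B k) where
  state : N.Q
  base : Tape (BaseSym A B N.Δ N.X)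
  work : Fin k → Tape N.W

/-- One step of the machine; nothing happens any more in a final state. -/
def step (N : Learner A B k) (c : N.Config) : N.Config :=
  if N.final c.state then c
  else
    let r := N.trans c.state c.base.read (fun i => (c.work i).read)
    { state := r.1
      base := c.base.act r.2.1.1 r.2.1.2
      work := fun i => (c.work i).act (r.2.2 i).1 (r.2.2 i).2 }

/-- The configuration after `s` steps. -/
def steps (N : Learner A B k) (s : ℕ) (c : N.Config) : N.Config :=
  N.step^[s] c

/-- What survives the change of cycles: the long term memory on the base tape, and the work tapes with
their contents and head positions. -/
structure Snapshot (N : Learner A B k) where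
  mem : List N.Δ
  work : Fin k → Tape N.W

/-- Before the first cycle: the initial memory, and blank work tapes with heads on `⊞`. -/
def initial (N : Learner A B k) : N.Snapshot where
  mem := N.init
  work := fun _ => Tape.ofList []

/-- Beginning of a cycle with datum `x`: start state, `⊞ conv(x, memory) ⊡ ⊡ …` on the base tape with
its head on `⊞`, work tapes as they were left. -/
def load (N : Learner A B k) (p : N.Snapshot) (x : List A) : N.Config where
  state := N.start
  base := Tape.ofList ((conv x p.mem).map BaseSym.input)
  work := p.work

/-- The cycle that begins in `p` with datum `x` halts after exactly `t` steps, with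
`⊞ conv(h, new memory) ⊡ ⊡ …` on the base tape, where `h` is the hypothesis that is output, and it leaves
the snapshot `p'`. -/
def Cycle (N : Learner A B k) (p : N.Snapshot) (x : List A) (t : ℕ) (h : List B)
    (p' : N.Snapshot) : Prop :=
  N.final (N.steps t (N.load p x)).state = true ∧
  (∀ s < t, N.final (N.steps s (N.load p x)).state = false) ∧
  (N.steps t (N.load p x)).base.cell
    = (Tape.ofList ((conv h p'.mem).map BaseSym.output)).cell ∧
  (N.steps t (N.load p x)).work = p'.work

/-- The run of `N` on the sequence `T` of data: `p i` is the snapshot before cycle `i`, and `h i` and `t i`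
are the hypothesis and the update time (number of steps) of cycle `i`. As the machine is
deterministic there is at most one run on `T`; there is none if some cycle does not halt with an
output of the required form. -/
def IsRun (N : Learner A B k) (T : ℕ → List A) (p : ℕ → N.Snapshot) (h : ℕ → List B)
    (t : ℕ → ℕ) : Prop :=
  p 0 = N.initial ∧ ∀ i, N.Cycle (p i) (T i) (t i) (h i) (p (i + 1))

/-- `N` learns the family `{L e : e ∈ I}`, using it as hypothesis space. -/
def Learns (N : Learner A B k) (I : Language B) (L : List B → Language A) : Prop :=
  ∀ e ∈ I, ∀ T : ℕ → List A, IsText T (L e) →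
    ∃ p h t, N.IsRun T p h t ∧ ConvergesToIndex I L (L e) h

/-- On every sequence of data, `N` completes all its cycles. Moreover, in each cycle, with `n` the
length of the longest datum seen so far: at all moments only the cells number `1, …, n` of the base
tape are non-blank, and the update time is at most `bound n`. -/
def RunsWithin (N : Learner A B k) (bound : ℕ → ℕ) : Prop :=
  ∀ T : ℕ → List A, ∃ p h t, N.IsRun T p h t ∧
    ∀ i, (∀ s ≤ t i, ∀ j, longest T i < j →
            (N.steps s (N.load (p i) (T i))).base.cell j = none) ∧
      t i ≤ bound (longest T i)

end Learner

end AutoLearn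

/-! The learner keeps a lossless record of all data on the work tape, reads it back slowly, and
simulates `M` on the initial segments recovered so far. The simulation runs in the background on
stacks in the long-term memory, at most one step per cycle and only if the `n` cells of the base
tape leave room. An infinite language over a finite alphabet contains arbitrarily long strings, so
`n` is unbounded on a text and every background computation finishes. The recovered segments exhaust
the text, hence the outputs converge together with the conjectures of `M`.

The work tape has only one head, which has to store new symbols and also to return to old ones. So
symbols are stored while the head travels. It goes back and forth in rounds: on the way right it
puts symbols on a first track of every second available cell, and on the way back it fills the
second track of these cells. The skipped cells remain available. After `s` rounds available cells
are at most `gapSize s = 2 ^ (s + 1) - 1` apart, so storing one symbol takes O(2^s) steps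
(`WorkInv.store`, `WorkInv.turn`). Once per round the first unread cell is read, provided that its
content is final. The turning marks alone tell which cells belong to which round (`sieve`), so the
contents of an initial segment of the tape yield a prefix of the stream
(`RightInv.answerStream_prefix`).

For the time bound, a further round may begin only when `f n` exceeds a multiple of the new gap.
This is enforced by space: after `s` answers the background computation builds a unary block of
length `g (2 ^ (s + 5))` on a stack (`exists_simulates`). The block fits only if `n ≥ g (2 ^ (s +
5))`, and then `f n ≥ 2 ^ (s + 5)` (`Inv.step`, `time_le`).

Every cell is finally read, because each round halves the number of available cells up to a given
position (`length_filter_sieve`, `IsExecution.exists_marked_lt`). Hence arbitrarily long initial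
segments are recovered (`IsExecution.eventually_items`). -/

namespace AutoLearn

/-! ### Alternating sublists, sieving, and splitting of streams -/

section Combinatorics

variable {α : Type*} {β : Type*}

/-- The elements at even and those at odd positions of a list. -/
def alternate : List α → List α × List α
  | [] => ([], [])
  | a :: l => (a :: (alternate l).2, (alternate l).1)

@[simp] theorem alternate_nil : alternate ([] : List α) = ([], []) := rfl

@[simp] theorem alternate_cons (a : α) (l : List α) :
    alternate (a :: l) = (a :: (alternate l).2, (alternate l).1) := rfl

theorem alternate_map (f : α → β) (l : List α) :
    alternate (l.map f) = ((alternate l).1.map f, (alternate l).2.map f) := by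
  induction l with
  | nil => rfl
  | cons a l ih => simp [ih]

theorem alternate_append (l l' : List α) :
    alternate (l ++ l') = if Even l.length
      then ((alternate l).1 ++ (alternate l').1, (alternate l).2 ++ (alternate l').2)
      else ((alternate l).1 ++ (alternate l').2, (alternate l).2 ++ (alternate l').1) := by
  induction l with
  | nil => simp
  | cons a l ih =>
    by_cases h : Even l.length <;> simp [ih, h, Nat.even_add_one]

theorem alternate_sublist (l : List α) :
    (alternate l).1.Sublist l ∧ (alternate l).2.Sublist l := by
  induction l with
  | nil => simp
  | cons a l ih => exact ⟨ih.2.cons_cons a, ih.1.cons a⟩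

theorem mem_alternate {a : α} {l : List α} :
    a ∈ l ↔ a ∈ (alternate l).1 ∨ a ∈ (alternate l).2 := by
  induction l with
  | nil => simp
  | cons b l ih => simp [ih]; tauto

theorem alternate_fst_ne_nil {l : List α} (h : l ≠ []) : (alternate l).1 ≠ [] := by
  cases l <;> simp_all

/-- Between two elements of a sorted list lie elements of both alternating sublists. -/
theorem exists_between_alternate {l : List ℕ} (hl : l.Pairwise (· < ·)) {x y : ℕ}
    (hx : x ∈ l) (hy : y ∈ l) (hxy : x < y) :
    (∃ z ∈ (alternate l).1, x ≤ z ∧ z ≤ y) ∧ (∃ z ∈ (alternate l).2, x ≤ z ∧ z ≤ y) := by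
  induction l with
  | nil => simp at hx
  | cons a l ih =>
    rw [List.pairwise_cons] at hl
    have hyl : y ∈ l := by
      rcases List.mem_cons.1 hy with rfl | h
      · rcases List.mem_cons.1 hx with rfl | h'
        · exact absurd hxy (lt_irrefl _)
        · exact absurd (hl.1 _ h') (by omega)
      · exact h
    rcases List.mem_cons.1 hx with rfl | h
    · refine ⟨⟨x, by simp, le_rfl, hxy.le⟩, ?_⟩
      cases l with
      | nil => simp at hyl
      | cons b l =>
        refine ⟨b, by simp, (hl.1 b (by simp)).le, ?_⟩
        rcases List.mem_cons.1 hyl with rfl | h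
        · exact le_rfl
        · exact ((List.pairwise_cons.1 hl.2).1 _ h).le
    · obtain ⟨⟨z, hz, hz'⟩, w, hw, hw'⟩ := ih hl.2 h hyl
      exact ⟨⟨w, by simp [hw], hw'⟩, z, by simpa using hz, hz'⟩

/-- In a sorted list the entries up to `p` form an initial segment, which the two sublists share
alternately; the second one never gets more than half. This halving drives the progress argument. -/
theorem length_filter_alternate {l : List ℕ} (hl : l.Pairwise (· < ·)) (p : ℕ) :
    ((alternate l).2.filter (· ≤ p)).length ≤ ((alternate l).1.filter (· ≤ p)).length ∧
    ((alternate l).1.filter (· ≤ p)).length ≤ ((alternate l).2.filter (· ≤ p)).length + 1 ∧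
    ((alternate l).1.filter (· ≤ p)).length + ((alternate l).2.filter (· ≤ p)).length
      = (l.filter (· ≤ p)).length := by
  induction l with
  | nil => simp
  | cons a l ih =>
    rw [List.pairwise_cons] at hl
    have ih := ih hl.2
    by_cases h : a ≤ p
    · simp only [alternate_cons, List.filter_cons, h, decide_true, if_true, List.length_cons]
      omega
    · have h0 : l.filter (· ≤ p) = [] := by
        simp only [List.filter_eq_nil_iff, decide_eq_true_eq]
        intro b hb
        have := hl.1 b hb
        omega
      rw [h0] at ih
      simp only [alternate_cons, List.filter_cons, h, decide_false, Bool.false_eq_true, if_false, h0,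
        List.length_nil] at ih ⊢
      omega

/-- One step of a sieve: `some a` appends a candidate, and `none` removes every second candidate, and
records the removed ones as a class. -/
def sieveStep (st : List α × List (List α)) : Option α → List α × List (List α)
  | some a => (st.1 ++ [a], st.2)
  | none => ((alternate st.1).2, st.2 ++ [(alternate st.1).1])

/-- The candidates that are left, and the classes of removed ones. -/
def sieve (l : List (Option α)) : List α × List (List α) :=
  l.foldl sieveStep ([], [])

@[simp] theorem sieve_nil : sieve ([] : List (Option α)) = ([], []) := rfl

theorem sieve_concat_some (l : List (Option α)) (a : α) :
    sieve (l ++ [some a]) = ((sieve l).1 ++ [a], (sieve l).2) := by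
  simp [sieve, sieveStep]

theorem sieve_concat_none (l : List (Option α)) :
    sieve (l ++ [none]) = ((alternate (sieve l).1).2, (sieve l).2 ++ [(alternate (sieve l).1).1]) := by
  simp [sieve, sieveStep]

theorem sieve_map (f : α → β) (l : List (Option α)) :
    sieve (l.map (Option.map f)) = ((sieve l).1.map f, (sieve l).2.map (List.map f)) := by
  induction l using List.reverseRecOn with
  | nil => rfl
  | append_singleton l t ih =>
    cases t <;>
      simp [List.map_append, sieve_concat_some, sieve_concat_none, ih, alternate_map]

/-- Sieving only deletes, so the surviving candidates keep their order along the tape. -/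
theorem sieve_sublist (l : List (Option α)) : (sieve l).1.Sublist l.reduceOption := by
  induction l using List.reverseRecOn with
  | nil => simp
  | append_singleton l t ih =>
    cases t with
    | none =>
      rw [sieve_concat_none, List.reduceOption_append]
      simpa using (alternate_sublist _).2.trans ih
    | some a =>
      rw [sieve_concat_some, List.reduceOption_append]
      simpa using ih

theorem mem_sieve {l : List (Option α)} {a : α} :
    some a ∈ l ↔ a ∈ (sieve l).1 ∨ ∃ c ∈ (sieve l).2, a ∈ c := by
  induction l using List.reverseRecOn with
  | nil => simp
  | append_singleton l t ih =>
    cases t with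
    | none =>
      rw [sieve_concat_none]
      simp only [List.mem_append, ih, mem_alternate (l := (sieve l).1), List.mem_singleton]
      grind
    | some b =>
      rw [sieve_concat_some]
      simp only [List.mem_append, ih, List.mem_singleton]
      grind

/-- Classes are appended and never revised. Hence the classes seen in an initial segment of the tape
are the first classes of the whole tape, which makes reading from left to right meaningful. -/
theorem sieve_snd_prefix (l l' : List (Option α)) : (sieve l).2 <+: (sieve (l ++ l')).2 := by
  induction l' using List.reverseRecOn with
  | nil => simp
  | append_singleton l' t ih =>
    rw [← List.append_assoc]
    cases t with
    | none => rw [sieve_concat_none]; exact ih.trans (List.prefix_append _ _)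
    | some b => rw [sieve_concat_some]; exact ih

/-- Every further class halves the number of the remaining candidates up to `p`. -/
theorem length_filter_sieve {l : List (Option ℕ)} {p : ℕ} (l' : List (Option ℕ))
    (hl : (l ++ l').reduceOption.Pairwise (· < ·)) (hl' : ∀ q, some q ∈ l' → p < q) :
    ((sieve (l ++ l')).1.filter (· ≤ p)).length * 2 ^ ((sieve (l ++ l')).2.length)
      ≤ ((sieve l).1.filter (· ≤ p)).length * 2 ^ ((sieve l).2.length) := by
  induction l' using List.reverseRecOn with
  | nil => simp
  | append_singleton l' t ih =>
    rw [← List.append_assoc] at hl ⊢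
    have hs : (l ++ l').reduceOption.Pairwise (· < ·) := by
      rw [List.reduceOption_append] at hl
      exact (List.pairwise_append.1 hl).1
    have ih := ih hs fun q hq => hl' q (by simp [hq])
    cases t with
    | none =>
      rw [sieve_concat_none]
      -- The survivors are the second sublist, whose share up to `p` is at most one half; this pays
      -- for the new factor 2.
      have h := length_filter_alternate (hs.sublist (sieve_sublist _)) p
      refine le_trans ?_ ih
      simp only [List.length_append, List.length_singleton, pow_succ]
      rw [mul_comm (2 ^ _) 2, ← mul_assoc]
      exact Nat.mul_le_mul_right _ (by omega)
    | some q =>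
      have hq : p < q := hl' q (by simp)
      rw [sieve_concat_some]
      simpa [List.filter_append, hq] using ih

/-- The stream that is stored in the classes: each class holds two tracks, the first of which is
filled from left to right, and then the second one from right to left. -/
def readOut (f g : α → β) (cls : List (List α)) : List β :=
  cls.flatMap fun c => c.map f ++ (c.map g).reverse

theorem readOut_append (f g : α → β) (c c' : List (List α)) :
    readOut f g (c ++ c') = readOut f g c ++ readOut f g c' := by
  simp [readOut]

theorem readOut_congr {f g f' g' : α → β} {cls : List (List α)}
    (h : ∀ c ∈ cls, ∀ p ∈ c, f p = f' p ∧ g p = g' p) :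
    readOut f g cls = readOut f' g' cls := by
  induction cls with
  | nil => rfl
  | cons c cls ih =>
    have h1 : c.map f = c.map f' := List.map_congr_left fun p hp => (h c (by simp) p hp).1
    have h2 : c.map g = c.map g' := List.map_congr_left fun p hp => (h c (by simp) p hp).2
    have h3 := ih fun c' hc' => h c' (by simp [hc'])
    simp only [readOut, List.flatMap_cons] at h3 ⊢
    rw [h1, h2, h3]

/-- Each member of a class contributes a first-track symbol. This converts a number of rounds into a
length of recovered stream. -/
theorem length_le_readOut (f g : α → β) {cls : List (List α)} (h : ∀ c ∈ cls, c ≠ []) :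
    cls.length ≤ (readOut f g cls).length := by
  induction cls with
  | nil => simp
  | cons c cls ih =>
    have := ih fun c' hc' => h c' (by simp [hc'])
    have h1 := List.length_pos_iff.2 (h c (by simp))
    simp only [readOut, List.flatMap_cons, List.length_append, List.length_map, List.length_reverse,
      List.length_cons] at this ⊢
    omega

/-- The stream of the symbols of the data, with `none` at the end of each datum. -/
def streamOf (l : List (List α)) : List (Option α) :=
  l.flatMap fun x => x.map some ++ [none]

theorem streamOf_concat (l : List (List α)) (x : List α) :
    streamOf (l ++ [x]) = streamOf l ++ (x.map some ++ [none]) := by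
  simp [streamOf]

/-- One step of splitting a stream: completed items, and the current one. -/
def splitStep (st : List (List α) × List α) : Option α → List (List α) × List α
  | some a => (st.1, st.2 ++ [a])
  | none => (st.1 ++ [st.2], [])

/-- The completed items of a stream. -/
def splitStream (l : List (Option α)) : List (List α) :=
  (l.foldl splitStep ([], [])).1

theorem foldl_splitStep_map_some (x : List α) (st : List (List α) × List α) :
    (x.map some).foldl splitStep st = (st.1, st.2 ++ x) := by
  induction x generalizing st with
  | nil => simp
  | cons a x ih => simp [ih, splitStep]

theorem foldl_splitStep_streamOf (l : List (List α)) :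
    (streamOf l).foldl splitStep ([], []) = (l, []) := by
  induction l using List.reverseRecOn with
  | nil => rfl
  | append_singleton l x ih =>
    rw [streamOf_concat, List.foldl_append, ih, List.foldl_append, foldl_splitStep_map_some]
    simp [splitStep]

theorem splitStream_streamOf (l : List (List α)) : splitStream (streamOf l) = l := by
  rw [splitStream, foldl_splitStep_streamOf]

/-- Completed items are final: a longer stream can only extend the list, and an unfinished datum at
the end is not reported. -/
theorem splitStream_prefix {l l' : List (Option α)} (h : l <+: l') :
    splitStream l <+: splitStream l' := by
  obtain ⟨r, rfl⟩ := h
  induction r using List.reverseRecOn with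
  | nil => simp
  | append_singleton r t ih =>
    refine ih.trans ?_
    rw [← List.append_assoc]
    rw [splitStream, splitStream, List.foldl_append (l := l ++ r)]
    cases t <;> simp [splitStep]

end Combinatorics

end AutoLearn

namespace AutoLearn

/-! ### The work tape -/

section WorkTape

/-- The modes of the learner: moving left on the work tape, moving right and looking for the next
cell to be read, ready for the next round, and running the background program. -/
inductive Ctl (P : Type) : Type
  | left
  | right
  | ready
  | run (p : P)

/-- Contents of a visited cell of the work tape. -/
inductive WSym (Y : Type) : Type
  | free
  | half (y : Y)
  | full (y z : Y)
  | turn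

/-- A visited cell, together with a mark which tells whether it has been read. -/
abbrev WCell (Y : Type) : Type := WSym Y × Bool

/-- A stream symbol is put into one available cell, and then the next available cell is skipped. -/
inductive Phase : Type
  | put
  | skip

/-- The answers of the rounds: `none` if the next cell could not be read yet, `some none` if it marks
the end of a round, and `some (some (y, z))` if it contains `y` and `z`. -/
abbrev Resp (Y : Type) : Type := Option (Option (Y × Y))

variable {P Y : Type}

/-- The control state after an answer. -/
def Ctl.answer (entry : Resp Y → P) (r : Resp Y) : Ctl P → Ctl P
  | .right => .run (entry r)
  | ct => ct

/-- Whether the next cell is being looked for. -/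
def Ctl.isRight : Ctl P → Bool
  | .right => true
  | _ => false

/-- What happens in an available cell: the next phase, and the symbol to write. -/
def Phase.place (y : Y) : Phase → Option Phase × WCell Y
  | .put => (some .skip, (.half y, false))
  | .skip => (none, (.free, false))

/-- The action on the work tape while moving left: new control state, new phase (`none` when done),
symbol to write, and move. -/
def leftAct (ph : Phase) (y : Y) : Cell (WCell Y) → (Ctl P × Option Phase) × Option (WCell Y) × Move
  | .leftEnd => ((.right, some ph), none, .right)
  | .blank => ((.left, some ph), none, .left)
  | .sym (.half z, _) => ((.left, none), some (.full z y, false), .left)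
  | .sym (.free, m) => ((.left, some ph), some (.free, m), .left)
  | .sym (.full z z', m) => ((.left, some ph), some (.full z z', m), .left)
  | .sym (.turn, m) => ((.left, some ph), some (.turn, m), .left)

/-- The action on the work tape while moving right. -/
def rightAct (entry : Resp Y → P) (ct : Ctl P) (ph : Phase) (y : Y) :
    Cell (WCell Y) → (Ctl P × Option Phase) × Option (WCell Y) × Move
  | .leftEnd => ((ct, some ph), none, .right)
  | .blank => ((ct.answer entry none, (ph.place y).1), some (ph.place y).2, .right)
  | .sym (.free, _) => ((ct.answer entry none, (ph.place y).1), some (ph.place y).2, .right)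
  | .sym (.half z, m) => ((ct, some ph), some (.half z, m), .right)
  | .sym (.full z z', m) =>
      ((bif m then ct else ct.answer entry (some (some (z, z'))), some ph),
        some (.full z z', m || ct.isRight), .right)
  | .sym (.turn, m) =>
      ((bif m then ct else ct.answer entry (some none), some ph),
        some (.turn, m || ct.isRight), .right)

/-- The action on the work tape while a symbol is being stored. -/
def workAct (entry : Resp Y → P) (ct : Ctl P) (ph : Phase) (y : Y) (c : Cell (WCell Y)) :
    (Ctl P × Option Phase) × Option (WCell Y) × Move :=
  match ct with
  | .left => leftAct ph y c
  | ct => rightAct entry ct ph y c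

theorem workAct_of_ne {entry : Resp Y → P} {ct : Ctl P} (h : ct ≠ .left) (ph : Phase) (y : Y)
    (c : Cell (WCell Y)) : workAct entry ct ph y c = rightAct entry ct ph y c := by
  cases ct <;> simp_all [workAct]

/-- `StoreRun entry y ct ph t n ct' t'`: from control state `ct`, phase `ph` and work tape `t`, the
storing of `y` is completed in exactly `n` steps, with control state `ct'` and work tape `t'`. -/
inductive StoreRun (entry : Resp Y → P) (y : Y) :
    Ctl P → Phase → Tape (WCell Y) → ℕ → Ctl P → Tape (WCell Y) → Prop
  | done {ct ph t ct' s d} (h : workAct entry ct ph y t.read = ((ct', none), s, d)) :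
      StoreRun entry y ct ph t 1 ct' (t.act s d)
  | step {ct ph t ct' ph' s d n ct'' t''}
      (h : workAct entry ct ph y t.read = ((ct', some ph'), s, d))
      (h' : StoreRun entry y ct' ph' (t.act s d) n ct'' t'') :
      StoreRun entry y ct ph t (n + 1) ct'' t''

/-- Storing a list of symbols. -/
inductive StoreRuns (entry : Resp Y → P) :
    List Y → Ctl P → Tape (WCell Y) → ℕ → Ctl P → Tape (WCell Y) → Prop
  | nil {ct t} : StoreRuns entry [] ct t 0 ct t
  | cons {y l ct t n ct' t' n' ct'' t''} (h : StoreRun entry y ct .put t n ct' t')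
      (h' : StoreRuns entry l ct' t' n' ct'' t'') : StoreRuns entry (y :: l) ct t (n + n') ct'' t''

/-- The content of a cell, without the mark. -/
def kind (c : ℕ → Option (WCell Y)) (p : ℕ) : Option (WSym Y) := (c p).map Prod.fst

/-- Whether a cell is marked as read. -/
def marked (c : ℕ → Option (WCell Y)) (p : ℕ) : Bool := (c p).elim false Prod.snd

/-- The two stream symbols of a cell which is full. -/
def content : WSym Y → Option (Y × Y)
  | .full y z => some (y, z)
  | _ => none

/-- A cell marks the end of a round (`none`), or it is a candidate for storing. -/
def tagAt (k : Option (WSym Y)) (p : ℕ) : Option ℕ :=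
  match k with
  | some .turn => none
  | _ => some p

/-- The tags of the cells `1, …, V`. -/
def tags (K : ℕ → Option (WSym Y)) (V : ℕ) : List (Option ℕ) :=
  (List.range V).map fun i => tagAt (K (i + 1)) (i + 1)

theorem tagAt_eq_none {k : Option (WSym Y)} {p : ℕ} : tagAt k p = none ↔ k = some .turn := by
  rcases k with _ | (_ | _ | _ | _) <;> simp [tagAt]

theorem tagAt_of_ne {k : Option (WSym Y)} (h : k ≠ some .turn) (p : ℕ) : tagAt k p = some p := by
  rcases k with _ | (_ | _ | _ | _) <;> simp_all [tagAt]

theorem tags_succ (K : ℕ → Option (WSym Y)) (V : ℕ) :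
    tags K (V + 1) = tags K V ++ [tagAt (K (V + 1)) (V + 1)] := by
  simp [tags, List.range_succ]

/-- Tags see only the turning marks. Storing symbols therefore leaves the assignment of cells to
rounds untouched. -/
theorem tags_congr {K K' : ℕ → Option (WSym Y)} {V : ℕ}
    (h : ∀ p, 1 ≤ p → p ≤ V → (K p = some .turn ↔ K' p = some .turn)) :
    tags K V = tags K' V := by
  refine List.map_congr_left fun i hi => ?_
  have h := h (i + 1) (by omega) (by have := List.mem_range.1 hi; omega)
  by_cases h' : K (i + 1) = some .turn
  · rw [tagAt_eq_none.2 h', tagAt_eq_none.2 (h.1 h')]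
  · rw [tagAt_of_ne h', tagAt_of_ne (mt h.2 h')]

theorem mem_tags {K : ℕ → Option (WSym Y)} {V p : ℕ} :
    some p ∈ tags K V ↔ 1 ≤ p ∧ p ≤ V ∧ K p ≠ some .turn := by
  simp only [tags, List.mem_map, List.mem_range]
  constructor
  · rintro ⟨i, hi, h⟩
    by_cases h' : K (i + 1) = some .turn
    · rw [tagAt_eq_none.2 h'] at h; simp at h
    · rw [tagAt_of_ne h'] at h
      obtain rfl : i + 1 = p := by simpa using h
      exact ⟨by omega, by omega, h'⟩
  · rintro ⟨h1, h2, h3⟩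
    obtain ⟨i, rfl⟩ : ∃ i, p = i + 1 := ⟨p - 1, by omega⟩
    exact ⟨i, by omega, tagAt_of_ne h3 _⟩

theorem tags_prefix (K : ℕ → Option (WSym Y)) {V V' : ℕ} (h : V ≤ V') :
    tags K V <+: tags K V' := by
  induction V', h using Nat.le_induction with
  | base => exact List.prefix_rfl
  | succ n _ ih => rw [tags_succ]; exact ih.trans (List.prefix_append _ _)

theorem length_tags (K : ℕ → Option (WSym Y)) (V : ℕ) : (tags K V).length = V := by
  simp [tags]

theorem sorted_tags (K : ℕ → Option (WSym Y)) (V : ℕ) :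
    (tags K V).reduceOption.Pairwise (· < ·) := by
  induction V with
  | zero => simp [tags]
  | succ V ih =>
    rw [tags_succ, List.reduceOption_append, List.pairwise_append]
    refine ⟨ih, ?_, ?_⟩
    · by_cases h : K (V + 1) = some .turn
      · simp [tagAt_eq_none.2 h]
      · simp [tagAt_of_ne h]
    · intro a ha b hb
      rw [List.reduceOption_mem_iff] at ha hb
      have h1 := (mem_tags.1 ha).2.1
      by_cases h : K (V + 1) = some .turn
      · rw [tagAt_eq_none.2 h] at hb; simp at hb
      · rw [tagAt_of_ne h] at hb
        have : b = V + 1 := by simpa using hb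
        omega

variable [Inhabited Y]

/-- The symbol on the first track of a cell. -/
def fstAt (K : ℕ → Option (WSym Y)) (p : ℕ) : Y :=
  match K p with
  | some (.half y) => y
  | some (.full y _) => y
  | _ => default

/-- The symbol on the second track of a cell. -/
def sndAt (K : ℕ → Option (WSym Y)) (p : ℕ) : Y :=
  match K p with
  | some (.full _ z) => z
  | _ => default

theorem fstAt_congr {K K' : ℕ → Option (WSym Y)} {p : ℕ} (h : K p = K' p) :
    fstAt K p = fstAt K' p := by simp [fstAt, h]

theorem sndAt_congr {K K' : ℕ → Option (WSym Y)} {p : ℕ} (h : K p = K' p) :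
    sndAt K p = sndAt K' p := by simp [sndAt, h]

/-- A bound for the distance of available cells after `s` rounds. -/
def gapSize (s : ℕ) : ℕ := 2 ^ (s + 1) - 1

theorem gapSize_pos (s : ℕ) : 1 ≤ gapSize s := by
  have := Nat.one_lt_two_pow (n := s + 1) (by omega)
  unfold gapSize; omega

/-- Dropping every second available cell merges two windows, and the turning mark adds one cell to
the visited region: hence twice the size plus one. -/
theorem gapSize_succ (s : ℕ) : gapSize (s + 1) = 2 * gapSize s + 1 := by
  have := Nat.one_lt_two_pow (n := s + 1) (by omega)
  unfold gapSize; rw [pow_succ 2 (s + 1)]; omega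

/-- Bookkeeping data: the number `V` of visited cells, the number `m` of cells that have been read, the
remaining candidates, the classes of the completed rounds, and the cells which have been (`D`) or have
yet to be (`todo`) considered in the current pass; when moving left, `D` and `todo` are the cells of
the last class that have to be filled, and those that have been filled. -/
structure Ghost where
  V : ℕ
  m : ℕ
  cur : List ℕ
  cls : List (List ℕ)
  D : List ℕ
  todo : List ℕ

/-- The visited region and its candidates and classes. -/
structure Layout (K : ℕ → Option (WSym Y)) (G : Ghost) : Prop where
  sieve_eq : sieve (tags K G.V) = (G.cur, G.cls)
  blank : ∀ p, G.V < p → K p = none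
  gap : ∀ q, 1 ≤ q → q + gapSize G.cls.length ≤ G.V + 1 →
    ∃ p ∈ G.cur, q ≤ p ∧ p < q + gapSize G.cls.length
  nonempty : ∀ c ∈ G.cls, c ≠ []

/-- The situation on the work tape while moving right. -/
structure RightCore (K : ℕ → Option (WSym Y)) (h : ℕ) (ph : Phase) (st : List Y) (G : Ghost) :
    Prop extends Layout K G where
  cur_eq : G.cur = G.D ++ G.todo
  D_lt : ∀ p ∈ G.D, p < h
  todo_ge : ∀ p ∈ G.todo, h ≤ p
  head_le : h ≤ G.V + 1
  parity : Even G.D.length ↔ ph = .put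
  half : ∀ p ∈ (alternate G.D).1, ∃ y, K p = some (.half y)
  free_D : ∀ p ∈ (alternate G.D).2, K p = some .free
  free_todo : ∀ p ∈ G.todo, K p = some .free
  full : ∀ c ∈ G.cls, ∀ p ∈ c, ∃ y z, K p = some (.full y z)
  stream : readOut (fstAt K) (sndAt K) G.cls ++ (alternate G.D).1.map (fstAt K) = st

/-- The situation on the work tape while moving left. -/
structure LeftCore (K : ℕ → Option (WSym Y)) (h : ℕ) (st : List Y) (G : Ghost)
    (cls : List (List ℕ)) : Prop extends Layout K G where
  cls_eq : G.cls = cls ++ [G.D ++ G.todo]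
  sorted : (G.D ++ G.todo).Pairwise (· < ·)
  D_le : ∀ p ∈ G.D, p ≤ h
  todo_gt : ∀ p ∈ G.todo, h < p
  head_le : h ≤ G.V
  half : ∀ p ∈ G.D, ∃ y, K p = some (.half y)
  full_todo : ∀ p ∈ G.todo, ∃ y z, K p = some (.full y z)
  free : ∀ p ∈ G.cur, K p = some .free
  full : ∀ c ∈ cls, ∀ p ∈ c, ∃ y z, K p = some (.full y z)
  gap_last : ∀ q, 1 ≤ q → q + gapSize G.cls.length ≤ G.V + 1 →
    ∃ p ∈ G.D ++ G.todo, q ≤ p ∧ p < q + gapSize G.cls.length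
  stream : readOut (fstAt K) (sndAt K) cls ++ (G.D ++ G.todo).map (fstAt K)
    ++ (G.todo.map (sndAt K)).reverse = st

/-- The cells that have been read, and the answers. -/
structure Marks (c : ℕ → Option (WCell Y)) (G : Ghost) (rs : List (Resp Y)) : Prop where
  m_le : G.m ≤ G.V
  marked_iff : ∀ p, 1 ≤ p → (marked c p = true ↔ p ≤ G.m)
  closed : ∀ p, 1 ≤ p → p ≤ G.m →
    kind c p = some .turn ∨ ∃ y z, kind c p = some (.full y z)
  answers : rs.reduceOption = (List.range G.m).map fun i => (kind c (i + 1)).bind content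

/-! ### The way right: which cell is under the head, and how it is used -/

section Core

variable {K : ℕ → Option (WSym Y)} {h : ℕ} {ph : Phase} {st : List Y} {G : Ghost}

omit [Inhabited Y] in
theorem Layout.mem_or (L : Layout K G) {p : ℕ} (h1 : 1 ≤ p) (h2 : p ≤ G.V) :
    K p = some .turn ∨ p ∈ G.cur ∨ ∃ c ∈ G.cls, p ∈ c := by
  by_cases h : K p = some .turn
  · exact Or.inl h
  · have := mem_sieve.1 (mem_tags.2 ⟨h1, h2, h⟩)
    rw [L.sieve_eq] at this
    exact Or.inr this

omit [Inhabited Y] in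
theorem Layout.of_mem (L : Layout K G) {p : ℕ} (h : p ∈ G.cur ∨ ∃ c ∈ G.cls, p ∈ c) :
    1 ≤ p ∧ p ≤ G.V ∧ K p ≠ some .turn := by
  refine mem_tags.1 (mem_sieve.2 ?_)
  rw [L.sieve_eq]
  exact h

omit [Inhabited Y] in
theorem Layout.sorted_cur (L : Layout K G) : G.cur.Pairwise (· < ·) := by
  have h := (sorted_tags K G.V).sublist (sieve_sublist _)
  rwa [L.sieve_eq] at h

/-- The head can stand on the left end, on a cell of no further use, on the next available cell, or
on the first unvisited one. An available cell under the head is the first of `todo`, because `todo`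
is sorted and does not reach behind the head. -/
theorem RightCore.cases (I : RightCore K h ph st G) :
    h = 0 ∨ (1 ≤ h ∧ h ≤ G.V ∧ h ∉ G.cur ∧ (K h = some .turn ∨ ∃ y z, K h = some (.full y z))) ∨
    (1 ≤ h ∧ h ≤ G.V ∧ K h = some .free ∧ G.todo = h :: G.todo.tail) ∨
    (1 ≤ h ∧ h = G.V + 1 ∧ K h = none ∧ G.todo = []) := by
  rcases Nat.eq_zero_or_pos h with h0 | h0
  · exact Or.inl h0
  refine Or.inr ?_
  rcases Nat.lt_or_ge G.V h with h1 | h1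
  · have h2 : h = G.V + 1 := le_antisymm I.head_le h1
    refine Or.inr (Or.inr ⟨h0, h2, I.blank _ h1, ?_⟩)
    rw [List.eq_nil_iff_forall_not_mem]
    intro p hp
    have h3 := I.todo_ge p hp
    have h4 := (I.of_mem (Or.inl (by rw [I.cur_eq]; simp [hp]) : p ∈ G.cur ∨ _)).2.1
    omega
  by_cases hc : h ∈ G.cur
  · refine Or.inr (Or.inl ⟨h0, h1, ?_⟩)
    have hm : h ∈ G.todo := by
      rw [I.cur_eq, List.mem_append] at hc
      exact hc.resolve_left fun h' => absurd (I.D_lt _ h') (lt_irrefl _)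
    refine ⟨I.free_todo _ hm, ?_⟩
    have hs := I.sorted_cur
    rw [I.cur_eq] at hs
    have hs := (List.pairwise_append.1 hs).2.1
    have hge := I.todo_ge
    generalize G.todo = l at hm hs hge
    cases l with
    | nil => simp at hm
    | cons a l =>
      rcases List.mem_cons.1 hm with rfl | h'
      · rfl
      · have h2 := (List.pairwise_cons.1 hs).1 _ h'
        have h3 := hge a (by simp)
        omega
  · refine Or.inl ⟨h0, h1, hc, ?_⟩
    rcases I.mem_or h0 h1 with h' | h' | ⟨c, hc', h'⟩
    · exact Or.inl h'
    · exact absurd h' hc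
    · exact Or.inr (I.full c hc' h h')

theorem RightCore.advance (I : RightCore K h ph st G) (h1 : h ≤ G.V) (h2 : h ∉ G.cur) :
    RightCore K (h + 1) ph st G :=
  { I with
    D_lt := fun p hp => (I.D_lt p hp).trans (Nat.lt_succ_self h)
    todo_ge := fun p hp => by
      have h3 := I.todo_ge p hp
      have h4 : p ≠ h := by
        rintro rfl
        exact h2 (by rw [I.cur_eq]; simp [hp])
      omega
    head_le := by omega }

/-- The bookkeeping data after the cell `h` has been used or skipped. -/
def Ghost.use (G : Ghost) (h : ℕ) : Ghost :=
  { G with V := max G.V h, cur := G.D ++ [h] ++ G.todo.tail, D := G.D ++ [h], todo := G.todo.tail }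

/-- Writing on an available visited cell changes no tag. Writing on the first blank appends one
candidate at the end, and this candidate serves the only new window of the density condition. -/
theorem RightCore.layout_use (I : RightCore K h ph st G) (h0 : 1 ≤ h)
    (hh : (h ≤ G.V ∧ K h = some .free ∧ G.todo = h :: G.todo.tail) ∨
      (h = G.V + 1 ∧ K h = none ∧ G.todo = []))
    {z : WSym Y} (hz : z ≠ .turn) :
    Layout (Function.update K h (some z)) (G.use h) ∧
      tags K G.V <+: tags (Function.update K h (some z)) (G.use h).V := by
  have htag : tags (Function.update K h (some z)) G.V = tags K G.V := by
    refine tags_congr fun p _ _ => ?_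
    rcases eq_or_ne p h with rfl | hp
    · have : K p ≠ some .turn := by rcases hh with ⟨_, h, _⟩ | ⟨_, h, _⟩ <;> simp [h]
      simp [this, hz]
    · rw [Function.update_of_ne hp]
  rcases hh with ⟨h1, h2, h3⟩ | ⟨h1, h2, h3⟩
  · have hV : (G.use h).V = G.V := max_eq_left h1
    have hc : (G.use h).cur = G.cur := by
      rw [I.cur_eq, h3]; simp [Ghost.use]
    refine ⟨⟨?_, ?_, ?_, I.nonempty⟩, ?_⟩
    · rw [hV, hc, htag]; exact I.sieve_eq
    · intro p hp
      rw [hV] at hp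
      rw [Function.update_of_ne (by omega)]
      exact I.blank p hp
    · rw [hV, hc]; exact I.gap
    · rw [hV, htag]
  · have hV : (G.use h).V = G.V + 1 := by simp [Ghost.use, h1]
    have hc : (G.use h).cur = G.cur ++ [h] := by
      rw [I.cur_eq, h3]; simp [Ghost.use, h3]
    have ht : tags (Function.update K h (some z)) (G.V + 1) = tags K G.V ++ [some h] := by
      rw [tags_succ, htag, ← h1, Function.update_self, tagAt_of_ne (by simpa using hz)]
    refine ⟨⟨?_, ?_, ?_, I.nonempty⟩, ?_⟩
    · rw [hV, hc, ht, sieve_concat_some, I.sieve_eq]; rfl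
    · intro p hp
      rw [hV] at hp
      rw [Function.update_of_ne (by omega)]
      exact I.blank p (by omega)
    · intro q hq hq'
      rw [hV] at hq'
      rw [hc]
      change q + gapSize G.cls.length ≤ _ at hq'
      change ∃ p ∈ _, q ≤ p ∧ p < q + gapSize G.cls.length
      have := gapSize_pos G.cls.length
      by_cases hq2 : q + gapSize G.cls.length ≤ G.V + 1
      · obtain ⟨p, hp, hp'⟩ := I.gap q hq hq2
        exact ⟨p, by simp [hp], hp'⟩
      · exact ⟨h, by simp, by omega, by omega⟩
    · rw [hV, ht]; exact List.prefix_append _ _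

/-- The parity of `D` alternates with the phase. A cell taken at even parity receives a symbol and
joins the first alternating sublist, the coming class; one taken at odd parity stays free and joins
the second, the candidates of the next round. Members of earlier classes are full, so they are not
overwritten. -/
theorem RightCore.use (I : RightCore K h ph st G) (h0 : 1 ≤ h)
    (hh : (h ≤ G.V ∧ K h = some .free ∧ G.todo = h :: G.todo.tail) ∨
      (h = G.V + 1 ∧ K h = none ∧ G.todo = [])) (y : Y) :
    (ph = .put → RightCore (Function.update K h (some (.half y))) (h + 1) .skip (st ++ [y]) (G.use h)) ∧
    (ph = .skip → RightCore (Function.update K h (some .free)) (h + 1) .put st (G.use h)) := by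
  have hne : ∀ {z : WSym Y} {p}, K p ≠ K h → Function.update K h (some z) p = K p := by
    intro z p hp
    rw [Function.update_of_ne]
    rintro rfl
    exact hp rfl
  have hKh : K h = some .free ∨ K h = none := by
    rcases hh with ⟨_, h, _⟩ | ⟨_, h, _⟩ <;> simp [h]
  have hD : ∀ {z : WSym Y} {p}, p ∈ G.D → Function.update K h (some z) p = K p := by
    intro z p hp
    rw [Function.update_of_ne (I.D_lt p hp).ne]
  have hfull : ∀ {z : WSym Y}, ∀ c ∈ G.cls, ∀ p ∈ c, Function.update K h (some z) p = K p := by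
    intro z c hc p hp
    obtain ⟨y, z, h⟩ := I.full c hc p hp
    refine hne ?_
    rcases hKh with h' | h' <;> simp [h, h']
  have hD1 := fun {p} (hp : p ∈ (alternate G.D).1) => (alternate_sublist G.D).1.subset hp
  have hD2 := fun {p} (hp : p ∈ (alternate G.D).2) => (alternate_sublist G.D).2.subset hp
  have htl : ∀ {p}, p ∈ G.todo.tail → p ∈ G.todo := fun hp => List.mem_of_mem_tail hp
  have htl' : ∀ {p}, p ∈ G.todo.tail → h < p := by
    intro p hp
    have hs := I.sorted_cur
    rw [I.cur_eq] at hs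
    have hs := (List.pairwise_append.1 hs).2.1
    rcases hh with ⟨_, _, h'⟩ | ⟨_, _, h'⟩
    · rw [h', List.pairwise_cons] at hs
      exact hs.1 p hp
    · simp [h'] at hp
  have hout : ∀ z : WSym Y, readOut (fstAt (Function.update K h (some z)))
      (sndAt (Function.update K h (some z))) G.cls = readOut (fstAt K) (sndAt K) G.cls := by
    intro z
    exact readOut_congr fun c hc p hp =>
      ⟨fstAt_congr (hfull c hc p hp), sndAt_congr (hfull c hc p hp)⟩
  have hmap : ∀ z : WSym Y, (alternate G.D).1.map (fstAt (Function.update K h (some z)))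
      = (alternate G.D).1.map (fstAt K) := by
    intro z
    exact List.map_congr_left fun p hp => fstAt_congr (hD (hD1 hp))
  have hle : h + 1 ≤ (G.use h).V + 1 := by
    have : h ≤ max G.V h := le_max_right _ _
    exact Nat.succ_le_succ this
  constructor
  · rintro rfl
    have he := I.parity.2 rfl
    have ha : alternate (G.D ++ [h]) = ((alternate G.D).1 ++ [h], (alternate G.D).2) := by
      rw [alternate_append, if_pos he]; simp
    refine ⟨(I.layout_use h0 hh (by simp)).1, rfl, ?_, ?_, hle, ?_, ?_, ?_, ?_, ?_, ?_⟩
    · intro p hp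
      rcases List.mem_append.1 hp with hp | hp
      · exact (I.D_lt p hp).trans (Nat.lt_succ_self h)
      · have : p = h := by simpa using hp
        omega
    · exact fun p hp => htl' hp
    · simp [Ghost.use, Nat.even_add_one, he]
    · change ∀ p ∈ (alternate (G.D ++ [h])).1, _
      rw [ha]
      intro p hp
      rcases List.mem_append.1 hp with hp | hp
      · rw [hD (hD1 hp)]; exact I.half p hp
      · obtain rfl : p = h := by simpa using hp
        exact ⟨y, by simp⟩
    · change ∀ p ∈ (alternate (G.D ++ [h])).2, _
      rw [ha]
      intro p hp
      rw [hD (hD2 hp)]; exact I.free_D p hp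
    · intro p hp
      rw [Function.update_of_ne (htl' hp).ne']
      exact I.free_todo p (htl hp)
    · intro c hc p hp
      rw [hfull c hc p hp]; exact I.full c hc p hp
    · change readOut _ _ G.cls ++ (alternate (G.D ++ [h])).1.map _ = _
      rw [ha, hout, ← I.stream, List.map_append, hmap, List.append_assoc]
      simp [fstAt]
  · rintro rfl
    have he : ¬ Even G.D.length := fun h => by simpa using I.parity.1 h
    have ha : alternate (G.D ++ [h]) = ((alternate G.D).1, (alternate G.D).2 ++ [h]) := by
      rw [alternate_append, if_neg he]; simp
    refine ⟨(I.layout_use h0 hh (by simp)).1, rfl, ?_, ?_, hle, ?_, ?_, ?_, ?_, ?_, ?_⟩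
    · intro p hp
      rcases List.mem_append.1 hp with hp | hp
      · exact (I.D_lt p hp).trans (Nat.lt_succ_self h)
      · have : p = h := by simpa using hp
        omega
    · exact fun p hp => htl' hp
    · simp [Ghost.use, Nat.even_add_one, he]
    · change ∀ p ∈ (alternate (G.D ++ [h])).1, _
      rw [ha]
      intro p hp
      rw [hD (hD1 hp)]; exact I.half p hp
    · change ∀ p ∈ (alternate (G.D ++ [h])).2, _
      rw [ha]
      intro p hp
      rcases List.mem_append.1 hp with hp | hp
      · rw [hD (hD2 hp)]; exact I.free_D p hp
      · obtain rfl : p = h := by simpa using hp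
        simp
    · intro p hp
      rw [Function.update_of_ne (htl' hp).ne']
      exact I.free_todo p (htl hp)
    · intro c hc p hp
      rw [hfull c hc p hp]; exact I.full c hc p hp
    · change readOut _ _ G.cls ++ (alternate (G.D ++ [h])).1.map _ = _
      rw [ha, hout, ← I.stream, hmap]

end Core

end WorkTape

end AutoLearn

namespace AutoLearn

/-! ### Marks, answers, and the steps of the head to the right -/

section WorkRuns

variable {P Y : Type}

theorem kind_update (c : ℕ → Option (WCell Y)) (h : ℕ) (z : WSym Y) (b : Bool) :
    kind (Function.update c h (some (z, b))) = Function.update (kind c) h (some z) := by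
  funext p
  rcases eq_or_ne p h with rfl | hp
  · simp [kind]
  · simp [kind, Function.update_of_ne hp]

theorem marked_update_self (c : ℕ → Option (WCell Y)) (h : ℕ) (z : WSym Y) (b : Bool) :
    marked (Function.update c h (some (z, b))) h = b := by
  simp [marked]

theorem marked_update_of_ne (c : ℕ → Option (WCell Y)) {h p : ℕ} (hp : p ≠ h)
    (x : Option (WCell Y)) : marked (Function.update c h x) p = marked c p := by
  simp [marked, Function.update_of_ne hp]

theorem Tape.read_zero {Γ : Type*} {t : Tape Γ} (h : t.head = 0) : t.read = Cell.leftEnd := by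
  simp [Tape.read, h]

theorem Tape.read_none {Γ : Type*} {t : Tape Γ} (h : 1 ≤ t.head) (h' : t.cell t.head = none) :
    t.read = Cell.blank := by
  simp [Tape.read, Nat.one_le_iff_ne_zero.1 h, h']

theorem Tape.read_some {Γ : Type*} {t : Tape Γ} {a : Γ} (h : 1 ≤ t.head)
    (h' : t.cell t.head = some a) : t.read = Cell.sym a := by
  simp [Tape.read, Nat.one_le_iff_ne_zero.1 h, h']

theorem Tape.act_cell {Γ : Type*} {t : Tape Γ} (h : 1 ≤ t.head) (s : Option Γ) (d : Move) :
    (t.act s d).cell = Function.update t.cell t.head s := by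
  simp [Tape.act, Nat.one_le_iff_ne_zero.1 h]

theorem Tape.act_cell_zero {Γ : Type*} {t : Tape Γ} (h : t.head = 0) (s : Option Γ) (d : Move) :
    (t.act s d).cell = t.cell := by
  simp [Tape.act, h]

theorem Tape.act_cell_keep {Γ : Type*} {t : Tape Γ} {s : Option Γ} (h : t.cell t.head = s) (d : Move) :
    (t.act s d).cell = t.cell := by
  subst h
  simp [Tape.act]

theorem Ctl.answer_of_ne {entry : Resp Y → P} {ct : Ctl P} (h : ct ≠ .right) (r : Resp Y) :
    ct.answer entry r = ct := by
  cases ct <;> simp_all [Ctl.answer]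

theorem Ctl.isRight_of_ne {ct : Ctl P} (h : ct ≠ .right) : ct.isRight = false := by
  cases ct <;> simp_all [Ctl.isRight]

theorem kind_some {c : ℕ → Option (WCell Y)} {p : ℕ} {z : WSym Y} (h : kind c p = some z) :
    ∃ b, c p = some (z, b) := by
  rcases hc : c p with _ | ⟨z', b⟩
  · simp [kind, hc] at h
  · simp only [kind, hc, Option.map_some, Option.some.injEq] at h
    exact ⟨b, by rw [h]⟩

theorem kind_none {c : ℕ → Option (WCell Y)} {p : ℕ} (h : kind c p = none) : c p = none := by
  simpa [kind] using h

/-- Only the cells `1, …, m` matter for the answers, so a write beyond them is harmless. -/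
theorem Marks.update {c : ℕ → Option (WCell Y)} {G G' : Ghost} {rs : List (Resp Y)}
    (M : Marks c G rs) {h : ℕ} (hh : G.m < h) (hm : G'.m = G.m) (hV : G.V ≤ G'.V) (z : WSym Y) :
    Marks (Function.update c h (some (z, false))) G' rs := by
  refine ⟨?_, ?_, ?_, ?_⟩
  · rw [hm]; exact M.m_le.trans hV
  · intro p hp
    rw [hm]
    rcases eq_or_ne p h with rfl | h'
    · simp [marked_update_self, hh]
    · rw [marked_update_of_ne _ h']; exact M.marked_iff p hp
  · intro p hp hp'
    rw [hm] at hp'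
    rw [kind_update, Function.update_of_ne (by omega)]
    exact M.closed p hp hp'
  · rw [M.answers, hm]
    refine List.map_congr_left fun i hi => ?_
    rw [kind_update, Function.update_of_ne]
    have := List.mem_range.1 hi
    omega

/-- The situation while moving right, with marks and answers. -/
structure RightInv [Inhabited Y] (ct : Ctl P) (ph : Phase) (t : Tape (WCell Y)) (st : List Y)
    (rs : List (Resp Y)) (G : Ghost) : Prop where
  core : RightCore (kind t.cell) t.head ph st G
  marks : Marks t.cell G rs
  ct_ne : ct ≠ .left
  right_le : ct = .right → t.head ≤ G.m + 1
  count_right : ct = .right → rs.length + 1 = G.cls.length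
  count : ct ≠ .right → rs.length = G.cls.length

/-- The situation while moving left, with marks and answers. -/
structure LeftInv [Inhabited Y] (t : Tape (WCell Y)) (st : List Y)
    (rs : List (Resp Y)) (G : Ghost) : Prop where
  core : ∃ cls, LeftCore (kind t.cell) t.head st G cls
  marks : Marks t.cell G rs
  count : rs.length + 1 = G.cls.length

/-- How control state and answers develop while a symbol is stored. -/
structure Evolves (entry : Resp Y → P) (ct : Ctl P) (rs : List (Resp Y)) (t : Tape (WCell Y))
    (G : Ghost) (ct' : Ctl P) (rs' : List (Resp Y)) (t' : Tape (WCell Y)) (G' : Ghost) : Prop where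
  cls_eq : G'.cls = G.cls
  V_le : G.V ≤ G'.V
  tags_le : tags (kind t.cell) G.V <+: tags (kind t'.cell) G'.V
  cur_sub : ∀ p ∈ G.cur, p ∈ G'.cur
  ev : (ct' = ct ∧ rs' = rs ∧ G'.m = G.m) ∨
    (ct = .left ∧ ct' = .right ∧ rs' = rs ∧ G'.m = G.m) ∨
    ((ct = .left ∨ ct = .right) ∧ ∃ r, ct' = .run (entry r) ∧ rs' = rs ++ [r] ∧
      (r = none → G'.m = G.m ∧ G.m + 1 ∈ G'.cur) ∧ (r ≠ none → G'.m = G.m + 1))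
  deficit : ct ≠ .left → G'.V + 1 - t'.head ≤ G.V + 1 - t.head - 1

/-- Successive pieces yield at most one answer: an answer puts the control into a state of the
background program, which no storing step leaves. -/
theorem Evolves.trans {entry : Resp Y → P} {ct rs t G ct' rs' t' G' ct'' rs'' t'' G''}
    (h : Evolves entry ct rs t G ct' rs' t' G')
    (h' : Evolves entry ct' rs' t' G' ct'' rs'' t'' G'') :
    Evolves entry ct rs t G ct'' rs'' t'' G'' := by
  refine ⟨h'.cls_eq.trans h.cls_eq, h.V_le.trans h'.V_le, h.tags_le.trans h'.tags_le,
    fun p hp => h'.cur_sub p (h.cur_sub p hp), ?_, ?_⟩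
  · rcases h.ev with ⟨h1, h2, h3⟩ | ⟨h0, h1, h2, h3⟩ | ⟨h0, r, h1, h2, h3, h4⟩
    · rcases h'.ev with ⟨k1, k2, k3⟩ | ⟨k0, k1, k2, k3⟩ | ⟨k0, r, k1, k2, k3, k4⟩
      · exact Or.inl ⟨k1.trans h1, k2.trans h2, k3.trans h3⟩
      · exact Or.inr (Or.inl ⟨h1 ▸ k0, k1, k2.trans h2, k3.trans h3⟩)
      · exact Or.inr (Or.inr ⟨h1 ▸ k0, r, k1, h2 ▸ k2, h3 ▸ k3, h3 ▸ k4⟩)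
    · subst h1
      rcases h'.ev with ⟨k1, k2, k3⟩ | ⟨k0, k1, k2, k3⟩ | ⟨k0, r, k1, k2, k3, k4⟩
      · exact Or.inr (Or.inl ⟨h0, k1, k2.trans h2, k3.trans h3⟩)
      · cases k0
      · exact Or.inr (Or.inr ⟨Or.inl h0, r, k1, h2 ▸ k2, h3 ▸ k3, h3 ▸ k4⟩)
    · subst h1
      rcases h'.ev with ⟨k1, k2, k3⟩ | ⟨k0, k1, k2, k3⟩ | ⟨k0, r', k1, k2, k3, k4⟩
      · exact Or.inr (Or.inr ⟨h0, r, k1, k2.trans h2,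
          fun hr => ⟨k3.trans (h3 hr).1, h'.cur_sub _ (h3 hr).2⟩, fun hr => k3.trans (h4 hr)⟩)
      · cases k0
      · rcases k0 with k0 | k0 <;> cases k0
  · intro hct
    have hct' : ct' ≠ .left := by
      rcases h.ev with ⟨h1, _⟩ | ⟨_, h1, _⟩ | ⟨_, r, h1, _⟩
      · rwa [h1]
      · simp [h1]
      · simp [h1]
    have h1 := h.deficit hct
    have h2 := h'.deficit hct'
    omega

variable [Inhabited Y]

theorem RightCore.set_m {K : ℕ → Option (WSym Y)} {h : ℕ} {ph : Phase} {st : List Y} {G : Ghost}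
    (I : RightCore K h ph st G) (m : ℕ) : RightCore K h ph st { G with m := m } :=
  ⟨⟨I.sieve_eq, I.blank, I.gap, I.nonempty⟩, I.cur_eq, I.D_lt, I.todo_ge, I.head_le, I.parity, I.half,
    I.free_D, I.free_todo, I.full, I.stream⟩

omit [Inhabited Y] in
-- The cell just after the read ones is read, so these remain an initial segment; it has to be
-- closed in order that the recorded content is its final one.
theorem Marks.mark {c : ℕ → Option (WCell Y)} {G : Ghost} {rs : List (Resp Y)}
    (M : Marks c G rs) {z : WSym Y} (hz : z = .turn ∨ ∃ y y', z = .full y y')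
    (hc : kind c (G.m + 1) = some z) (hV : G.m + 1 ≤ G.V) :
    Marks (Function.update c (G.m + 1) (some (z, true))) { G with m := G.m + 1 }
      (rs ++ [some (content z)]) := by
  have hk : kind (Function.update c (G.m + 1) (some (z, true))) = kind c := by
    rw [kind_update, ← hc, Function.update_eq_self]
  refine ⟨hV, ?_, ?_, ?_⟩
  · intro p hp
    change _ ↔ p ≤ G.m + 1
    rcases eq_or_ne p (G.m + 1) with rfl | h'
    · simp [marked_update_self]
    · rw [marked_update_of_ne _ h', M.marked_iff p hp]; omega
  · intro p hp hp'
    change p ≤ G.m + 1 at hp'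
    rw [hk]
    rcases eq_or_ne p (G.m + 1) with rfl | h'
    · rw [hc]
      rcases hz with rfl | ⟨y, y', rfl⟩
      · exact Or.inl rfl
      · exact Or.inr ⟨y, y', rfl⟩
    · exact M.closed p hp (by omega)
  · rw [hk, List.reduceOption_append, M.answers, List.range_succ]
    simp [hc, List.reduceOption]

/-- Passing a cell which holds no candidate. -/
theorem RightInv.pass {ct : Ctl P} {ph : Phase} {t : Tape (WCell Y)} {st : List Y}
    {rs : List (Resp Y)} {G : Ghost} (I : RightInv ct ph t st rs G) (entry : Resp Y → P)
    (h0 : 1 ≤ t.head) (h1 : t.head ≤ G.V) (h2 : t.head ∉ G.cur) {z : WSym Y} {b : Bool}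
    (hz : z = .turn ∨ ∃ y y', z = .full y y') (hc : t.cell t.head = some (z, b)) :
    ∃ rs' G', Evolves entry ct rs t G
        (bif b then ct else ct.answer entry (some (content z))) rs'
        (t.act (some (z, b || ct.isRight)) .right) G' ∧
      RightInv (bif b then ct else ct.answer entry (some (content z))) ph
        (t.act (some (z, b || ct.isRight)) .right) st rs' G' ∧
      G'.cur = G.cur ∧ G'.V = G.V ∧ G'.cls = G.cls := by
  have hkc : kind t.cell t.head = some z := by simp [kind, hc]
  -- Either the cell has been read before, or nothing is being looked for; then the step only moves
  -- the head.
  by_cases hb : b = true ∨ ct ≠ .right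
  · have h3 : (bif b then ct else ct.answer entry (some (content z))) = ct := by
      rcases hb with rfl | hb
      · rfl
      · rw [Ctl.answer_of_ne hb]; simp
    have h4 : (b || ct.isRight) = b := by
      rcases hb with rfl | hb
      · rfl
      · rw [Ctl.isRight_of_ne hb]; simp
    rw [h3, h4]
    have hcell := Tape.act_cell_keep hc .right
    have hI : RightInv ct ph (t.act (some (z, b)) .right) st rs G := by
      refine ⟨?_, ?_, I.ct_ne, ?_, I.count_right, I.count⟩
      · rw [hcell]; exact I.core.advance h1 h2
      · rw [hcell]; exact I.marks
      · intro hct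
        have hbt : b = true := by rcases hb with h | h; exacts [h, absurd hct h]
        have : t.head ≤ G.m := (I.marks.marked_iff _ h0).1 (by simp [marked, hc, hbt])
        exact Nat.succ_le_succ this
    refine ⟨rs, G, ⟨rfl, le_rfl, ?_, fun p hp => hp, Or.inl ⟨rfl, rfl, rfl⟩, ?_⟩, hI, rfl, rfl, rfl⟩
    · rw [hcell]
    · intro _
      change _ - (t.head + 1) ≤ _
      omega
  · rw [not_or, Bool.not_eq_true, not_not] at hb
    obtain ⟨rfl, rfl⟩ := hb
    have hm : ¬ t.head ≤ G.m := by
      rw [← I.marks.marked_iff _ h0]; simp [marked, hc]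
    -- During the search the head is at most at `m + 1`, and an unmarked cell lies beyond `m`; so
    -- this is the next unread cell.
    have hm' : t.head = G.m + 1 := le_antisymm (I.right_le rfl) (by omega)
    have hcell := Tape.act_cell h0 (some (z, true)) .right
    have hk : kind (t.act (some (z, true)) .right).cell = kind t.cell := by
      rw [hcell, kind_update, ← hkc, Function.update_eq_self]
    refine ⟨rs ++ [some (content z)], { G with m := G.m + 1 },
      ⟨rfl, le_rfl, ?_, fun p hp => hp, Or.inr (Or.inr ⟨Or.inr rfl, _, rfl, rfl, by simp, by simp⟩), ?_⟩,
      ⟨?_, ?_, by simp [Ctl.answer], by simp [Ctl.answer], by simp [Ctl.answer], ?_⟩, rfl, rfl, rfl⟩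
    · change _ <+: tags (kind (t.act (some (z, true)) .right).cell) G.V
      rw [hk]
    · intro _
      change _ - (t.head + 1) ≤ _
      dsimp only
      omega
    · change RightCore (kind (t.act (some (z, true)) .right).cell) _ _ _ _
      rw [hk]
      exact (I.core.advance h1 h2).set_m _
    · change Marks (t.act (some (z, true)) .right).cell _ _
      rw [hcell, hm']
      exact I.marks.mark hz (hm' ▸ hkc) (hm' ▸ h1)
    · intro _
      simpa using I.count_right rfl

/-- Using or skipping an available cell. -/
theorem RightInv.use {ct : Ctl P} {ph : Phase} {t : Tape (WCell Y)} {st : List Y}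
    {rs : List (Resp Y)} {G : Ghost} (I : RightInv ct ph t st rs G) (entry : Resp Y → P) (y : Y)
    (h0 : 1 ≤ t.head)
    (hh : (t.head ≤ G.V ∧ kind t.cell t.head = some .free ∧ G.todo = t.head :: G.todo.tail) ∨
      (t.head = G.V + 1 ∧ kind t.cell t.head = none ∧ G.todo = [])) :
    ∃ rs', Evolves entry ct rs t G (ct.answer entry none) rs'
        (t.act (some (ph.place y).2) .right) (G.use t.head) ∧
      (ph = .put → RightInv (ct.answer entry none) .skip
        (t.act (some (ph.place y).2) .right) (st ++ [y]) rs' (G.use t.head)) ∧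
      (ph = .skip → RightInv (ct.answer entry none) .put
        (t.act (some (ph.place y).2) .right) st rs' (G.use t.head)) := by
  -- A free or blank cell is not closed, so it has not been read.
  have hm : G.m < t.head := by
    by_contra hcon
    have := I.marks.closed _ h0 (by omega)
    rcases hh with ⟨_, h, _⟩ | ⟨_, h, _⟩ <;> simp [h] at this
  obtain ⟨z, hz, hzt⟩ : ∃ z, (ph.place y).2 = (z, false) ∧ z ≠ WSym.turn := by
    cases ph
    · exact ⟨_, rfl, by simp⟩
    · exact ⟨_, rfl, by simp⟩
  have hcell := Tape.act_cell h0 (some (ph.place y).2) .right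
  have hk : kind (t.act (some (ph.place y).2) .right).cell
      = Function.update (kind t.cell) t.head (some z) := by
    rw [hcell, hz, kind_update]
  have hlay := (I.core.layout_use h0 hh hzt).2
  have hcore := I.core.use h0 hh y
  have hVle : G.V ≤ (G.use t.head).V := le_max_left _ _
  have hmarks : Marks (t.act (some (ph.place y).2) .right).cell (G.use t.head) rs := by
    rw [hcell, hz]
    exact I.marks.update (G' := G.use t.head) hm rfl hVle z
  have hdef : (G.use t.head).V + 1 - (t.head + 1) ≤ G.V + 1 - t.head - 1 := by
    have : (G.use t.head).V = max G.V t.head := rfl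
    have h2 : t.head ≤ G.V ∨ t.head = G.V + 1 := by
      rcases hh with ⟨h, _⟩ | ⟨h, _⟩ <;> simp [h]
    rcases h2 with h2 | h2
    · rw [this, max_eq_left h2]; omega
    · rw [this, max_eq_right (by omega)]; omega
  have hsub : ∀ p ∈ G.cur, p ∈ (G.use t.head).cur := by
    intro p hp
    change p ∈ G.D ++ [t.head] ++ G.todo.tail
    rw [I.core.cur_eq] at hp
    rcases hh with ⟨_, _, h⟩ | ⟨_, _, h⟩
    · rw [h] at hp; simpa using hp
    · rw [h] at hp; simp at hp; simp [hp]
  by_cases hct : ct = .right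
  · subst hct
    have hm' : t.head = G.m + 1 := le_antisymm (I.right_le rfl) (by omega)
    -- The answer `none` disappears under `reduceOption`: a round without a readable cell leaves the
    -- record unchanged.
    have hM' : Marks (t.act (some (ph.place y).2) .right).cell (G.use t.head) (rs ++ [none]) :=
      ⟨hmarks.m_le, hmarks.marked_iff, hmarks.closed, by
        rw [List.reduceOption_append, hmarks.answers]; simp⟩
    have hcnt : (rs ++ [(none : Resp Y)]).length = (G.use t.head).cls.length := by
      rw [List.length_append]; exact I.count_right rfl
    refine ⟨rs ++ [none], ⟨rfl, hVle, ?_, hsub,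
      Or.inr (Or.inr ⟨Or.inr rfl, none, rfl, rfl, fun _ => ⟨rfl, ?_⟩, by simp⟩), fun _ => hdef⟩, ?_, ?_⟩
    · rw [hk]; exact hlay
    · change _ ∈ G.D ++ [t.head] ++ G.todo.tail
      simp [hm']
    · rintro rfl
      refine ⟨?_, hM', by simp [Ctl.answer], by simp [Ctl.answer], by simp [Ctl.answer], fun _ => hcnt⟩
      rw [hk]; cases hz; exact hcore.1 rfl
    · rintro rfl
      refine ⟨?_, hM', by simp [Ctl.answer], by simp [Ctl.answer], by simp [Ctl.answer], fun _ => hcnt⟩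
      rw [hk]; cases hz; exact hcore.2 rfl
  · rw [Ctl.answer_of_ne hct]
    refine ⟨rs, ⟨rfl, hVle, ?_, hsub, Or.inl ⟨rfl, rfl, rfl⟩, fun _ => hdef⟩, ?_, ?_⟩
    · rw [hk]; exact hlay
    · rintro rfl
      refine ⟨?_, hmarks, I.ct_ne, fun h => absurd h hct, fun h => absurd h hct, fun _ => I.count hct⟩
      rw [hk]; cases hz; exact hcore.1 rfl
    · rintro rfl
      refine ⟨?_, hmarks, I.ct_ne, fun h => absurd h hct, fun h => absurd h hct, fun _ => I.count hct⟩
      rw [hk]; cases hz; exact hcore.2 rfl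

/-- One step to the right. -/
theorem RightInv.step {ct : Ctl P} {ph : Phase} {t : Tape (WCell Y)} {st : List Y}
    {rs : List (Resp Y)} {G : Ghost} (I : RightInv ct ph t st rs G) (entry : Resp Y → P) (y : Y) :
    ∃ ct' o s d rs' G', workAct entry ct ph y t.read = ((ct', o), s, d) ∧
      Evolves entry ct rs t G ct' rs' (t.act s d) G' ∧ G'.cls = G.cls ∧
      ((o = some ph ∧ RightInv ct' ph (t.act s d) st rs' G' ∧ (t.act s d).head = t.head + 1 ∧
          G'.cur = G.cur ∧ G'.V = G.V ∧ t.head ∉ G.cur ∧ t.head ≤ G.V) ∨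
        (ph = .put ∧ o = some .skip ∧ RightInv ct' .skip (t.act s d) (st ++ [y]) rs' G') ∨
        (ph = .skip ∧ o = none ∧ RightInv ct' .put (t.act s d) st rs' G' ∧ G'.D ≠ [])) := by
  rw [workAct_of_ne I.ct_ne]
  rcases I.core.cases with h0 | ⟨h0, h1, h2, h3⟩ | hh
  · have hn : t.head ∉ G.cur := fun h => by
      have := (I.core.of_mem (Or.inl h)).1
      omega
    have hcell := Tape.act_cell_zero h0 (none : Option (WCell Y)) .right
    refine ⟨ct, some ph, none, .right, rs, G, by rw [Tape.read_zero h0]; rfl,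
      ⟨rfl, le_rfl, by rw [hcell], fun p hp => hp, Or.inl ⟨rfl, rfl, rfl⟩, fun _ => ?_⟩, rfl,
      Or.inl ⟨rfl, ⟨?_, ?_, I.ct_ne, fun _ => ?_, I.count_right, I.count⟩, rfl, rfl, rfl, hn, by omega⟩⟩
    · change _ - (t.head + 1) ≤ _
      omega
    · rw [hcell]; exact I.core.advance (by omega) hn
    · rw [hcell]; exact I.marks
    · change t.head + 1 ≤ _
      omega
  · rcases h3 with h3 | ⟨z, z', h3⟩
    · obtain ⟨b, hb⟩ := kind_some h3
      obtain ⟨rs', G', hE, hI, hc, hV, hcls⟩ := I.pass entry h0 h1 h2 (Or.inl rfl) hb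
      exact ⟨_, _, _, _, rs', G', by rw [Tape.read_some h0 hb]; rfl, hE, hcls,
        Or.inl ⟨rfl, hI, rfl, hc, hV, h2, h1⟩⟩
    · obtain ⟨b, hb⟩ := kind_some h3
      obtain ⟨rs', G', hE, hI, hc, hV, hcls⟩ := I.pass entry h0 h1 h2 (Or.inr ⟨z, z', rfl⟩) hb
      exact ⟨_, _, _, _, rs', G', by rw [Tape.read_some h0 hb]; rfl, hE, hcls,
        Or.inl ⟨rfl, hI, rfl, hc, hV, h2, h1⟩⟩
  · have hh0 : 1 ≤ t.head := by rcases hh with h | h <;> exact h.1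
    have hh1 := hh.imp And.right And.right
    obtain ⟨rs', hE, hI1, hI2⟩ := I.use entry y hh0 hh1
    have hact : rightAct entry ct ph y t.read
        = ((ct.answer entry none, (ph.place y).1), some (ph.place y).2, .right) := by
      rcases hh1 with ⟨_, h, _⟩ | ⟨_, h, _⟩
      · obtain ⟨b, hb⟩ := kind_some h
        rw [Tape.read_some hh0 hb]; rfl
      · rw [Tape.read_none hh0 (kind_none h)]; rfl
    refine ⟨_, _, _, _, rs', _, hact, hE, rfl, Or.inr ?_⟩
    cases ph
    · exact Or.inl ⟨rfl, rfl, hI1 rfl⟩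
    · exact Or.inr ⟨rfl, rfl, hI2 rfl, by simp [Ghost.use]⟩

/-- An available cell lies less than `n` cells to the right. -/
def Near (n : ℕ) (G : Ghost) (h : ℕ) : Prop := (∃ p ∈ G.cur, h ≤ p ∧ p < h + n) ∨ G.V + 1 < h + n

/-- The window that starts one cell after the head contains an available cell, unless it sticks out
of the visited region; in that case the first blank is within reach. -/
theorem RightCore.near {K : ℕ → Option (WSym Y)} {h : ℕ} {ph : Phase} {st : List Y} {G : Ghost}
    (I : RightCore K h ph st G) : Near (gapSize G.cls.length + 1) G h := by
  by_cases hh : h + gapSize G.cls.length ≤ G.V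
  · obtain ⟨p, hp, h1, h2⟩ := I.gap (h + 1) (by omega) (by omega)
    exact Or.inl ⟨p, hp, by omega, by omega⟩
  · exact Or.inr (by omega)

theorem Near.next {n : ℕ} {G G' : Ghost} {h : ℕ} (hn : Near (n + 1) G h) (hc : G'.cur = G.cur)
    (hV : G'.V = G.V) (hh : h ∉ G.cur) : Near n G' (h + 1) := by
  rcases hn with ⟨p, hp, h1, h2⟩ | hn
  · have : p ≠ h := by rintro rfl; exact hh hp
    exact Or.inl ⟨p, hc ▸ hp, by omega, by omega⟩
  · exact Or.inr (by omega)

/-- The head passes closed cells until it meets an available one; the distance in `Near` drops at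
each step and cannot become zero. -/
theorem RightInv.skip_run {n : ℕ} {ct : Ctl P} {t : Tape (WCell Y)} {st : List Y}
    {rs : List (Resp Y)} {G : Ghost} (I : RightInv ct .skip t st rs G) (hn : Near n G t.head)
    (entry : Resp Y → P) (y : Y) :
    ∃ k ct' t' rs' G', StoreRun entry y ct .skip t k ct' t' ∧ k ≤ n ∧
      RightInv ct' .put t' st rs' G' ∧ G'.D ≠ [] ∧ Evolves entry ct rs t G ct' rs' t' G' := by
  induction n generalizing ct t rs G with
  | zero =>
    have := I.core.head_le
    rcases hn with ⟨p, _, h1, h2⟩ | hn <;> omega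
  | succ n ih =>
    obtain ⟨ct', o, s, d, rs', G', hact, hE, hcls, h | ⟨h, _⟩ | ⟨_, rfl, hI, hD⟩⟩ := I.step entry y
    · obtain ⟨rfl, hI, hh, hc, hV, hnc, _⟩ := h
      obtain ⟨k, ct'', t'', rs'', G'', hr, hk, hI', hD, hE'⟩ := ih hI (by
        rw [hh]; exact hn.next hc hV hnc)
      exact ⟨k + 1, ct'', t'', rs'', G'', .step hact hr, by omega, hI', hD, hE.trans hE'⟩
    · cases h
    · exact ⟨1, ct', _, rs', G', .done hact, by omega, hI, hD, hE⟩

/-- Two searches are made, one for the cell that receives the symbol and one for the cell left to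
the next round. -/
theorem RightInv.put_run {n : ℕ} {ct : Ctl P} {t : Tape (WCell Y)} {st : List Y}
    {rs : List (Resp Y)} {G : Ghost} (I : RightInv ct .put t st rs G) (hn : Near n G t.head)
    (entry : Resp Y → P) (y : Y) :
    ∃ k ct' t' rs' G', StoreRun entry y ct .put t k ct' t' ∧ k ≤ n + (gapSize G.cls.length + 1) ∧
      RightInv ct' .put t' (st ++ [y]) rs' G' ∧ G'.D ≠ [] ∧
      Evolves entry ct rs t G ct' rs' t' G' := by
  induction n generalizing ct t rs G with
  | zero =>
    have := I.core.head_le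
    rcases hn with ⟨p, _, h1, h2⟩ | hn <;> omega
  | succ n ih =>
    obtain ⟨ct', o, s, d, rs', G', hact, hE, hcls, h | ⟨_, rfl, hI⟩ | ⟨h, _⟩⟩ := I.step entry y
    · obtain ⟨rfl, hI, hh, hc, hV, hnc, _⟩ := h
      obtain ⟨k, ct'', t'', rs'', G'', hr, hk, hI', hD, hE'⟩ := ih hI (by
        rw [hh]; exact hn.next hc hV hnc)
      rw [hcls] at hk
      exact ⟨k + 1, ct'', t'', rs'', G'', .step hact hr, by omega, hI', hD, hE.trans hE'⟩
    · obtain ⟨k, ct'', t'', rs'', G'', hr, hk, hI', hD, hE'⟩ := hI.skip_run hI.core.near entry y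
      rw [hcls] at hk
      exact ⟨k + 1, ct'', t'', rs'', G'', .step hact hr, by omega, hI', hD, hE.trans hE'⟩
    · cases h

end WorkRuns

end AutoLearn

namespace AutoLearn

/-! ### The way left, the end of a round, and the recovery of the stream -/

section WorkCycle

variable {P Y : Type} [Inhabited Y]

theorem LeftCore.mem_cls {K : ℕ → Option (WSym Y)} {h : ℕ} {st : List Y} {G : Ghost}
    {cls : List (List ℕ)} (I : LeftCore K h st G cls) {p : ℕ} :
    (∃ c ∈ G.cls, p ∈ c) ↔ (∃ c ∈ cls, p ∈ c) ∨ p ∈ G.D ∨ p ∈ G.todo := by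
  rw [I.cls_eq]
  simp [or_and_right, exists_or]

/-- At the left end, the direction changes. -/
theorem LeftInv.bounce {t : Tape (WCell Y)} {st : List Y} {rs : List (Resp Y)} {G : Ghost}
    (I : LeftInv t st rs G) (entry : Resp Y → P) (h0 : t.head = 0) :
    RightInv (.right : Ctl P) .put (t.act none .right) st rs { G with D := [], todo := G.cur } ∧
    Evolves entry .left rs t G .right rs (t.act none .right) { G with D := [], todo := G.cur } := by
  obtain ⟨cls, C⟩ := I.core
  have hcell := Tape.act_cell_zero h0 (none : Option (WCell Y)) .right
  -- Cells still to be filled have positive numbers and do not lie beyond the head, so none is left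
  -- at the left end.
  have hD : G.D = [] := by
    rw [List.eq_nil_iff_forall_not_mem]
    intro p hp
    have h1 := C.D_le p hp
    have h2 := (C.of_mem (Or.inr (C.mem_cls.2 (Or.inr (Or.inl hp))))).1
    omega
  have hcls : G.cls = cls ++ [G.todo] := by rw [C.cls_eq, hD]; rfl
  have hhead : (t.act (none : Option (WCell Y)) .right).head = 1 := by simp [Tape.act, h0]
  have hst := C.stream
  refine ⟨⟨?_, ?_, by simp, fun _ => ?_, fun _ => I.count, by simp⟩,
    ⟨rfl, le_rfl, ?_, fun p hp => hp, Or.inr (Or.inl ⟨rfl, rfl, rfl, rfl⟩), by simp⟩⟩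
  · rw [hcell, hhead]
    refine ⟨⟨C.sieve_eq, C.blank, C.gap, C.nonempty⟩, rfl, by simp, ?_, by simp, by simp, by simp,
      by simp, C.free, ?_, ?_⟩
    · intro p hp
      exact (C.of_mem (Or.inl hp)).1
    · intro c hc p hp
      rcases C.mem_cls.1 ⟨c, hc, hp⟩ with ⟨c', hc', hp'⟩ | h | h
      · exact C.full c' hc' p hp'
      · rw [hD] at h; simp at h
      · exact C.full_todo p h
    -- The finished class, first track forwards and second track backwards, is one more block of
    -- `readOut`.
    · change readOut _ _ G.cls ++ _ = _
      rw [← hst, hcls, hD, readOut_append]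
      simp [readOut]
  · rw [hcell]; exact ⟨I.marks.m_le, I.marks.marked_iff, I.marks.closed, I.marks.answers⟩
  · rw [hhead]; exact Nat.le_add_left _ _
  · rw [hcell]

/-- Filling a cell while moving left. -/
theorem LeftInv.fill {t : Tape (WCell Y)} {st : List Y} {rs : List (Resp Y)} {G : Ghost}
    (I : LeftInv t st rs G) (entry : Resp Y → P) {z : Y}
    (h0 : 1 ≤ t.head) (hK : kind t.cell t.head = some (.half z)) (y : Y) :
    ∃ G', LeftInv (t.act (some (.full z y, false)) .left) (st ++ [y]) rs G' ∧
      Evolves entry .left rs t G .left rs (t.act (some (.full z y, false)) .left) G' ∧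
      G'.D.length < G.D.length := by
  obtain ⟨cls, C⟩ := I.core
  have hcell := Tape.act_cell h0 (some (WSym.full z y, false)) .left
  have hk : kind (t.act (some (WSym.full z y, false)) .left).cell
      = Function.update (kind t.cell) t.head (some (.full z y)) := by
    rw [hcell, kind_update]
  have hhead : (t.act (some (WSym.full z y, false)) .left).head = t.head - 1 := rfl
  generalize hL : t.act (some (WSym.full z y, false)) .left = t' at hcell hk hhead ⊢
  generalize hh : t.head = h at *
  have hD : h ∈ G.D := by
    rcases C.mem_or h0 C.head_le with h' | h' | h'
    · rw [hK] at h'; simp at h'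
    · have := C.free h h'; rw [hK] at this; simp at this
    · rcases C.mem_cls.1 h' with ⟨c, hc, hp⟩ | h | h
      · obtain ⟨_, _, h⟩ := C.full c hc _ hp; rw [hK] at h; simp at h
      · exact h
      · exact absurd (C.todo_gt _ h) (lt_irrefl _)
  -- `D` is sorted and bounded by the head, which belongs to it; so the head is its last element.
  obtain ⟨D, hDD⟩ : ∃ D, G.D = D ++ [h] := by
    rcases List.eq_nil_or_concat G.D with h' | ⟨D, x, h'⟩
    · rw [h'] at hD; simp at hD
    · have hx := C.D_le x (by simp [h'])
      have hs := (List.pairwise_append.1 C.sorted).1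
      rw [h', List.concat_eq_append] at hs
      rw [h', List.concat_eq_append, List.mem_append] at hD
      have hs := (List.pairwise_append.1 hs).2.2
      rcases hD with hD | hD
      · have := hs h hD x (by simp); omega
      · obtain rfl : h = x := by simpa using hD
        exact ⟨D, by rw [h', List.concat_eq_append]⟩
  have hDlt : ∀ p ∈ D, p < h := by
    intro p hp
    have hs := (List.pairwise_append.1 C.sorted).1
    rw [hDD] at hs
    exact (List.pairwise_append.1 hs).2.2 p hp h (by simp)
  have hm : G.m < h := by
    by_contra hcon
    have := I.marks.closed _ h0 (by omega)
    simp [hK] at this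
  have hne : ∀ {p}, kind t.cell p ≠ some (.half z) →
      Function.update (kind t.cell) h (some (.full z y)) p = kind t.cell p := by
    intro p hp
    rw [Function.update_of_ne]
    rintro rfl
    exact hp hK
  have hfull : ∀ c ∈ cls, ∀ p ∈ c,
      Function.update (kind t.cell) h (some (.full z y)) p = kind t.cell p := by
    intro c hc p hp
    obtain ⟨_, _, h⟩ := C.full c hc p hp
    exact hne (by simp [h])
  have htodo : ∀ p ∈ G.todo,
      Function.update (kind t.cell) h (some (.full z y)) p = kind t.cell p :=
    fun p hp => Function.update_of_ne (C.todo_gt p hp).ne' _ _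
  have hD' : ∀ p ∈ D,
      Function.update (kind t.cell) h (some (.full z y)) p = kind t.cell p :=
    fun p hp => Function.update_of_ne (hDlt p hp).ne _ _
  have htags : tags (Function.update (kind t.cell) h (some (.full z y))) G.V = tags (kind t.cell) G.V := by
    refine tags_congr fun p _ _ => ?_
    rcases eq_or_ne p h with rfl | hp
    · simp [hK]
    · rw [Function.update_of_ne hp]
  have hDtodo : D ++ h :: G.todo = G.D ++ G.todo := by rw [hDD]; simp
  refine ⟨{ G with D := D, todo := h :: G.todo }, ⟨⟨cls, ?_⟩, ?_, I.count⟩,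
    ⟨rfl, le_rfl, ?_, fun p hp => hp, Or.inl ⟨rfl, rfl, rfl⟩, by simp⟩, by simp [hDD]⟩
  · rw [hk, hhead]
    refine ⟨⟨?_, ?_, C.gap, C.nonempty⟩, ?_, ?_, ?_, ?_, ?_, ?_, ?_, ?_, ?_, ?_, ?_⟩
    · exact htags ▸ C.sieve_eq
    · intro p (hp : G.V < p)
      have := C.head_le
      rw [Function.update_of_ne (by omega)]
      exact C.blank p hp
    · change G.cls = cls ++ [D ++ h :: G.todo]
      rw [hDtodo]; exact C.cls_eq
    · change (D ++ h :: G.todo).Pairwise _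
      rw [hDtodo]; exact C.sorted
    · intro p hp
      have := hDlt p hp
      omega
    · intro p hp
      rcases List.mem_cons.1 hp with rfl | hp
      · omega
      · have := C.todo_gt p hp; omega
    · have := C.head_le
      change h - 1 ≤ G.V
      omega
    · intro p hp
      rw [hD' p hp]
      exact C.half p (by rw [hDD]; exact List.mem_append_left _ hp)
    · intro p hp
      rcases List.mem_cons.1 hp with rfl | hp
      · exact ⟨z, y, by simp⟩
      · rw [htodo p hp]; exact C.full_todo p hp
    · intro p hp
      have h := C.free p hp
      rw [hne (by simp [h])]
      exact h
    · intro c hc p hp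
      rw [hfull c hc p hp]; exact C.full c hc p hp
    · change ∀ q, 1 ≤ q → _ → ∃ p ∈ D ++ h :: G.todo, _
      rw [hDtodo]; exact C.gap_last
    -- The second track grows from right to left, so the reversal places `y` at the end of the
    -- stream.
    · change readOut _ _ cls ++ (D ++ h :: G.todo).map _ ++ ((h :: G.todo).map _).reverse = _
      have e1 : (D ++ h :: G.todo).map (fstAt (Function.update (kind t.cell) h (some (.full z y))))
          = (D ++ h :: G.todo).map (fstAt (kind t.cell)) := by
        refine List.map_congr_left fun p hp => ?_
        rcases eq_or_ne p h with rfl | hph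
        · simp [fstAt, hK]
        · exact fstAt_congr (Function.update_of_ne hph _ _)
      have e2 : G.todo.map (sndAt (Function.update (kind t.cell) h (some (.full z y))))
          = G.todo.map (sndAt (kind t.cell)) :=
        List.map_congr_left fun p hp => sndAt_congr (htodo p hp)
      have e3 : sndAt (Function.update (kind t.cell) h (some (.full z y))) h = y := by simp [sndAt]
      rw [e1, List.map_cons, List.reverse_cons, e2, e3, hDtodo, ← C.stream,
        readOut_congr fun c hc p hp =>
          ⟨fstAt_congr (hfull c hc p hp), sndAt_congr (hfull c hc p hp)⟩]
      simp
  · rw [hcell]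
    exact I.marks.update (G' := { G with D := D, todo := h :: G.todo }) hm rfl le_rfl _
  · rw [hk]
    change _ <+: tags _ G.V
    rw [htags]

/-- An unfilled cell, or the left end, lies less than `n` cells to the left. -/
def NearLeft (n : ℕ) (G : Ghost) (h : ℕ) : Prop := (∃ p ∈ G.D, p ≤ h ∧ h < p + n) ∨ h < n

/-- The window that ends at the head contains a member of the last class. It is still to be filled,
since the filled ones lie to the right of the head. -/
theorem LeftCore.near {K : ℕ → Option (WSym Y)} {h : ℕ} {st : List Y} {G : Ghost}
    {cls : List (List ℕ)} (I : LeftCore K h st G cls) : NearLeft (gapSize G.cls.length) G h := by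
  by_cases hh : h < gapSize G.cls.length
  · exact Or.inr hh
  · have := I.head_le
    obtain ⟨p, hp, h1, h2⟩ := I.gap_last (h + 1 - gapSize G.cls.length) (by omega) (by omega)
    refine Or.inl ⟨p, ?_, by omega, by omega⟩
    rcases List.mem_append.1 hp with hp | hp
    · exact hp
    · have := I.todo_gt p hp; omega

/-- Moving left over a cell which is not filled now. -/
theorem LeftInv.pass {t : Tape (WCell Y)} {st : List Y} {rs : List (Resp Y)} {G : Ghost}
    (I : LeftInv t st rs G) (entry : Resp Y → P) (h0 : 1 ≤ t.head)
    (hK : ∀ z, kind t.cell t.head ≠ some (.half z)) {s : Option (WCell Y)}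
    (hs : t.cell t.head = s) :
    LeftInv (t.act s .left) st rs G ∧
    Evolves entry .left rs t G .left rs (t.act s .left) G ∧ t.head ∉ G.D := by
  obtain ⟨cls, C⟩ := I.core
  have hcell := Tape.act_cell_keep hs .left
  have hD : t.head ∉ G.D := fun h => by
    obtain ⟨z, hz⟩ := C.half _ h
    exact hK z hz
  refine ⟨⟨⟨cls, ?_⟩, ?_, I.count⟩,
    ⟨rfl, le_rfl, ?_, fun p hp => hp, Or.inl ⟨rfl, rfl, rfl⟩, by simp⟩, hD⟩
  · rw [hcell]
    refine { C with D_le := ?_, todo_gt := ?_, head_le := ?_ }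
    · intro p hp
      have h1 := C.D_le p hp
      have h2 : p ≠ t.head := by rintro rfl; exact hD hp
      change p ≤ t.head - 1
      omega
    · intro p hp
      have h1 := C.todo_gt p hp
      change t.head - 1 < p
      omega
    · have h1 := C.head_le
      change t.head - 1 ≤ _
      omega
  · rw [hcell]; exact I.marks
  · rw [hcell]

/-- On the way left, the next half-filled cell or the left end is reached within `n` steps. At the
left end the direction changes and the symbol is put on the way right, at the cost of two more
searches. -/
theorem LeftInv.store_run {n : ℕ} {t : Tape (WCell Y)} {st : List Y}
    {rs : List (Resp Y)} {G : Ghost} (I : LeftInv t st rs G) (hn : NearLeft n G t.head)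
    (entry : Resp Y → P) (y : Y) :
    ∃ k ct' t' rs' G', StoreRun entry y .left .put t k ct' t' ∧
      k ≤ n + (2 * gapSize G.cls.length + 2) ∧
      ((ct' = .left ∧ LeftInv t' (st ++ [y]) rs' G' ∧ G'.D.length < G.D.length) ∨
        (RightInv ct' .put t' (st ++ [y]) rs' G' ∧ G'.D ≠ [])) ∧
      Evolves entry .left rs t G ct' rs' t' G' := by
  induction n generalizing t with
  | zero => rcases hn with ⟨p, _, h1, h2⟩ | hn <;> omega
  | succ n ih =>
    rcases Nat.eq_zero_or_pos t.head with h0 | h0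
    · obtain ⟨I', hE⟩ := I.bounce entry h0
      obtain ⟨k, ct', t', rs', G', hr, hk, hI', hD, hE'⟩ := I'.put_run I'.core.near entry y
      have hk' : k ≤ gapSize G.cls.length + 1 + (gapSize G.cls.length + 1) := hk
      refine ⟨k + 1, ct', t', rs', G', .step ?_ hr, by omega, Or.inr ⟨hI', hD⟩, hE.trans hE'⟩
      rw [Tape.read_zero h0]; rfl
    by_cases hK : ∃ z, kind t.cell t.head = some (.half z)
    · obtain ⟨z, hz⟩ := hK
      obtain ⟨G', hI', hE, hD⟩ := I.fill entry h0 hz y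
      obtain ⟨b, hb⟩ := kind_some hz
      refine ⟨1, .left, _, rs, G', .done ?_, by omega, Or.inl ⟨rfl, hI', hD⟩, hE⟩
      rw [Tape.read_some h0 hb]; rfl
    · rw [not_exists] at hK
      obtain ⟨hI, hE, hD⟩ := I.pass entry h0 hK rfl
      have hn' : NearLeft n G (t.act (t.cell t.head) .left).head := by
        change NearLeft n G (t.head - 1)
        rcases hn with ⟨p, hp, h1, h2⟩ | hn
        · have : p ≠ t.head := by rintro rfl; exact hD hp
          exact Or.inl ⟨p, hp, by omega, by omega⟩
        · exact Or.inr (by omega)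
      obtain ⟨k, ct', t', rs', G', hr, hk, hI', hE'⟩ := ih hI hn'
      refine ⟨k + 1, ct', t', rs', G', .step ?_ hr, by omega, hI', hE.trans hE'⟩
      rcases hc : t.cell t.head with _ | ⟨z, b⟩
      · rw [Tape.read_none h0 hc]; rfl
      · rw [Tape.read_some h0 hc]
        have hz : ∀ z', z ≠ .half z' := by
          intro z' h
          exact hK z' (by simp [kind, hc, h])
        cases z <;> first | rfl | exact absurd rfl (hz _)

/-- The situation on the work tape between the storing of two symbols. -/
def WorkInv (ct : Ctl P) (t : Tape (WCell Y)) (st : List Y) (rs : List (Resp Y)) (G : Ghost) : Prop :=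
  (ct = .left ∧ LeftInv t st rs G) ∨ (RightInv ct .put t st rs G ∧ (t.head = 0 ∨ G.D ≠ []))

theorem WorkInv.store {ct : Ctl P} {t : Tape (WCell Y)} {st : List Y} {rs : List (Resp Y)} {G : Ghost}
    (I : WorkInv ct t st rs G) (entry : Resp Y → P) (y : Y) :
    ∃ k ct' t' rs' G', StoreRun entry y ct .put t k ct' t' ∧ k ≤ 3 * gapSize G.cls.length + 2 ∧
      WorkInv ct' t' (st ++ [y]) rs' G' ∧ Evolves entry ct rs t G ct' rs' t' G' ∧
      (ct' = .left → G'.D.length < G.D.length) ∧ (ct' ≠ .left → G'.D ≠ []) := by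
  have hg := gapSize_pos G.cls.length
  rcases I with ⟨rfl, I⟩ | ⟨I, _⟩
  · obtain ⟨cls, C⟩ := I.core
    obtain ⟨k, ct', t', rs', G', hr, hk, hI' | hI', hE'⟩ := I.store_run C.near entry y
    · exact ⟨k, ct', t', rs', G', hr, by omega, Or.inl ⟨hI'.1, hI'.2.1⟩, hE', fun _ => hI'.2.2,
        fun h => absurd hI'.1 h⟩
    · exact ⟨k, ct', t', rs', G', hr, by omega, Or.inr ⟨hI'.1, Or.inr hI'.2⟩, hE',
        fun h => absurd h hI'.1.ct_ne, fun _ => hI'.2⟩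
  · obtain ⟨k, ct', t', rs', G', hr, hk, hI', hD, hE'⟩ := I.put_run I.core.near entry y
    exact ⟨k, ct', t', rs', G', hr, by omega, Or.inr ⟨hI', Or.inr hD⟩, hE',
      fun h => absurd h hI'.ct_ne, fun _ => hD⟩

omit [Inhabited Y] in
theorem Evolves.ne_left {entry : Resp Y → P} {ct rs t G ct' rs' t' G'}
    (h : Evolves entry ct rs t G ct' rs' t' G') (hct : ct ≠ .left) : ct' ≠ .left := by
  rcases h.ev with ⟨h1, _⟩ | ⟨_, h1, _⟩ | ⟨_, r, h1, _⟩
  · rwa [h1]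
  · simp [h1]
  · simp [h1]

/-- The list is nonempty, as each datum ends with a separator. So every cycle fills a cell on the
way left or uses one on the way right. -/
theorem WorkInv.stores (entry : Resp Y → P) (l : List Y) (y : Y) {ct : Ctl P} {t : Tape (WCell Y)}
    {st : List Y} {rs : List (Resp Y)} {G : Ghost} (I : WorkInv ct t st rs G) :
    ∃ k ct' t' rs' G', StoreRuns entry (y :: l) ct t k ct' t' ∧
      k ≤ (l.length + 1) * (3 * gapSize G.cls.length + 2) ∧
      WorkInv ct' t' (st ++ (y :: l)) rs' G' ∧ Evolves entry ct rs t G ct' rs' t' G' ∧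
      (ct' = .left → G'.D.length < G.D.length) ∧ (ct' ≠ .left → G'.D ≠ []) := by
  induction l generalizing y ct t st rs G with
  | nil =>
    obtain ⟨k, ct', t', rs', G', hr, hk, hI', hE, hD, hD'⟩ := I.store entry y
    exact ⟨k + 0, ct', t', rs', G', .cons hr .nil, by simpa using hk, hI', hE, hD, hD'⟩
  | cons z l ih =>
    obtain ⟨k, ct', t', rs', G', hr, hk, hI', hE, hD, hD'⟩ := I.store entry y
    obtain ⟨k2, ct2, t2, rs2, G2, hr2, hk2, hI2, hE2, hD2, hD2'⟩ := ih z hI'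
    rw [hE.cls_eq] at hk2
    refine ⟨k + k2, ct2, t2, rs2, G2, .cons hr hr2, ?_, by simpa using hI2, hE.trans hE2, ?_, hD2'⟩
    · rw [List.length_cons, add_mul _ 1, one_mul]; omega
    · intro h
      have h1 := hD2 h
      by_cases h' : ct' = .left
      · exact h1.trans (hD h')
      · exact absurd h (hE2.ne_left h')

/-- The end of a round. -/
theorem WorkInv.turn {t : Tape (WCell Y)} {st : List Y} {rs : List (Resp Y)} {G : Ghost}
    (I : WorkInv (.ready : Ctl P) t st rs G) (hb : t.read = .blank) :
    ∃ G', WorkInv (.left : Ctl P) (t.act (some (.turn, false)) .left) st rs G' ∧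
      G'.cls.length = G.cls.length + 1 ∧ G.V ≤ G'.V ∧ G'.m = G.m ∧
      tags (kind t.cell) G.V <+: tags (kind (t.act (some (.turn, false)) .left).cell) G'.V := by
  rcases I with ⟨h, _⟩ | ⟨I, hD⟩
  · cases h
  have h0 : 1 ≤ t.head := by
    by_contra h
    rw [Tape.read_zero (by omega)] at hb
    simp at hb
  have hn : kind t.cell t.head = none := by
    rcases hc : t.cell t.head with _ | x
    · simp [kind, hc]
    · rw [Tape.read_some h0 hc] at hb; simp at hb
  -- A blank under the head means that the pass is over: `D` now consists of all candidates.
  obtain ⟨hh, htodo⟩ : t.head = G.V + 1 ∧ G.todo = [] := by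
    rcases I.core.cases with h | ⟨_, _, _, h | ⟨_, _, h⟩⟩ | ⟨_, _, h, _⟩ | ⟨_, h1, _, h2⟩
    · omega
    · simp [hn] at h
    · simp [hn] at h
    · simp [hn] at h
    · exact ⟨h1, h2⟩
  have hcur : G.cur = G.D := by rw [I.core.cur_eq, htodo, List.append_nil]
  -- The head has left the left end, so some cell was used in this pass and the new class will be
  -- nonempty.
  have hD : G.D ≠ [] := hD.resolve_left (by omega)
  have hcell := Tape.act_cell h0 (some ((WSym.turn : WSym Y), false)) .left
  have hk : kind (t.act (some ((WSym.turn : WSym Y), false)) .left).cell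
      = Function.update (kind t.cell) (G.V + 1) (some .turn) := by
    rw [hcell, kind_update, hh]
  have hhead : (t.act (some ((WSym.turn : WSym Y), false)) .left).head = G.V := by
    simp [Tape.act, hh]
  have hne : ∀ {p}, p ≤ G.V →
      Function.update (kind t.cell) (G.V + 1) (some .turn) p = kind t.cell p :=
    fun hp => Function.update_of_ne (by omega) _ _
  have hcurV : ∀ {p}, p ∈ G.cur → 1 ≤ p ∧ p ≤ G.V := fun hp =>
    ⟨(I.core.of_mem (Or.inl hp)).1, (I.core.of_mem (Or.inl hp)).2.1⟩
  have hclsV : ∀ c ∈ G.cls, ∀ p ∈ c, p ≤ G.V := fun c hc p hp =>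
    (I.core.of_mem (Or.inr ⟨c, hc, hp⟩)).2.1
  have h1 := fun {p} (hp : p ∈ (alternate G.cur).1) => (alternate_sublist G.cur).1.subset hp
  have h2 := fun {p} (hp : p ∈ (alternate G.cur).2) => (alternate_sublist G.cur).2.subset hp
  have htags : tags (Function.update (kind t.cell) (G.V + 1) (some .turn)) (G.V + 1)
      = tags (kind t.cell) G.V ++ [none] := by
    rw [tags_succ, Function.update_self]
    congr 1
    exact tags_congr fun p _ hp => by rw [hne hp]
  -- Two adjacent old windows contain candidates `x < y`, and between these both sublists are
  -- represented. The additional cell of the new window makes up for the turning mark, which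
  -- enlarges the visited region.
  have hgap : ∀ q, 1 ≤ q → q + gapSize (G.cls.length + 1) ≤ G.V + 1 + 1 →
      (∃ p ∈ (alternate G.cur).1, q ≤ p ∧ p < q + gapSize (G.cls.length + 1)) ∧
      (∃ p ∈ (alternate G.cur).2, q ≤ p ∧ p < q + gapSize (G.cls.length + 1)) := by
    intro q hq hq'
    rw [gapSize_succ] at hq' ⊢
    obtain ⟨x, hx, hx1, hx2⟩ := I.core.gap q hq (by omega)
    obtain ⟨y, hy, hy1, hy2⟩ := I.core.gap (q + gapSize G.cls.length) (by omega) (by omega)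
    obtain ⟨⟨z, hz, hz1, hz2⟩, w, hw, hw1, hw2⟩ :=
      exists_between_alternate I.core.sorted_cur hx hy (by omega)
    exact ⟨⟨z, hz, by omega, by omega⟩, w, hw, by omega, by omega⟩
  -- The second sublist remains available. The first one is the new class and starts as `D`, since
  -- its second track is still to be filled.
  refine ⟨⟨G.V + 1, G.m, (alternate G.cur).2, G.cls ++ [(alternate G.cur).1], (alternate G.cur).1, []⟩,
    Or.inl ⟨rfl, ⟨⟨G.cls, ?_⟩, ?_, ?_⟩⟩, by simp, Nat.le_succ _, rfl, ?_⟩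
  · rw [hk, hhead]
    refine ⟨⟨?_, ?_, ?_, ?_⟩, by simp, ?_, ?_, by simp, Nat.le_succ _, ?_, by simp, ?_, ?_, ?_, ?_⟩
    · rw [htags, sieve_concat_none, I.core.sieve_eq]
    · intro p (hp : G.V + 1 < p)
      rw [Function.update_of_ne (by omega)]
      exact I.core.blank p (by omega)
    · intro q hq hq'
      simp only [List.length_append, List.length_singleton] at hq' ⊢
      exact (hgap q hq hq').2
    · intro c hc
      rcases List.mem_append.1 hc with hc | hc
      · exact I.core.nonempty c hc
      · rw [List.mem_singleton.1 hc]
        exact alternate_fst_ne_nil (hcur ▸ hD)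
    · rw [List.append_nil]
      exact I.core.sorted_cur.sublist (alternate_sublist _).1
    · intro p hp
      exact (hcurV (h1 hp)).2
    · intro p hp
      rw [hne (hcurV (h1 hp)).2]
      exact I.core.half p (hcur ▸ hp)
    · intro p hp
      rw [hne (hcurV (h2 hp)).2]
      exact I.core.free_D p (hcur ▸ hp)
    · intro c hc p hp
      rw [hne (hclsV c hc p hp)]
      exact I.core.full c hc p hp
    · intro q hq hq'
      simp only [List.length_append, List.length_singleton, List.append_nil] at hq' ⊢
      exact (hgap q hq hq').1
    · have e1 : (alternate G.cur).1.map (fstAt (Function.update (kind t.cell) (G.V + 1) (some .turn)))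
          = (alternate G.cur).1.map (fstAt (kind t.cell)) :=
        List.map_congr_left fun p hp => fstAt_congr (hne (hcurV (h1 hp)).2)
      dsimp only
      rw [List.append_nil, e1, readOut_congr fun c hc p hp =>
          ⟨fstAt_congr (hne (hclsV c hc p hp)), sndAt_congr (hne (hclsV c hc p hp))⟩,
        ← I.core.stream, hcur]
      simp
  · rw [hcell, hh]
    have hm : G.m < G.V + 1 := Nat.lt_succ_of_le I.marks.m_le
    exact I.marks.update
      (G' := ⟨G.V + 1, G.m, (alternate G.cur).2, G.cls ++ [(alternate G.cur).1], (alternate G.cur).1, []⟩)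
      hm rfl (Nat.le_succ _) _
  · rw [I.count (by simp)]; simp
  · rw [hk]
    dsimp only
    rw [htags]
    exact List.prefix_append _ _

/-- The blank work tape. -/
theorem WorkInv.init {ct : Ctl P} (h1 : ct ≠ .left) (h2 : ct ≠ .right) :
    WorkInv ct (Tape.ofList ([] : List (WCell Y))) [] [] ⟨0, 0, [], [], [], []⟩ := by
  have hc : (Tape.ofList ([] : List (WCell Y))).cell = fun _ => none := by
    funext p; simp [Tape.ofList]
  have hk : kind (Tape.ofList ([] : List (WCell Y))).cell = fun _ => none := by
    funext p; simp [kind, hc]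
  refine Or.inr ⟨⟨?_, ?_, h1, fun h => absurd h h2, fun h => absurd h h2, fun _ => rfl⟩, Or.inl rfl⟩
  · rw [hk]
    refine ⟨⟨rfl, fun _ _ => rfl, ?_, by simp⟩, rfl, by simp, by simp, Nat.zero_le _, by simp, by simp,
      by simp, by simp, by simp, rfl⟩
    intro q hq hq'
    simp [gapSize] at hq'
    omega
  · refine ⟨le_rfl, ?_, ?_, rfl⟩
    · intro p hp
      simp [marked, hc]
      omega
    · intro p hp hp'
      simp only at hp'
      omega

theorem readOut_map {α β γ : Type*} (f g : β → γ) (h : α → β) (cls : List (List α)) :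
    readOut f g (cls.map (List.map h)) = readOut (f ∘ h) (g ∘ h) cls := by
  simp [readOut, List.flatMap_map]

/-- The part of the stream that the answers determine. -/
def answerStream (rs : List (Resp Y)) : List Y :=
  readOut Prod.fst Prod.snd (sieve rs.reduceOption).2

/-- The answers are the tags of the read cells with contents instead of positions. As sieving
commutes with maps, the classes can be found without knowing positions. -/
theorem Marks.reduceOption_eq {c : ℕ → Option (WCell Y)} {G : Ghost} {rs : List (Resp Y)}
    (M : Marks c G rs) : rs.reduceOption
      = (tags (kind c) G.m).map (Option.map fun p => (fstAt (kind c) p, sndAt (kind c) p)) := by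
  rw [M.answers, tags, List.map_map]
  refine List.map_congr_left fun i hi => ?_
  have hi := List.mem_range.1 hi
  rcases M.closed (i + 1) (by omega) (by omega) with h | ⟨y, z, h⟩
  · simp [h, content, tagAt]
  · simp [h, content, tagAt, fstAt, sndAt]

theorem Marks.answerStream_eq {c : ℕ → Option (WCell Y)} {G : Ghost} {rs : List (Resp Y)}
    (M : Marks c G rs) : answerStream rs
      = readOut (fstAt (kind c)) (sndAt (kind c)) (sieve (tags (kind c) G.m)).2 := by
  rw [answerStream, M.reduceOption_eq, sieve_map, readOut_map]
  rfl

theorem readOut_prefix {α β : Type*} (f g : α → β) {c c' : List (List α)} (h : c <+: c') :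
    readOut f g c <+: readOut f g c' := by
  obtain ⟨d, rfl⟩ := h
  rw [readOut_append]
  exact List.prefix_append _ _

/-- The classes found among the read cells are the first of all classes, and on the way right all
classes are full. On the way left the last class would still be incomplete. -/
theorem RightInv.answerStream_prefix {ct : Ctl P} {ph : Phase} {t : Tape (WCell Y)} {st : List Y}
    {rs : List (Resp Y)} {G : Ghost} (I : RightInv ct ph t st rs G) : answerStream rs <+: st := by
  rw [I.marks.answerStream_eq, ← I.core.stream]
  refine (readOut_prefix _ _ ?_).trans (List.prefix_append _ _)
  obtain ⟨r, hr⟩ := tags_prefix (kind t.cell) I.marks.m_le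
  have h := sieve_snd_prefix (tags (kind t.cell) G.m) r
  rwa [hr, I.core.sieve_eq] at h

/-- When all cells visited at an earlier time have been read, the answers determine at least as many
stream symbols as there were rounds at that time. -/
theorem RightInv.le_length_answerStream {ct : Ctl P} {ph : Phase} {t : Tape (WCell Y)} {st : List Y}
    {rs : List (Resp Y)} {G : Ghost} (I : RightInv ct ph t st rs G) {K : ℕ → Option (WSym Y)} {V : ℕ}
    (h : tags K V <+: tags (kind t.cell) G.V) (hV : V ≤ G.m) :
    (sieve (tags K V)).2.length ≤ (answerStream rs).length := by
  have h1 : tags K V <+: tags (kind t.cell) G.m :=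
    List.prefix_of_prefix_length_le h (tags_prefix _ I.marks.m_le) (by simpa [length_tags])
  obtain ⟨r, hr⟩ := h1
  have h2 := (sieve_snd_prefix (tags K V) r).length_le
  rw [hr] at h2
  refine h2.trans ?_
  rw [I.marks.answerStream_eq]
  refine length_le_readOut _ _ ?_
  obtain ⟨r', hr'⟩ := tags_prefix (kind t.cell) I.marks.m_le
  have h3 := sieve_snd_prefix (tags (kind t.cell) G.m) r'
  rw [hr', I.core.sieve_eq] at h3
  exact fun c hc => I.core.nonempty c (h3.subset hc)

end WorkCycle

end AutoLearn

namespace AutoLearn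

/-! ### The Turing machine: stacks as tracks of the long-term memory -/

section Machine

/-- Operations on one stack. -/
inductive StackOp (Γ : Type) : Type
  | keep
  | pop
  | push (g : Γ)

/-- The stack after an operation; the top is the first element. -/
def StackOp.app {Γ : Type} : StackOp Γ → List Γ → List Γ
  | .keep, l => l
  | .pop, l => l.tail
  | .push g, l => g :: l

/-- Operations on all stacks, a letter to be put in front of the new hypothesis, and whether the
new hypothesis replaces the old one. -/
structure Ops (K Γ E : Type) : Type where
  st : K → StackOp Γ
  hp : Option E
  cm : Bool

/-- No operation. -/
def Ops.idle {K Γ E : Type} : Ops K Γ E := ⟨fun _ => .keep, none, false⟩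

/-- A background program, which works on stacks. It is entered at `boot`, and again after each
answer; `none` as a next state means that it is ready for the next round. -/
structure Prog (K Γ E Y : Type) : Type 1 where
  St : Type
  finSt : Finite St
  boot : St
  entry : Resp Y → St
  δ : St → (K → Option Γ) → Option St × Ops K Γ E

/-- A symbol of the long term memory: the control state (in the first cell only), the entries of the
stacks, of the new hypothesis and of the old hypothesis. -/
structure MemSym (K Γ E S : Type) : Type where
  ctl : Option (Ctl S)
  tr : K → Option Γ
  hn : Option E
  ho : Option E

/-- The content of the long term memory. -/
structure Mem (K Γ E S : Type) : Type where
  ctl : Ctl S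
  stk : K → List Γ
  hn : List E
  ho : List E

variable {K Γ E A' : Type}

/-- The symbol that describes the memory in cell `i + 1`. -/
def Mem.cellOf {S : Type} (m : Mem K Γ E S) (i : ℕ) : MemSym K Γ E S :=
  ⟨if i = 0 then some m.ctl else none, fun k => (m.stk k)[i]?, m.hn[i]?, m.ho[i]?⟩

/-- The long term memory as a string of length `n`. -/
def Mem.toList {S : Type} (m : Mem K Γ E S) (n : ℕ) : List (MemSym K Γ E S) :=
  (List.range n).map m.cellOf

/-- The effect of operations on the memory. -/
def Mem.app {S : Type} (m : Mem K Γ E S) (ct : Ctl S) (o : Ops K Γ E) : Mem K Γ E S :=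
  ⟨ct, fun k => (o.st k).app (m.stk k), bif o.cm then [] else o.hp.toList ++ m.hn,
    bif o.cm then m.hn else m.ho⟩

/-- All components of the memory fit into `n` cells. -/
structure Mem.Fits {S : Type} (m : Mem K Γ E S) (n : ℕ) : Prop where
  stk : ∀ k, (m.stk k).length ≤ n
  hn : m.hn.length ≤ n
  ho : m.ho.length ≤ n

/-- There is room for one more entry on each stack. -/
def Mem.Room {S : Type} (m : Mem K Γ E S) (n : ℕ) : Prop :=
  (∀ k, (m.stk k).length < n) ∧ m.hn.length < n

/-- A missing memory symbol is read as an empty one. -/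
def MemSym.norm {S : Type} (m : Option (MemSym K Γ E S)) : MemSym K Γ E S :=
  m.getD ⟨none, fun _ => none, none, none⟩

open Classical in
/-- Whether the symbol shows that there is room on all stacks. -/
noncomputable def MemSym.isEmpty {S : Type} (m : MemSym K Γ E S) : Bool :=
  decide ((∀ k, m.tr k = none) ∧ m.hn = none)

/-- Control states of the learner. -/
inductive MachineState (K Γ E Y S : Type) : Type
  | start
  | first
  | body (pend : Bool) (ct : Ctl S) (tops : K → Option Γ) (g : Bool)
  | store (ph : Phase) (y : Y) (pend : Bool) (ct : Ctl S) (tops : K → Option Γ) (g : Bool)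
  | back (ct : Ctl S) (o : Ops K Γ E) (carry : K → Option Γ)
  | fwd (o : Ops K Γ E) (carry : K → Option Γ) (hc : Option E)
  | fin

/-- What to write in order to leave a cell as it is. -/
def Cell.keep {G : Type*} : Cell G → Option G
  | .sym a => some a
  | _ => none

/-- At the beginning of a cycle, the round may be ended. -/
def turnAct {S Y : Type} (ct : Ctl S) (w : Cell (WCell Y)) : Ctl S × Option (WCell Y) × Move :=
  match ct, w with
  | .ready, .blank => (.left, some (.turn, false), .left)
  | ct, w => (ct, w.keep, .stay)

/-- The next control state, and the operations on the memory. -/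
def Prog.decide {Y : Type} (P : Prog K Γ E Y) (ct : Ctl P.St) (tops : K → Option Γ) (g : Bool) :
    Ctl P.St × Ops K Γ E :=
  match g, ct with
  | true, .run s => (match (P.δ s tops).1 with | some s' => .run s' | none => .ready, (P.δ s tops).2)
  | _, ct => (ct, .idle)

/-- The track of a stack in the sweep to the left. -/
def StackOp.backTr {Γ : Type} : StackOp Γ → Option Γ → Option Γ → Option Γ
  | .pop, carry, _ => carry
  | _, _, g => g

/-- The track of a stack in the sweep to the right. -/
def StackOp.fwdTr {Γ : Type} : StackOp Γ → Option Γ → Option Γ → Option Γ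
  | .push _, carry, _ => carry
  | _, _, g => g

/-- The pushed symbol. -/
def StackOp.pushed {Γ : Type} : StackOp Γ → Option Γ
  | .push g => some g
  | _ => none

universe u v

variable {A : Type u} {B : Type v}

/-- The symbols of the base tape. -/
abbrev BSym (A : Type u) (B : Type v) (K Γ E S : Type) := BaseSym A B (MemSym K Γ E S) Empty

/-- The transition table. -/
noncomputable def transition (P : Prog K Γ E (Option A')) (ea : A → A') (eb : E → B)
    (q : MachineState K Γ E (Option A') P.St) (b : Cell (BSym A B K Γ E P.St))
    (w : Cell (WCell (Option A'))) :
    MachineState K Γ E (Option A') P.St × (Option (BSym A B K Γ E P.St) × Move) ×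
      (Option (WCell (Option A')) × Move) :=
  match q with
  | .start => (.first, (b.keep, .right), (w.keep, .stay))
  | .first =>
    match b with
    | .sym (.input p) =>
      let m := MemSym.norm p.2
      let ct := m.ctl.getD (.run P.boot)
      (.body true (turnAct ct w).1 m.tr false,
        (some (.input (p.1, some { m with ctl := some ct })), .stay), (turnAct ct w).2)
    -- Without a usable cell the memory string is empty, and the initial memory is meant.
    | b => (.body true (.run P.boot) (fun _ => none) false, (b.keep, .stay), (w.keep, .stay))
  | .body pend ct tops g =>
    match b with
    | .sym (.input (some x, m)) =>
      (.store .put (some (ea x)) pend ct tops (MemSym.norm m).isEmpty,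
        (some (.output (none, some (MemSym.norm m))), .right), (w.keep, .stay))
    -- The datum is over: its separator is stored once, while `pend` holds, before the sweep goes
    -- on.
    | .sym (.input (none, m)) =>
      bif pend then (.store .put none false ct tops g, (b.keep, .stay), (w.keep, .stay))
      else (.body false ct tops (MemSym.norm m).isEmpty,
        (some (.output (none, some (MemSym.norm m))), .right), (w.keep, .stay))
    | b =>
      bif pend then (.store .put none false ct tops g, (b.keep, .stay), (w.keep, .stay))
      else (.back (P.decide ct tops g).1 (P.decide ct tops g).2 (fun _ => none),
        (b.keep, .left), (w.keep, .stay))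
  | .store ph y pend ct tops g =>
    (match (workAct P.entry ct ph y w).1.2 with
      | some ph' => .store ph' y pend (workAct P.entry ct ph y w).1.1 tops g
      | none => .body pend (workAct P.entry ct ph y w).1.1 tops g,
      (b.keep, .stay), (workAct P.entry ct ph y w).2)
  -- Stack tops are in cell 1, so a pop shifts a track to the left; the carry is the old symbol of
  -- the right neighbour.
  | .back ct o carry =>
    match b with
    | .sym (.output (_, m)) =>
      (.back ct o (MemSym.norm m).tr,
        (some (.output (none, some
          { MemSym.norm m with
            ctl := (MemSym.norm m).ctl.map fun _ => ct
            tr := fun k => (o.st k).backTr (carry k) ((MemSym.norm m).tr k) })), .left),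
        (w.keep, .stay))
    | b => (.fwd o (fun k => (o.st k).pushed) o.hp, (b.keep, .right), (w.keep, .stay))
  -- Dually, a push shifts a track to the right and is done on the way right, where the hypothesis
  -- is output as well.
  | .fwd o carry hc =>
    match b with
    | .sym (.output (_, m)) =>
      (.fwd o (MemSym.norm m).tr (MemSym.norm m).hn,
        (some (.output ((bif o.cm then (MemSym.norm m).hn else (MemSym.norm m).ho).map eb, some
          { ctl := (MemSym.norm m).ctl
            tr := fun k => (o.st k).fwdTr (carry k) ((MemSym.norm m).tr k)
            hn := bif o.cm then none else bif o.hp.isSome then hc else (MemSym.norm m).hn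
            ho := bif o.cm then (MemSym.norm m).hn else (MemSym.norm m).ho })), .right),
        (w.keep, .stay))
    | b => (.fin, (b.keep, .stay), (w.keep, .stay))
  | .fin => (.fin, (b.keep, .stay), (w.keep, .stay))

section Finiteness

instance {S : Type} [Finite S] : Finite (Ctl S) :=
  Finite.of_injective (β := Option (Option (Option S)))
    (fun
      | .left => none
      | .right => some none
      | .ready => some (some none)
      | .run p => some (some (some p)))
    (by intro x y h; cases x <;> cases y <;> simp_all)

instance {Y : Type} [Finite Y] : Finite (WSym Y) :=
  Finite.of_injective (β := Option (Option (Y ⊕ Y × Y)))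
    (fun
      | .free => none
      | .turn => some none
      | .half y => some (some (.inl y))
      | .full y z => some (some (.inr (y, z))))
    (by intro x y h; cases x <;> cases y <;> simp_all)

instance : Finite Phase :=
  Finite.of_injective (β := Bool) (fun | .put => true | .skip => false)
    (by intro x y h; cases x <;> cases y <;> simp_all)

instance [Finite Γ] : Finite (StackOp Γ) :=
  Finite.of_injective (β := Option (Option Γ))
    (fun | .keep => none | .pop => some none | .push g => some (some g))
    (by intro x y h; cases x <;> cases y <;> simp_all)

variable [Finite K] [Finite Γ] [Finite E]

instance : Finite (Ops K Γ E) :=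
  Finite.of_injective (β := (K → StackOp Γ) × Option E × Bool) (fun o => (o.st, o.hp, o.cm))
    (by rintro ⟨_, _, _⟩ ⟨_, _, _⟩ h; simp_all)

instance {S : Type} [Finite S] : Finite (MemSym K Γ E S) :=
  Finite.of_injective (β := Option (Ctl S) × (K → Option Γ) × Option E × Option E)
    (fun o => (o.ctl, o.tr, o.hn, o.ho))
    (by rintro ⟨_, _, _, _⟩ ⟨_, _, _, _⟩ h; simp_all)

instance {Y S : Type} [Finite Y] [Finite S] : Finite (MachineState K Γ E Y S) :=
  Finite.of_injective
    (β := (Bool ⊕ Bool) ⊕ (Bool × Ctl S × (K → Option Γ) × Bool) ⊕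
      (Phase × Y × Bool × Ctl S × (K → Option Γ) × Bool) ⊕
      (Ctl S × Ops K Γ E × (K → Option Γ)) ⊕ (Ops K Γ E × (K → Option Γ) × Option E))
    (fun
      | .start => .inl (.inl true)
      | .first => .inl (.inl false)
      | .fin => .inl (.inr true)
      | .body a b c d => .inr (.inl (a, b, c, d))
      | .store a b c d e f => .inr (.inr (.inl (a, b, c, d, e, f)))
      | .back a b c => .inr (.inr (.inr (.inl (a, b, c))))
      | .fwd a b c => .inr (.inr (.inr (.inr (a, b, c)))))
    (by intro x y h; cases x <;> cases y <;> simp_all)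

end Finiteness

/-- The learner that runs the background program `P`. -/
noncomputable def machine [Finite K] [Finite Γ] [Finite E] [Finite A']
    (P : Prog K Γ E (Option A')) (ea : A → A') (eb : E → B) : Learner A B 1 where
  Q := MachineState K Γ E (Option A') P.St
  Δ := MemSym K Γ E P.St
  X := Empty
  W := WCell (Option A')
  finQ := by have := P.finSt; infer_instance
  finΔ := by have := P.finSt; infer_instance
  finX := inferInstance
  finW := inferInstance
  start := .start
  final := fun q => match q with
    | .fin => true
    | _ => false
  init := []
  trans := fun q b w =>
    ((transition P ea eb q b (w 0)).1, (transition P ea eb q b (w 0)).2.1,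
      fun _ => (transition P ea eb q b (w 0)).2.2)

theorem Tape.act_keep {G : Type*} (t : Tape G) : t.act t.read.keep .stay = t := by
  rcases t with ⟨h, c⟩
  rcases Nat.eq_zero_or_pos h with rfl | hh
  · simp [Tape.act]
  · have hne : h ≠ 0 := by omega
    have hk : (Tape.mk h c).read.keep = c h := by
      rcases hc : c h with _ | a <;> simp [Tape.read, hne, hc, Cell.keep]
    rw [hk]
    simp [Tape.act, hne]

/-- The tape which contains `F i` in cell `i + 1`. -/
def baseTape {G : Type*} (h : ℕ) (F : ℕ → Option G) : Tape G :=
  ⟨h, fun j => if j = 0 then none else F (j - 1)⟩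

section BaseTape

variable {G : Type*} {F : ℕ → Option G} {i : ℕ}

theorem baseTape_read_zero : (baseTape 0 F).read = .leftEnd := rfl

theorem baseTape_read_none (h : F i = none) : (baseTape (i + 1) F).read = .blank := by
  simp [baseTape, Tape.read, h]

theorem baseTape_read_some {a : G} (h : F i = some a) : (baseTape (i + 1) F).read = .sym a := by
  simp [baseTape, Tape.read, h]

theorem baseTape_cell_update (s : Option G) :
    Function.update (baseTape (i + 1) F).cell (i + 1) s
      = fun j => if j = 0 then none else Function.update F i s (j - 1) := by
  funext j
  rcases j with _ | j
  · simp [baseTape]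
  · rcases eq_or_ne j i with rfl | h
    · simp
    · have h' : j + 1 ≠ i + 1 := by omega
      simp [Function.update_of_ne h', Function.update_of_ne h, baseTape]

theorem baseTape_act_right (s : Option G) :
    (baseTape (i + 1) F).act s .right = baseTape (i + 2) (Function.update F i s) := by
  exact congrArg (Tape.mk (i + 2)) (baseTape_cell_update s)

theorem baseTape_act_left (s : Option G) :
    (baseTape (i + 1) F).act s .left = baseTape i (Function.update F i s) := by
  exact congrArg (Tape.mk i) (baseTape_cell_update s)

theorem baseTape_act_stay (s : Option G) :
    (baseTape (i + 1) F).act s .stay = baseTape (i + 1) (Function.update F i s) := by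
  exact congrArg (Tape.mk (i + 1)) (baseTape_cell_update s)

theorem baseTape_cell_none {n h : ℕ} (hF : ∀ i, n ≤ i → F i = none) {j : ℕ} (hj : n < j) :
    (baseTape h F).cell j = none := by
  have : j ≠ 0 := by omega
  simp [baseTape, this, hF (j - 1) (by omega)]

theorem ofList_eq_baseTape (z : List G) : Tape.ofList z = baseTape 0 fun i => z[i]? := rfl

end BaseTape

/-- `T` steps lead from `c` to `c'`; before, no final state occurs, and only the cells `1, …, n` of
the base tape are in use. -/
def Runs {k : ℕ} (N : Learner A B k) (n : ℕ) (c : N.Config) (T : ℕ) (c' : N.Config) : Prop :=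
  N.steps T c = c' ∧ ∀ s < T, N.final (N.steps s c).state = false ∧
    ∀ j, n < j → (N.steps s c).base.cell j = none

theorem Runs.trans {k : ℕ} {N : Learner A B k} {n T T' : ℕ} {c c' c'' : N.Config}
    (h : Runs N n c T c') (h' : Runs N n c' T' c'') : Runs N n c (T + T') c'' := by
  have hs : ∀ s, N.steps (T + s) c = N.steps s c' := by
    intro s
    rw [Learner.steps, add_comm, Function.iterate_add_apply]
    exact congrArg _ h.1
  refine ⟨(hs T').trans h'.1, fun s hs' => ?_⟩
  rcases Nat.lt_or_ge s T with h1 | h1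
  · exact h.2 s h1
  · obtain ⟨r, rfl⟩ := Nat.exists_eq_add_of_le h1
    rw [hs]
    exact h'.2 r (by omega)

theorem Runs.single {k : ℕ} {N : Learner A B k} {n : ℕ} {c c' : N.Config} (h : N.step c = c')
    (h1 : N.final c.state = false) (h2 : ∀ j, n < j → c.base.cell j = none) : Runs N n c 1 c' := by
  refine ⟨h, fun s hs => ?_⟩
  obtain rfl : s = 0 := by omega
  exact ⟨h1, h2⟩

end Machine

end AutoLearn

namespace AutoLearn

/-! ### One cycle: three sweeps over the base tape -/

section Cycle

universe u v

variable {A : Type u} {B : Type v} {K Γ E A' : Type} [Finite K] [Finite Γ] [Finite E] [Finite A']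
  (P : Prog K Γ E (Option A')) (ea : A → A') (eb : E → B)

/-- A configuration of the learner. -/
noncomputable def cfg (q : MachineState K Γ E (Option A') P.St) (b : Tape (BSym A B K Γ E P.St))
    (w : Tape (WCell (Option A'))) : (machine P ea eb).Config := ⟨q, b, fun _ => w⟩

variable {P ea eb} {n : ℕ} {q q' : MachineState K Γ E (Option A') P.St}
  {w w' : Tape (WCell (Option A'))}

theorem cfg_step {b : Tape (BSym A B K Γ E P.St)} {s ws d wd}
    (h : transition P ea eb q b.read w.read = (q', (s, d), ws, wd)) (hq : q ≠ .fin)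
    (hb : ∀ j, n < j → b.cell j = none) :
    Runs (machine P ea eb) n (cfg P ea eb q b w) 1
      (cfg P ea eb q' (b.act s d) (w.act ws wd)) := by
  have hf : (machine P ea eb).final q = false := by cases q <;> first | rfl | exact absurd rfl hq
  refine Runs.single ?_ hf hb
  have : (machine P ea eb).final (cfg P ea eb q b w).state ≠ true := by
    rw [show (cfg P ea eb q b w).state = q from rfl, hf]; simp
  rw [Learner.step, if_neg this]
  simp only [cfg, machine, h]

theorem cfg_step_keep {b : Tape (BSym A B K Γ E P.St)} {s d}
    (h : transition P ea eb q b.read w.read = (q', (s, d), w.read.keep, .stay)) (hq : q ≠ .fin)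
    (hb : ∀ j, n < j → b.cell j = none) :
    Runs (machine P ea eb) n (cfg P ea eb q b w) 1 (cfg P ea eb q' (b.act s d) w) := by
  have := cfg_step h hq hb
  rwa [Tape.act_keep] at this

theorem cfg_store {b : Tape (BSym A B K Γ E P.St)} (hb : ∀ j, n < j → b.cell j = none)
    {y : Option A'} {ct ct' : Ctl P.St} {ph : Phase} {k : ℕ}
    (h : StoreRun P.entry y ct ph w k ct' w') (pend : Bool) (tops : K → Option Γ) (g : Bool) :
    Runs (machine P ea eb) n (cfg P ea eb (.store ph y pend ct tops g) b w) k
      (cfg P ea eb (.body pend ct' tops g) b w') := by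
  induction h with
  | @done ct ph t ct' s d h =>
    have := cfg_step (P := P) (ea := ea) (eb := eb) (n := n) (w := t) (b := b)
      (q := .store ph y pend ct tops g)
      (q' := .body pend ct' tops g) (s := b.read.keep) (d := .stay) (ws := s) (wd := d)
      (by simp only [transition, h]) (by simp) hb
    rwa [Tape.act_keep] at this
  | @step ct ph t ct' ph' s d n' ct'' t'' h _ ih =>
    have := cfg_step (P := P) (ea := ea) (eb := eb) (n := n) (w := t) (b := b)
      (q := .store ph y pend ct tops g)
      (q' := .store ph' y pend ct' tops g) (s := b.read.keep) (d := .stay) (ws := s) (wd := d)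
      (by simp only [transition, h]) (by simp) hb
    rw [Tape.act_keep] at this
    rw [add_comm]
    exact this.trans ih

/-- Before the sweep to the left: the first `i` symbols have been converted. -/
def midTape {S : Type} (m : Mem K Γ E S) (F : ℕ → Option (BSym A B K Γ E S)) (i j : ℕ) :
    Option (BSym A B K Γ E S) :=
  if j < i then some (.output (none, some (m.cellOf j))) else F j

omit [Finite K] [Finite Γ] [Finite E] in
theorem midTape_update {S : Type} (m : Mem K Γ E S) (F : ℕ → Option (BSym A B K Γ E S)) (i : ℕ) :
    Function.update (midTape m F i) i (some (.output (none, some (m.cellOf i))))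
      = midTape m F (i + 1) := by
  funext j
  rcases eq_or_ne j i with rfl | h
  · simp [midTape]
  · rw [Function.update_of_ne h]
    simp only [midTape]
    congr 1
    simp only [eq_iff_iff]; omega

omit [Finite K] [Finite Γ] [Finite E] in
theorem midTape_self {S : Type} (m : Mem K Γ E S) (F : ℕ → Option (BSym A B K Γ E S)) (i : ℕ) :
    midTape m F i i = F i := by simp [midTape]

/-- Whether there is room, as seen in cell `i`. -/
noncomputable def roomAt {S : Type} (m : Mem K Γ E S) (i : ℕ) : Bool :=
  match i with
  | 0 => false
  | i + 1 => (m.cellOf i).isEmpty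

/-- The base tape holds the datum `x` and the memory `m`. -/
structure Holds {S : Type} (x : List A) (m : Mem K Γ E S) (n : ℕ)
    (F : ℕ → Option (BSym A B K Γ E S)) : Prop where
  input : ∀ i < n, ∃ c, F i = some (.input (x[i]?, c)) ∧ MemSym.norm c = m.cellOf i
  blank : ∀ i, n ≤ i → F i = none
  length_le : x.length ≤ n

variable {x : List A} {m : Mem K Γ E P.St} {F : ℕ → Option (BSym A B K Γ E P.St)}

omit [Finite K] [Finite Γ] [Finite E] [Finite A'] in
theorem Holds.cell_eq_none (H : Holds x m n F) {i h : ℕ} (hi : i ≤ n) :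
    ∀ j, n < j → (baseTape h (midTape m F i)).cell j = none := by
  intro j hj
  refine baseTape_cell_none (fun i' hi' => ?_) hj
  rw [midTape, if_neg (by omega)]
  exact H.blank _ hi'

theorem cfg_rest (H : Holds x m n F) {i : ℕ} (hi : x.length ≤ i) (hn : i ≤ n) (ct : Ctl P.St)
    (tops : K → Option Γ) :
    Runs (machine P ea eb) n
      (cfg P ea eb (.body false ct tops (roomAt m i)) (baseTape (i + 1) (midTape m F i)) w)
      (n - i + 1)
      (cfg P ea eb (.back (P.decide ct tops (roomAt m n)).1 (P.decide ct tops (roomAt m n)).2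
        (fun _ => none)) (baseTape n (midTape m F n)) w) := by
  obtain ⟨k, rfl⟩ := Nat.exists_eq_add_of_le hn
  induction k generalizing i with
  | zero =>
    have hF : midTape m F i i = none := (midTape_self m F i).trans (H.blank i (by simp))
    have hr := baseTape_read_none hF
    have := cfg_step_keep (P := P) (ea := ea) (eb := eb) (n := i) (w := w)
      (q := .body false ct tops (roomAt m i)) (b := baseTape (i + 1) (midTape m F i))
      (s := none) (d := .left)
      (q' := .back (P.decide ct tops (roomAt m i)).1 (P.decide ct tops (roomAt m i)).2
        (fun _ => none)) (by rw [hr]; rfl) (by simp)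
      (H.cell_eq_none (by simp))
    rw [baseTape_act_left, ← hF, Function.update_eq_self] at this
    simpa using this
  | succ k ih =>
    obtain ⟨c, hc, hm⟩ := H.input i (by omega)
    rw [List.getElem?_eq_none hi] at hc
    have hr := baseTape_read_some ((midTape_self m F i).trans hc)
    have := cfg_step_keep (P := P) (ea := ea) (eb := eb) (n := i + (k + 1)) (w := w)
      (q := .body false ct tops (roomAt m i)) (b := baseTape (i + 1) (midTape m F i))
      (s := some (.output (none, some (m.cellOf i)))) (d := .right)
      (q' := .body false ct tops (roomAt m (i + 1)))
      (by rw [hr, ← hm]; simp [transition, roomAt, hm])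
      (by simp) (H.cell_eq_none (by omega))
    rw [baseTape_act_right, midTape_update] at this
    have h2 := ih (i := i + 1) (by omega) (by rw [show i + 1 + k = i + (k + 1) by omega]; exact H) (by omega)
    rw [show i + 1 + k = i + (k + 1) by omega] at h2
    have h3 := this.trans h2
    rwa [show 1 + (i + (k + 1) - (i + 1) + 1) = i + (k + 1) - i + 1 by omega] at h3

/-- There is one step per cell, interrupted by the storing of the symbols. The two extra steps enter
the storing of the separator and turn round at the first blank. -/
theorem cfg_body (H : Holds x m n F) (tops : K → Option Γ) {l : List A} :
    ∀ {i : ℕ} {ct ct' : Ctl P.St} {w w' : Tape (WCell (Option A'))} {k : ℕ}, i + l.length = x.length →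
    x.drop i = l →
    StoreRuns P.entry (l.map (fun a => some (ea a)) ++ [none]) ct w k ct' w' →
    Runs (machine P ea eb) n
      (cfg P ea eb (.body true ct tops (roomAt m i)) (baseTape (i + 1) (midTape m F i)) w)
      (k + (n - i) + 2)
      (cfg P ea eb (.back (P.decide ct' tops (roomAt m n)).1 (P.decide ct' tops (roomAt m n)).2
        (fun _ => none)) (baseTape n (midTape m F n)) w') := by
  have hxn := H.length_le
  induction l with
  | nil =>
    intro i ct ct' w w' k hi hl hr
    have hix : i = x.length := by simpa using hi
    cases hr with
    | cons h h' =>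
      cases h'
      have hb := H.cell_eq_none (i := i) (h := i + 1) (by omega)
      have hst := cfg_store (P := P) (ea := ea) (eb := eb) hb h false tops (roomAt m i)
      have hrest := cfg_rest (P := P) (ea := ea) (eb := eb) (w := w') H (i := i) hix.ge (by omega) ct' tops
      have h1 : Runs (machine P ea eb) n
          (cfg P ea eb (.body true ct tops (roomAt m i)) (baseTape (i + 1) (midTape m F i)) w) 1
          (cfg P ea eb (.store .put none false ct tops (roomAt m i))
            (baseTape (i + 1) (midTape m F i)) w) := by
        have := cfg_step_keep (P := P) (ea := ea) (eb := eb) (n := n) (w := w)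
          (q := .body true ct tops (roomAt m i)) (b := baseTape (i + 1) (midTape m F i))
          (s := (baseTape (i + 1) (midTape m F i)).read.keep) (d := .stay)
          (q' := .store .put none false ct tops (roomAt m i))
          (by
            -- The end of the datum shows as a missing datum symbol beside the memory, or as the
            -- blank after the last cell.
            rcases Nat.lt_or_ge i n with hn | hn
            · obtain ⟨c, hc, hm⟩ := H.input i hn
              rw [List.getElem?_eq_none hix.ge] at hc
              rw [baseTape_read_some ((midTape_self m F i).trans hc)]
              rfl
            · rw [baseTape_read_none ((midTape_self m F i).trans (H.blank i hn))]
              rfl) (by simp) hb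
        rwa [Tape.act_keep] at this
      have := (h1.trans hst).trans hrest
      convert this using 1
      omega
  | cons a l ih =>
    intro i ct ct' w w' k hi hl hr
    have hlt : i < x.length := by simp at hi; omega
    have hxi : x[i]? = some a := by
      have := congrArg (fun l => l[0]?) hl
      simpa using this
    rw [List.map_cons, List.cons_append] at hr
    cases hr with
    | @cons _ _ _ _ k1 ct1 t1 k2 _ _ h h' =>
      obtain ⟨c, hc, hm⟩ := H.input i (by omega)
      rw [hxi] at hc
      have h1 := cfg_step_keep (P := P) (ea := ea) (eb := eb) (n := n) (w := w)
        (q := .body true ct tops (roomAt m i)) (b := baseTape (i + 1) (midTape m F i))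
        (s := some (.output (none, some (m.cellOf i)))) (d := .right)
        (q' := .store .put (some (ea a)) true ct tops (roomAt m (i + 1)))
        (by
          rw [baseTape_read_some ((midTape_self m F i).trans hc), ← hm]
          simp [transition, roomAt, hm]) (by simp) (H.cell_eq_none (by omega))
      rw [baseTape_act_right, midTape_update] at h1
      have h2 := cfg_store (P := P) (ea := ea) (eb := eb)
        (H.cell_eq_none (i := i + 1) (h := i + 2) (by omega)) h true tops (roomAt m (i + 1))
      have h3 := ih (i := i + 1) (by simp at hi; omega)
        (by rw [← List.drop_drop, hl]; rfl) h'
      have := (h1.trans h2).trans h3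
      convert this using 1
      omega

/-- The memory after the sweep to the left. -/
def Mem.back {S : Type} (m : Mem K Γ E S) (ct : Ctl S) (o : Ops K Γ E) : Mem K Γ E S :=
  ⟨ct, fun k => match o.st k with
    | .pop => (m.stk k).tail
    | _ => m.stk k, m.hn, m.ho⟩

omit [Finite K] [Finite Γ] [Finite E] in
theorem Mem.cellOf_back {S : Type} (m : Mem K Γ E S) (ct : Ctl S) (o : Ops K Γ E) (i : ℕ) :
    (m.back ct o).cellOf i =
      { m.cellOf i with
        ctl := (m.cellOf i).ctl.map fun _ => ct
        tr := fun k => (o.st k).backTr ((m.cellOf (i + 1)).tr k) ((m.cellOf i).tr k) } := by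
  simp only [Mem.cellOf, Mem.back, MemSym.mk.injEq, and_true]
  constructor
  · split <;> rfl
  · funext k
    cases o.st k <;> simp [StackOp.backTr]

/-- During the sweep to the left. -/
def backTape {S : Type} (m : Mem K Γ E S) (ct : Ctl S) (o : Ops K Γ E) (n i j : ℕ) :
    Option (BSym A B K Γ E S) :=
  if j < n then
    some (.output (none, some (if j < i then m.cellOf j else (m.back ct o).cellOf j)))
  else none

theorem cfg_back (ct : Ctl P.St) (o : Ops K Γ E) {i : ℕ} (hi : i ≤ n) :
    Runs (machine P ea eb) n
      (cfg P ea eb (.back ct o (m.cellOf i).tr) (baseTape i (backTape m ct o n i)) w) (i + 1)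
      (cfg P ea eb (.fwd o (fun k => (o.st k).pushed) o.hp) (baseTape 1 (backTape m ct o n 0)) w) := by
  have hb : ∀ i h, ∀ j, n < j →
      (baseTape h (backTape (A := A) (B := B) m ct o n i)).cell j = none := by
    intro i h j hj
    refine baseTape_cell_none (fun i' hi' => ?_) hj
    rw [backTape, if_neg (by omega)]
  induction i with
  | zero =>
    exact cfg_step_keep (P := P) (ea := ea) (eb := eb) (n := n) (w := w)
        (q := .back ct o (m.cellOf 0).tr) (b := baseTape 0 (backTape m ct o n 0))
        (s := none) (d := .right)
        (q' := .fwd o (fun k => (o.st k).pushed) o.hp) (by rw [baseTape_read_zero]; rfl) (by simp)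
        (hb _ _)
  | succ i ih =>
    have hr : (baseTape (i + 1) (backTape (A := A) (B := B) m ct o n (i + 1))).read
        = .sym (.output (none, some (m.cellOf i))) :=
      baseTape_read_some (by rw [backTape, if_pos (by omega), if_pos (by omega)])
    have := cfg_step_keep (P := P) (ea := ea) (eb := eb) (n := n) (w := w)
      (q := .back ct o (m.cellOf (i + 1)).tr) (b := baseTape (i + 1) (backTape m ct o n (i + 1)))
      (s := some (.output (none, some ((m.back ct o).cellOf i)))) (d := .left)
      (q' := .back ct o (m.cellOf i).tr)
      (by rw [hr, Mem.cellOf_back]; rfl) (by simp) (hb _ _)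
    rw [baseTape_act_left] at this
    have hu : Function.update (backTape (A := A) (B := B) m ct o n (i + 1)) i
        (some (.output (none, some ((m.back ct o).cellOf i)))) = backTape m ct o n i := by
      funext j
      rcases eq_or_ne j i with rfl | h
      · simp [backTape, show j < n by omega]
      · rw [Function.update_of_ne h]
        simp only [backTape]
        congr 6
        simp only [eq_iff_iff]; omega
    rw [hu] at this
    have h2 := this.trans (ih (by omega))
    rwa [add_comm 1 (i + 1)] at h2

omit [Finite K] [Finite Γ] [Finite E] in
-- Pushes shift to the right, so each cell is determined by itself and its left neighbour before the
-- sweep; for the first cell the pushed symbol takes the neighbour's place.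
theorem Mem.cellOf_app {S : Type} (m : Mem K Γ E S) (ct : Ctl S) (o : Ops K Γ E) (i : ℕ) :
    (m.app ct o).cellOf i =
      { ctl := ((m.back ct o).cellOf i).ctl
        tr := fun k => (o.st k).fwdTr
          ((if i = 0 then fun k => (o.st k).pushed else ((m.back ct o).cellOf (i - 1)).tr) k)
          (((m.back ct o).cellOf i).tr k)
        hn := bif o.cm then none else bif o.hp.isSome then
          (if i = 0 then o.hp else ((m.back ct o).cellOf (i - 1)).hn) else
          ((m.back ct o).cellOf i).hn
        ho := bif o.cm then ((m.back ct o).cellOf i).hn else ((m.back ct o).cellOf i).ho } := by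
  simp only [Mem.cellOf, Mem.back, Mem.app, MemSym.mk.injEq, true_and]
  refine ⟨?_, ?_, ?_⟩
  · funext k
    rcases i with _ | i <;> cases hk : o.st k <;> simp [StackOp.fwdTr, StackOp.app, StackOp.pushed, hk]
  · rcases o.cm <;> rcases o.hp with _ | e <;> rcases i with _ | i <;> simp
  · rcases o.cm <;> simp

/-- During the sweep to the right. -/
def fwdTape {S : Type} (eb : E → B) (m : Mem K Γ E S) (ct : Ctl S) (o : Ops K Γ E) (n i j : ℕ) :
    Option (BSym A B K Γ E S) :=
  if j < n then
    some (.output (if j < i then (((m.app ct o).ho[j]?).map eb, some ((m.app ct o).cellOf j))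
      else (none, some ((m.back ct o).cellOf j))))
  else none

theorem cfg_fwd (ct : Ctl P.St) (o : Ops K Γ E) {i : ℕ} (hi : i ≤ n) :
    Runs (machine P ea eb) n
      (cfg P ea eb (.fwd o (if i = 0 then fun k => (o.st k).pushed else
          ((m.back ct o).cellOf (i - 1)).tr)
        (if i = 0 then o.hp else ((m.back ct o).cellOf (i - 1)).hn))
        (baseTape (i + 1) (fwdTape eb m ct o n i)) w) (n - i + 1)
      (cfg P ea eb .fin (baseTape (n + 1) (fwdTape eb m ct o n n)) w) := by
  have hb : ∀ i h, ∀ j, n < j →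
      (baseTape h (fwdTape (A := A) eb m ct o n i)).cell j = none := by
    intro i h j hj
    refine baseTape_cell_none (fun i' hi' => ?_) hj
    rw [fwdTape, if_neg (by omega)]
  obtain ⟨k, rfl⟩ := Nat.exists_eq_add_of_le hi
  induction k generalizing i with
  | zero =>
    have hF : fwdTape (A := A) eb m ct o (i + 0) i i = none := by
      rw [fwdTape, if_neg (by omega)]
    have := cfg_step_keep (P := P) (ea := ea) (eb := eb) (n := i + 0) (w := w)
        (q := .fwd o (if i = 0 then fun k => (o.st k).pushed else
          ((m.back ct o).cellOf (i - 1)).tr)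
          (if i = 0 then o.hp else ((m.back ct o).cellOf (i - 1)).hn))
        (b := baseTape (i + 1) (fwdTape eb m ct o (i + 0) i))
        (s := (baseTape (i + 1) (fwdTape eb m ct o (i + 0) i)).read.keep) (d := .stay)
        (q' := .fin) (by rw [baseTape_read_none hF]; rfl) (by simp)
        (hb _ _)
    rw [Tape.act_keep] at this
    simpa using this
  | succ k ih =>
    have hr : (baseTape (i + 1) (fwdTape (A := A) eb m ct o (i + (k + 1)) i)).read
        = .sym (.output (none, some ((m.back ct o).cellOf i))) :=
      baseTape_read_some (by rw [fwdTape, if_pos (by omega), if_neg (by omega)])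
    have := cfg_step_keep (P := P) (ea := ea) (eb := eb) (n := i + (k + 1)) (w := w)
      (q := .fwd o (if i = 0 then fun k => (o.st k).pushed else
          ((m.back ct o).cellOf (i - 1)).tr)
          (if i = 0 then o.hp else ((m.back ct o).cellOf (i - 1)).hn))
      (b := baseTape (i + 1) (fwdTape eb m ct o (i + (k + 1)) i))
      (s := some (.output (((m.app ct o).ho[i]?).map eb, some ((m.app ct o).cellOf i))))
      (d := .right)
      (q' := .fwd o ((m.back ct o).cellOf i).tr ((m.back ct o).cellOf i).hn)
      (by
        have ho : (m.app ct o).ho[i]? = bif o.cm then ((m.back ct o).cellOf i).hn else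
            ((m.back ct o).cellOf i).ho := congrArg MemSym.ho (m.cellOf_app ct o i)
        rw [hr, Mem.cellOf_app, ho]; rfl) (by simp) (hb _ _)
    rw [baseTape_act_right] at this
    have hu : Function.update (fwdTape (A := A) eb m ct o (i + (k + 1)) i) i
        (some (.output (((m.app ct o).ho[i]?).map eb, some ((m.app ct o).cellOf i))))
        = fwdTape eb m ct o (i + (k + 1)) (i + 1) := by
      funext j
      rcases eq_or_ne j i with rfl | h
      · simp [fwdTape]
      · rw [Function.update_of_ne h]
        simp only [fwdTape]
        have hj : j < i ↔ j < i + 1 := by omega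
        simp only [hj]
    rw [hu] at this
    have h2 := ih (i := i + 1) (by omega) (by rw [show i + 1 + k = i + (k + 1) by omega]; exact hb)
    rw [show i + 1 + k = i + (k + 1) by omega] at h2
    have h3 := this.trans h2
    rwa [show 1 + (i + (k + 1) - (i + 1) + 1) = i + (k + 1) - i + 1 by omega] at h3

omit [Finite K] [Finite Γ] [Finite E] [Finite A'] in
theorem Mem.Fits.cellOf {S : Type} {m : Mem K Γ E S} (hm : m.Fits n) {i : ℕ} (h : n ≤ i)
    (h0 : i ≠ 0) : m.cellOf i = ⟨none, fun _ => none, none, none⟩ := by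
  simp only [Mem.cellOf, if_neg h0]
  congr 1
  · funext k; exact List.getElem?_eq_none ((hm.stk k).trans h)
  · exact List.getElem?_eq_none (hm.hn.trans h)
  · exact List.getElem?_eq_none (hm.ho.trans h)

omit [Finite K] [Finite Γ] [Finite E] [Finite A'] in
theorem Mem.Fits.mono {S : Type} {m : Mem K Γ E S} (hm : m.Fits n) {n' : ℕ} (h : n ≤ n') :
    m.Fits n' :=
  ⟨fun k => (hm.stk k).trans h, hm.hn.trans h, hm.ho.trans h⟩

/-- The memory in the beginning. -/
def Mem.init (P : Prog K Γ E (Option A')) : Mem K Γ E P.St := ⟨.run P.boot, fun _ => [], [], []⟩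

omit [Finite K] [Finite Γ] [Finite E] [Finite A'] in
theorem getElem?_toList {S : Type} (m : Mem K Γ E S) (n i : ℕ) :
    (m.toList n)[i]? = if i < n then some (m.cellOf i) else none := by
  simp only [Mem.toList, List.getElem?_map]
  split
  · rename_i h; simp [h]
  · rename_i h; simp [not_lt.1 h]

theorem getElem?_conv {C : Type u} {D : Type v} (x : List C) (y : List D) (i : ℕ) :
    (conv x y)[i]? = if i < max x.length y.length then some (x[i]?, y[i]?) else none := by
  simp only [conv, List.getElem?_map]
  split
  · rename_i h; rw [List.getElem?_range h]; rfl
  · rename_i h; rw [List.getElem?_eq_none (by simpa using h)]; rfl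

/-- The time consists of two steps at the left end, a sweep to the right with the storing inside, a
sweep to the left and another one to the right. The memory is padded to exactly `n'` cells, which
also leave room for the hypothesis. -/
theorem machine_cycle {n' k : ℕ} {ct' : Ctl P.St} (hm : m.Fits n) (h0 : n = 0 → m = Mem.init P)
    (hn' : n' = max n x.length)
    (hs : StoreRuns P.entry (x.map (fun a => some (ea a)) ++ [none]) (turnAct m.ctl w.read).1
      (w.act (turnAct m.ctl w.read).2.1 (turnAct m.ctl w.read).2.2) k ct' w')
    {o : Ctl P.St × Ops K Γ E} (ho : P.decide ct' (m.cellOf 0).tr (roomAt m n') = o)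
    (hfit : (m.app o.1 o.2).ho.length ≤ n') :
    (machine P ea eb).Cycle ⟨m.toList n, fun _ => w⟩ x (3 * n' + k + 6)
      ((m.app o.1 o.2).ho.map eb) ⟨(m.app o.1 o.2).toList n', fun _ => w'⟩ ∧
    ∀ s ≤ 3 * n' + k + 6, ∀ j, n' < j →
      ((machine P ea eb).steps s ((machine P ea eb).load ⟨m.toList n, fun _ => w⟩ x)).base.cell j
        = none := by
  have hm' : m.Fits n' := hm.mono (by omega)
  have hlen : (m.toList n).length = n := by simp [Mem.toList]
  obtain ⟨F, hF⟩ : ∃ F : ℕ → Option (BSym A B K Γ E P.St), F = fun i =>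
      if i < n' then some (.input (x[i]?, (m.toList n)[i]?)) else none := ⟨_, rfl⟩
  have hload : (machine P ea eb).load ⟨m.toList n, fun _ => w⟩ x
      = cfg P ea eb .start (baseTape 0 F) w := by
    have : (fun i => (((conv x (m.toList n)).map BaseSym.input)[i]? :
        Option (BSym A B K Γ E P.St))) = F := by
      funext i
      rw [hF, List.getElem?_map, getElem?_conv, hlen, max_comm, ← hn']
      dsimp only
      split <;> rfl
    rw [← this, ← ofList_eq_baseTape]
    rfl
  have hFb : ∀ h, ∀ j, n' < j → (baseTape h F).cell j = none := by
    intro h j hj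
    refine baseTape_cell_none (fun i' hi' => ?_) hj
    rw [hF]; exact if_neg (by omega)
  have hnorm : ∀ i < n', i ≠ 0 → MemSym.norm (m.toList n)[i]? = m.cellOf i := by
    intro i hi hi0
    rw [getElem?_toList]
    split
    · rfl
    · rw [hm.cellOf (by omega) hi0]; rfl
  have h1 : Runs (machine P ea eb) n' (cfg P ea eb .start (baseTape 0 F) w) 1
      (cfg P ea eb .first (baseTape 1 F) w) :=
    cfg_step_keep (P := P) (ea := ea) (eb := eb) (n := n') (w := w)
      (q := .start) (b := baseTape 0 F) (s := none) (d := .right)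
      (q' := .first) (by rw [baseTape_read_zero]; rfl) (by simp) (hFb _)
  obtain ⟨F', hH, h2⟩ : ∃ F', Holds x m n' F' ∧
      Runs (machine P ea eb) n' (cfg P ea eb .first (baseTape 1 F) w) 1
      (cfg P ea eb (.body true (turnAct m.ctl w.read).1 (m.cellOf 0).tr false) (baseTape 1 F')
        (w.act (turnAct m.ctl w.read).2.1 (turnAct m.ctl w.read).2.2)) := by
    -- Without any cell the memory cannot be written down; this does no harm, because it is then
    -- still the initial one.
    rcases Nat.eq_zero_or_pos n' with h | h
    · have hn : m = Mem.init P := h0 (by omega)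
      refine ⟨F, ⟨fun i hi => by omega, fun i hi => by rw [hF]; exact if_neg (by omega),
        by omega⟩, ?_⟩
      have hr : (baseTape (0 + 1) F).read = .blank :=
        baseTape_read_none (by rw [hF]; exact if_neg (by omega))
      have := cfg_step_keep (P := P) (ea := ea) (eb := eb) (n := n') (w := w)
        (q := .first) (b := baseTape (0 + 1) F) (s := (baseTape (0 + 1) F).read.keep) (d := .stay)
        (q' := .body true (.run P.boot) (fun _ => none) false) (by rw [hr]; rfl) (by simp) (hFb _)
      rw [Tape.act_keep] at this
      subst hn
      have ht : turnAct (Mem.init P).ctl w.read = (.run P.boot, w.read.keep, .stay) := by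
        cases w.read <;> rfl
      rw [ht, Tape.act_keep]
      exact this
    · have hF0 : F 0 = some (.input (x[0]?, (m.toList n)[0]?)) := by
        rw [hF]; exact if_pos h
      -- If the memory string is empty, the default control state and the empty tracks describe
      -- exactly the initial memory.
      have hc : { MemSym.norm (m.toList n)[0]? with
          ctl := some ((MemSym.norm (m.toList n)[0]?).ctl.getD (.run P.boot)) } = m.cellOf 0 := by
        rw [getElem?_toList]
        split
        · rfl
        · rw [h0 (by omega)]; rfl
      have hr := baseTape_read_some hF0
      have := cfg_step (P := P) (ea := ea) (eb := eb) (n := n') (w := w)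
        (q := .first) (b := baseTape (0 + 1) F)
        (s := some (.input (x[0]?, some (m.cellOf 0)))) (d := .stay)
        (q' := .body true (turnAct m.ctl w.read).1 (m.cellOf 0).tr false)
        (ws := (turnAct m.ctl w.read).2.1) (wd := (turnAct m.ctl w.read).2.2)
        (by
          have hct : (MemSym.norm (m.toList n)[0]?).ctl.getD (.run P.boot) = m.ctl := by
            have := congrArg MemSym.ctl hc
            exact Option.some.inj this
          have htr : (MemSym.norm (m.toList n)[0]?).tr = (m.cellOf 0).tr := by
            rw [← hc]
          rw [hr]
          simp only [transition]
          rw [hc, htr, hct]) (by simp) (hFb _)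
      rw [baseTape_act_stay] at this
      refine ⟨_, ⟨?_, ?_, by omega⟩, this⟩
      · intro i hi
        rcases eq_or_ne i 0 with rfl | hi0
        · exact ⟨some (m.cellOf 0), by simp, rfl⟩
        · refine ⟨_, ?_, hnorm i hi hi0⟩
          rw [Function.update_of_ne hi0, hF]
          exact if_pos hi
      · intro i hi
        rw [Function.update_of_ne (by omega), hF]
        exact if_neg (by omega)
  have hmid0 : midTape m F' 0 = F' := by funext j; simp [midTape]
  have h3 := cfg_body (P := P) (ea := ea) (eb := eb) hH (m.cellOf 0).tr (l := x) (i := 0)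
    (by simp) (by simp) hs
  rw [hmid0, ho] at h3
  have hmid : midTape m F' n' = backTape m o.1 o.2 n' n' := by
    funext j
    simp only [midTape, backTape]
    split
    · rfl
    · exact hH.blank _ (by omega)
  -- Beyond the last cell there is no entry, so the empty carry is the correct right neighbour.
  have htr : (fun _ => none) = (m.cellOf n').tr := by
    funext k
    exact (List.getElem?_eq_none (hm'.stk k)).symm
  rw [hmid, htr] at h3
  have h4 := cfg_back (P := P) (ea := ea) (eb := eb) (w := w') (m := m) (n := n') o.1 o.2 le_rfl
  have hbf : backTape m o.1 o.2 n' 0 = fwdTape (A := A) eb m o.1 o.2 n' 0 := by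
    funext j; simp [backTape, fwdTape]
  rw [hbf] at h4
  have h5 := cfg_fwd (P := P) (ea := ea) (eb := eb) (w := w') (m := m) o.1 o.2 (Nat.zero_le n')
  have hrun := (((h1.trans h2).trans h3).trans h4).trans h5
  rw [← hload, show 1 + 1 + (k + (n' - 0) + 2) + (n' + 1) + (n' - 0 + 1) = 3 * n' + k + 6 by omega]
    at hrun
  obtain ⟨he, hb⟩ := hrun
  refine ⟨⟨by rw [he]; rfl, fun s hs => (hb s hs).1, ?_, by rw [he]; rfl⟩, ?_⟩
  · have hout : (fun i => (((conv ((m.app o.1 o.2).ho.map eb) ((m.app o.1 o.2).toList n')).map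
        BaseSym.output)[i]? : Option (BSym A B K Γ E P.St))) = fwdTape eb m o.1 o.2 n' n' := by
      funext j
      have hl : max ((m.app o.1 o.2).ho.map eb).length ((m.app o.1 o.2).toList n').length = n' := by
        simp [Mem.toList, hfit]
      rw [List.getElem?_map, getElem?_conv, hl, getElem?_toList, fwdTape]
      split <;> simp
    rw [he]
    change (baseTape (n' + 1) _).cell = _
    rw [← hout]
    rfl
  · intro s hs j hj
    rcases hs.lt_or_eq with h | rfl
    · exact (hb s h).2 j hj
    · rw [he]
      refine baseTape_cell_none (fun i' hi' => ?_) hj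
      rw [fwdTape, if_neg (by omega)]
      rfl

end Cycle

end AutoLearn

namespace AutoLearn

/-! ### The background program -/

section Coding

open Turing.PartrecToTM2

/-- A coding of lists of natural numbers by natural numbers: the binary digits, the least significant
one first, are the unary representations of the entries, each one followed by `1`. -/
def unaryCode : List ℕ → ℕ
  | [] => 0
  | i :: l => 2 ^ i * (2 * unaryCode l + 1)

/-- The binary digits of `unaryCode l`. -/
def unaryBits : List ℕ → List Γ'
  | [] => []
  | i :: l => List.replicate i Γ'.bit0 ++ Γ'.bit1 :: unaryBits l

theorem trNat_two_mul_add_one (n : ℕ) : trNat (2 * n + 1) = Γ'.bit1 :: trNat n := by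
  have h : ((2 * n + 1 : ℕ) : Num) = (n : Num).bit1 := by
    rw [← Num.bit1_of_bit1, two_mul]; push_cast; rfl
  rw [trNat, h, trNat]
  cases (n : Num) <;> rfl

theorem trNat_two_mul {n : ℕ} (hn : n ≠ 0) : trNat (2 * n) = Γ'.bit0 :: trNat n := by
  have h : ((2 * n : ℕ) : Num) = (n : Num).bit0 := by
    rw [← Num.bit0_of_bit0, two_mul]; push_cast; rfl
  have h0 : (n : Num) ≠ 0 := by exact_mod_cast hn
  rw [trNat, h, trNat]
  rcases hm : (n : Num) with _ | m
  · exact absurd hm h0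
  · rfl

theorem trNat_two_pow_mul {n : ℕ} (hn : n ≠ 0) (i : ℕ) :
    trNat (2 ^ i * n) = List.replicate i Γ'.bit0 ++ trNat n := by
  induction i with
  | zero => simp
  | succ i ih =>
    rw [pow_succ', mul_assoc, trNat_two_mul (by positivity), ih]
    rfl

/-- Doubling pushes the digit `bit0`, and doubling plus one pushes `bit1`. So the stack that holds
the number is a unary text, which a finite control can write and read. -/
theorem trNat_unaryCode (l : List ℕ) : trNat (unaryCode l) = unaryBits l := by
  induction l with
  | nil => exact trNat_zero
  | cons i l ih => rw [unaryCode, trNat_two_pow_mul (by omega), trNat_two_mul_add_one, ih]; rfl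

theorem unaryCode_injective : Function.Injective unaryCode := by
  have key : ∀ (i j a b : ℕ), 2 ^ i * (2 * a + 1) = 2 ^ j * (2 * b + 1) → i = j ∧ a = b := by
    intro i
    induction i with
    | zero =>
      intro j a b h
      rcases j with _ | j
      · exact ⟨rfl, by omega⟩
      · rw [pow_succ', mul_assoc] at h; omega
    | succ i ih =>
      intro j a b h
      rcases j with _ | j
      · rw [pow_succ', mul_assoc] at h; omega
      · rw [pow_succ', pow_succ', mul_assoc, mul_assoc] at h
        have := ih j a b (by omega)
        exact ⟨by omega, this.2⟩
  intro l
  induction l with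
  | nil =>
    intro l' h
    rcases l' with _ | ⟨j, l'⟩
    · rfl
    · have : 2 ^ j * (2 * unaryCode l' + 1) ≠ 0 := by positivity
      exact absurd h.symm this
  | cons i l ih =>
    intro l' h
    rcases l' with _ | ⟨j, l'⟩
    · have : 2 ^ i * (2 * unaryCode l + 1) ≠ 0 := by positivity
      exact absurd h this
    · obtain ⟨rfl, h'⟩ := key _ _ _ _ h
      rw [ih h']

end Coding

/-! ### Runs of a stack program -/

section Leads

variable {K Γ E Y : Type}

/-- One step of the background program. -/
def Prog.micro (P : Prog K Γ E Y) (m : Mem K Γ E P.St) : Mem K Γ E P.St :=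
  m.app (P.decide m.ctl (fun k => (m.stk k).head?) true).1
    (P.decide m.ctl (fun k => (m.stk k).head?) true).2

/-- `n` steps of the background program lead from `m` to `m'`. -/
def Prog.Leads (P : Prog K Γ E Y) (n : ℕ) (m m' : Mem K Γ E P.St) : Prop :=
  P.micro^[n] m = m' ∧ ∀ i < n, ∃ s, (P.micro^[i] m).ctl = .run s

variable {P : Prog K Γ E Y} {m m' m'' : Mem K Γ E P.St}

theorem Prog.Leads.refl : P.Leads 0 m m := ⟨rfl, fun _ h => absurd h (Nat.not_lt_zero _)⟩

theorem Prog.Leads.trans {n n' : ℕ} (h : P.Leads n m m') (h' : P.Leads n' m' m'') :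
    P.Leads (n + n') m m'' := by
  have hs : ∀ s, P.micro^[n + s] m = P.micro^[s] m' := by
    intro s
    rw [add_comm, Function.iterate_add_apply, h.1]
  refine ⟨(hs _).trans h'.1, fun i hi => ?_⟩
  rcases Nat.lt_or_ge i n with h1 | h1
  · exact h.2 i h1
  · obtain ⟨r, rfl⟩ := Nat.exists_eq_add_of_le h1
    rw [hs]
    exact h'.2 r (by omega)

theorem Prog.Leads.single {s : P.St} {S : K → List Γ} {hn ho : List E} {s' : Option P.St}
    {o : Ops K Γ E} (h : P.δ s (fun k => (S k).head?) = (s', o)) :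
    P.Leads 1 ⟨.run s, S, hn, ho⟩
      ((⟨.run s, S, hn, ho⟩ : Mem K Γ E P.St).app (s'.elim .ready .run) o) := by
  refine ⟨?_, fun i hi => ?_⟩
  · simp only [Function.iterate_one, Prog.micro, Prog.decide, h]
    cases s' <;> rfl
  · obtain rfl : i = 0 := by omega
    exact ⟨s, rfl⟩

end Leads

/-! ### The stack program that executes a partial recursive code -/

section Background

open Turing Turing.PartrecToTM2 Turing.TM2

/-- The operation `op` on stack `k`. -/
def Ops.at {Γ E : Type} (k : K') (op : StackOp Γ) : Ops K' Γ E :=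
  ⟨Function.update (fun _ => .keep) k op, none, false⟩

/-- Part of a step of a machine with stacks: the rest of the statement and the local store, or `none`
if the machine halts, and the operations on the stacks. -/
def stmtStep {E : Type} (M : Λ' → Stmt (fun _ : K' => Γ') Λ' (Option Γ')) (v : Option Γ')
    (tops : K' → Option Γ') : Stmt (fun _ : K' => Γ') Λ' (Option Γ') →
    Option (Stmt (fun _ : K' => Γ') Λ' (Option Γ') × Option Γ') × Ops K' Γ' E
  | .push k f q => (some (q, v), Ops.at k (.push (f v)))
  | .peek k f q => (some (q, f v (tops k)), Ops.idle)
  | .pop k f q => (some (q, f v (tops k)), Ops.at k .pop)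
  | .load a q => (some (q, a v), Ops.idle)
  | .branch f q₁ q₂ => (some (cond (f v) q₁ q₂, v), Ops.idle)
  | .goto f => (some (M (f v), v), Ops.idle)
  | .halt => (none, Ops.idle)

/-- The statements that occur in the execution of a code. -/
def codeStmts (c : ToPartrec.Code) : Set (Stmt (fun _ : K' => Γ') Λ' (Option Γ')) :=
  {q | some q ∈ stmts tr (codeSupp c Cont'.halt)}

/-- A fixed code involves only finitely many statements, so these can be part of the finite control.
-/
theorem finite_codeStmts (c : ToPartrec.Code) : Finite (codeStmts c) := by
  have : Set.Finite {q | some q ∈ stmts tr (codeSupp c Cont'.halt)} :=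
    (Finset.finite_toSet _).preimage (Option.some_injective _).injOn
  exact this.to_subtype

open Classical in
theorem tr_mem_codeStmts {c : ToPartrec.Code} {l : Λ'} (h : l ∈ codeSupp c Cont'.halt) :
    tr l ∈ codeStmts c := by
  change some (tr l) ∈ stmts tr (codeSupp c Cont'.halt)
  exact Finset.some_mem_insertNone.2 (Finset.mem_biUnion.2 ⟨l, h, stmts₁_self⟩)

open Classical in
-- Substatements stay inside by `stmts_trans`, and jumps by `tr_supports`. Hence `BgState.exec` does
-- not resort to its default while the code is running.
theorem stmtStep_mem {E : Type} {c : ToPartrec.Code} {q q' v v' tops} {o : Ops K' Γ' E}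
    (hq : q ∈ codeStmts c) (h : stmtStep tr v tops q = (some (q', v'), o)) : q' ∈ codeStmts c := by
  have hs := @stmts_supportsStmt _ _ _ _ ⟨trNormal c Cont'.halt⟩ _ _ _ (tr_supports c Cont'.halt) hq
  have hsub : ∀ q', q' ∈ stmts₁ q → q' ∈ codeStmts c := fun q' h => stmts_trans h hq
  cases q with
  | goto f => cases h; exact tr_mem_codeStmts (hs v)
  | halt => cases h
  | branch f q₁ q₂ =>
    cases h
    refine hsub _ ?_
    rw [stmts₁]
    refine Finset.mem_insert_of_mem ?_
    cases f v
    · exact Finset.mem_union_right _ stmts₁_self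
    · exact Finset.mem_union_left _ stmts₁_self
  | _ =>
    cases h
    exact hsub _ (by rw [stmts₁]; exact Finset.mem_insert_of_mem stmts₁_self)

/-- The states of the background program. -/
inductive BgState (c : ToPartrec.Code) (a b : ℕ) : Type
  | boot
  | app0 (j : Fin a)
  | app1 (j : Fin a)
  | tm (q : codeStmts c) (v : Option Γ')
  | dec0
  | dec1 (j : Fin (b + 1))

instance (c : ToPartrec.Code) (a b : ℕ) : Finite (BgState c a b) :=
  have := finite_codeStmts c
  Finite.of_injective (β := Option (Option (Fin a ⊕ Fin a ⊕ (codeStmts c × Option Γ') ⊕ Fin (b + 1))))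
    (fun
      | .boot => none
      | .dec0 => some none
      | .app0 j => some (some (.inl j))
      | .app1 j => some (some (.inr (.inl j)))
      | .tm q v => some (some (.inr (.inr (.inl (q, v)))))
      | .dec1 j => some (some (.inr (.inr (.inr j)))))
    (by intro x y h; cases x <;> cases y <;> simp_all)

variable {c : ToPartrec.Code} {a b : ℕ} {E Y : Type}

open Classical in
/-- The state in which the statement `q` is executed. -/
noncomputable def BgState.exec (q : Stmt (fun _ : K' => Γ') Λ' (Option Γ')) (v : Option Γ') :
    BgState c a b :=
  if h : q ∈ codeStmts c then .tm ⟨q, h⟩ v else .dec0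

/-- The background program: append the code of the answer to the history on the main stack, run the
code `c`, and then decode the first component of its output; its first entry is skipped, and the others
are the letters of the new hypothesis. -/
noncomputable def background (c : ToPartrec.Code) (a b : ℕ) (code : Resp Y → Fin a)
    (letter : ℕ → Option E) : Prog K' Γ' E Y where
  St := BgState c a b
  finSt := inferInstance
  boot := .boot
  entry := fun r => .app0 (code r)
  δ := fun s tops => match s with
    | .boot => (some (.exec (tr (trNormal c Cont'.halt)) none), Ops.at K'.main (.push Γ'.cons))
    | .app0 j => (some (.app1 j), Ops.at K'.main (.push Γ'.bit1))
    | .app1 ⟨0, _⟩ => (some (.exec (tr (trNormal c Cont'.halt)) none), Ops.idle)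
    | .app1 ⟨j + 1, h⟩ => (some (.app1 ⟨j, by omega⟩), Ops.at K'.main (.push Γ'.bit0))
    | .tm q v =>
      (match (stmtStep (E := E) tr v tops q.1).1 with
        | some (q', v') => some (.exec q' v')
        | none => some .dec0, (stmtStep tr v tops q.1).2)
    | .dec0 =>
      match tops K'.main with
      | some Γ'.bit1 => (some (.dec1 0), Ops.at K'.main .pop)
      | _ => (some .dec0, Ops.at K'.main .pop)
    | .dec1 j =>
      match tops K'.main with
      | some Γ'.bit0 => (some (.dec1 ⟨min (j + 1) b, by omega⟩), Ops.at K'.main .pop)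
      | some Γ'.bit1 => (some (.dec1 0), ⟨(Ops.at (E := E) K'.main .pop).st, letter j, false⟩)
      | _ => (none, ⟨(Ops.at (E := E) K'.main .pop).st, none, true⟩)

/-- The stacks between rounds. -/
def mainStack (l : List Γ') : K' → List Γ' := K'.elim l [] [] []

theorem app_at_main (l : List Γ') (op : StackOp Γ') :
    (fun k => ((Ops.at (E := E) K'.main op).st k).app (mainStack l k)) = mainStack (op.app l) := by
  funext k
  cases k <;> rfl

variable {code : Resp Y → Fin a} {letter : ℕ → Option E}

/-- The memory while the background program is running. -/
noncomputable def bgMem (code : Resp Y → Fin a) (letter : ℕ → Option E) (s : BgState c a b)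
    (S : K' → List Γ') (hn ho : List E) : Mem K' Γ' E (background c a b code letter).St :=
  ⟨.run s, S, hn, ho⟩

theorem leads_single {s s' : BgState c a b} {S S' : K' → List Γ'} {hn hn' ho : List E}
    {o : Ops K' Γ' E}
    (h : (background c a b code letter).δ s (fun k => (S k).head?) = (some s', o))
    (hS : (fun k => (o.st k).app (S k)) = S') (hh : o.hp.toList ++ hn = hn') (hc : o.cm = false) :
    (background c a b code letter).Leads 1 (bgMem code letter s S hn ho)
      (bgMem code letter s' S' hn' ho) := by
  have := Prog.Leads.single (P := background c a b code letter) (s := s) (S := S) (hn := hn)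
    (ho := ho) h
  rw [Mem.app, hS, hh, hc] at this
  exact this

theorem app_at (k : K') (op : StackOp Γ') (S : K' → List Γ') :
    (fun k' => ((Ops.at (E := E) k op).st k').app (S k')) = Function.update S k (op.app (S k)) := by
  funext k'
  rcases eq_or_ne k' k with rfl | h
  · simp [Ops.at]
  · simp [Ops.at, h, StackOp.app]

/-- The commands of the code. -/
noncomputable def startState (c : ToPartrec.Code) (a b : ℕ) : BgState c a b :=
  .exec (tr (trNormal c Cont'.halt)) none

theorem leads_app1 (j : ℕ) (hj : j < a) (l : List Γ') (ho : List E) :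
    (background c a b code letter).Leads (j + 1)
      (bgMem code letter (.app1 ⟨j, hj⟩) (mainStack l) [] ho)
      (bgMem code letter (startState c a b) (mainStack (List.replicate j Γ'.bit0 ++ l)) [] ho) := by
  induction j generalizing l with
  | zero => exact leads_single rfl rfl rfl rfl
  | succ j ih =>
    have h2 := ih (by omega) (Γ'.bit0 :: l)
    rw [List.append_cons, ← List.replicate_succ'] at h2
    rw [add_comm]
    exact (leads_single rfl (app_at_main l (.push Γ'.bit0)) rfl rfl).trans h2

/-- The memory that represents a configuration of the code. -/
noncomputable def cfgMem (code : Resp Y → Fin a) (letter : ℕ → Option E) (ho : List E)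
    (C : TM2.Cfg (fun _ : K' => Γ') Λ' (Option Γ')) :
    Mem K' Γ' E (background c a b code letter).St :=
  bgMem code letter (match C.l with
    | some l => .exec (tr l) C.var
    | none => .dec0) C.stk [] ho

theorem leads_stmtStep {q : Stmt (fun _ : K' => Γ') Λ' (Option Γ')} (hq : q ∈ codeStmts c)
    {v : Option Γ'} {S S' : K' → List Γ'} {ho : List E} {o : Ops K' Γ' E}
    (h1 : (stmtStep tr v (fun k => (S k).head?) q).2 = o)
    (h2 : (fun k => (o.st k).app (S k)) = S') (h3 : o.hp = none) (h4 : o.cm = false) :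
    (background c a b code letter).Leads 1 (bgMem code letter (.exec q v) S [] ho)
      (bgMem code letter (match (stmtStep (E := E) tr v (fun k => (S k).head?) q).1 with
        | some (q', v') => .exec q' v'
        | none => .dec0) S' [] ho) := by
  refine leads_single (o := o) ?_ h2 (by rw [h3]; rfl) h4
  rw [← h1]
  simp only [background, BgState.exec, dif_pos hq]
  split <;> rfl

/-- A step of the stack machine performs a whole statement; here each of its parts takes a step of
its own, since one step of the program applies only one operation to each stack. -/
theorem leads_stmt (q : Stmt (fun _ : K' => Γ') Λ' (Option Γ')) (hq : q ∈ codeStmts c)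
    (v : Option Γ') (S : K' → List Γ') (ho : List E) :
    ∃ n, (background c a b code letter).Leads n (bgMem code letter (.exec q v) S [] ho)
      (cfgMem code letter ho (stepAux q v S)) := by
  induction q generalizing v S with
  | push k f q ih =>
    obtain ⟨n, h⟩ := ih (stmtStep_mem (E := E) (v := v) (tops := fun k => (S k).head?) hq rfl) v
      (Function.update S k (f v :: S k))
    exact ⟨1 + n, (leads_stmtStep hq rfl (app_at k (.push (f v)) S) rfl rfl).trans h⟩
  | peek k f q ih =>
    obtain ⟨n, h⟩ := ih (stmtStep_mem (E := E) (v := v) (tops := fun k => (S k).head?) hq rfl)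
      (f v (S k).head?) S
    exact ⟨1 + n, (leads_stmtStep hq rfl rfl rfl rfl).trans h⟩
  | pop k f q ih =>
    obtain ⟨n, h⟩ := ih (stmtStep_mem (E := E) (v := v) (tops := fun k => (S k).head?) hq rfl)
      (f v (S k).head?) (Function.update S k (S k).tail)
    exact ⟨1 + n, (leads_stmtStep hq rfl (app_at k .pop S) rfl rfl).trans h⟩
  | load f q ih =>
    obtain ⟨n, h⟩ := ih (stmtStep_mem (E := E) (v := v) (tops := fun k => (S k).head?) hq rfl)
      (f v) S
    exact ⟨1 + n, (leads_stmtStep hq rfl rfl rfl rfl).trans h⟩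
  | branch f q₁ q₂ ih₁ ih₂ =>
    have hm := stmtStep_mem (E := E) (v := v) (tops := fun k => (S k).head?) hq rfl
    have hst := leads_stmtStep (code := code) (letter := letter) (b := b) (v := v) (S := S)
      (ho := ho) hq rfl rfl rfl rfl
    simp only [stmtStep] at hst
    rw [stepAux]
    cases hf : f v <;> rw [hf] at hm hst
    · obtain ⟨n, h⟩ := ih₂ hm v S
      exact ⟨1 + n, hst.trans h⟩
    · obtain ⟨n, h⟩ := ih₁ hm v S
      exact ⟨1 + n, hst.trans h⟩
  | goto f => exact ⟨1, leads_stmtStep hq rfl rfl rfl rfl⟩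
  | halt => exact ⟨1, leads_stmtStep hq rfl rfl rfl rfl⟩

/-- Supportedness of the current label is carried along, because only supported statements are
states of the program. A halting configuration corresponds to `dec0`, where decoding starts. -/
theorem leads_reaches {C C' : TM2.Cfg (fun _ : K' => Γ') Λ' (Option Γ')}
    (h : StateTransition.Reaches (TM2.step tr) C C')
    (hC : C.l ∈ Finset.insertNone (codeSupp c Cont'.halt)) (ho : List E) :
    ∃ n, (background c a b code letter).Leads n (cfgMem code letter ho C)
      (cfgMem code letter ho C') := by
  induction h using Relation.ReflTransGen.head_induction_on with
  | refl => exact ⟨0, Prog.Leads.refl⟩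
  | @head C C₁ h _ ih =>
    obtain ⟨n, h2⟩ := ih (@step_supports _ _ _ _ ⟨trNormal c Cont'.halt⟩ _ _ _
      (tr_supports c Cont'.halt) _ _ h hC)
    rcases C with ⟨_ | l, v, S⟩
    · have : none = some C₁ := h
      cases this
    · obtain rfl : stepAux (tr l) v S = C₁ := Option.some.inj h
      obtain ⟨n', h1⟩ := leads_stmt (code := code) (letter := letter) (b := b) (tr l)
        (tr_mem_codeStmts (Finset.some_mem_insertNone.1 hC)) v S ho
      exact ⟨n' + n, h1.trans h2⟩

theorem leads_eval {N : ℕ} {l : List ℕ} (h : l ∈ c.eval [N]) (ho : List E) :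
    ∃ n, (background c a b code letter).Leads n
      (bgMem code letter (startState c a b) (mainStack (trList [N])) [] ho)
      (bgMem code letter .dec0 (mainStack (trList l)) [] ho) := by
  have h1 : halt l ∈ StateTransition.eval (TM2.step tr) (init c [N]) := by
    rw [tr_eval]
    exact Part.mem_map _ h
  exact leads_reaches (StateTransition.mem_eval.1 h1).1
    (Finset.some_mem_insertNone.2 (codeSupp_self _ _ (trStmts₁_self _))) ho

theorem leads_dec0 (i : ℕ) (l : List Γ') (ho : List E) :
    (background c a b code letter).Leads (i + 1)
      (bgMem code letter .dec0 (mainStack (List.replicate i Γ'.bit0 ++ Γ'.bit1 :: l)) [] ho)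
      (bgMem code letter (.dec1 0) (mainStack l) [] ho) := by
  induction i with
  | zero => exact leads_single rfl (app_at_main _ .pop) rfl rfl
  | succ i ih =>
    rw [add_comm]
    exact (leads_single rfl (app_at_main _ .pop) rfl rfl).trans ih

/-- The control state counts the digits `bit0` up to the next `bit1`; the assumption `j + i ≤ b`
prevents the counter from saturating. -/
theorem leads_letter (j : ℕ) (hj : j < b + 1) (i : ℕ) (hji : j + i ≤ b) (l : List Γ')
    (hn ho : List E) :
    (background c a b code letter).Leads (i + 1)
      (bgMem code letter (.dec1 ⟨j, hj⟩)
        (mainStack (List.replicate i Γ'.bit0 ++ Γ'.bit1 :: l)) hn ho)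
      (bgMem code letter (.dec1 0) (mainStack l) ((letter (j + i)).toList ++ hn) ho) := by
  induction i generalizing j with
  | zero => exact leads_single rfl (app_at_main (E := E) _ .pop) rfl rfl
  | succ i ih =>
    rw [add_comm (i + 1)]
    have h := ih (j + 1) (by omega) (by omega)
    rw [show j + 1 + i = j + (i + 1) by omega] at h
    refine Prog.Leads.trans ?_ h
    refine leads_single (o := Ops.at K'.main .pop) ?_ (app_at_main _ .pop) rfl rfl
    have hm : min (j + 1) b = j + 1 := by omega
    simp only [background, mainStack, K'.elim, List.replicate_succ, List.cons_append, List.head?_cons,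
      hm]

theorem leads_letters (L : List ℕ) (hL : ∀ i ∈ L, i ≤ b) (l : List Γ') (hn ho : List E) :
    ∃ n, (background c a b code letter).Leads n
      (bgMem code letter (.dec1 0) (mainStack (unaryBits L ++ l)) hn ho)
      (bgMem code letter (.dec1 0) (mainStack l)
        ((L.map fun i => (letter i).toList).reverse.flatten ++ hn) ho) := by
  induction L generalizing hn with
  | nil => exact ⟨0, Prog.Leads.refl⟩
  | cons i L ih =>
    obtain ⟨n, h⟩ := ih (fun i hi => hL i (by simp [hi])) ((letter i).toList ++ hn)
    have h1 := leads_letter (code := code) (letter := letter) (c := c) 0 (by omega) i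
      (by simpa using hL i (by simp)) (unaryBits L ++ l) hn ho
    rw [Nat.zero_add] at h1
    refine ⟨i + 1 + n, ?_⟩
    rw [unaryBits, List.append_assoc, List.cons_append]
    have hl : (List.map (fun i => (letter i).toList) (i :: L)).reverse.flatten ++ hn =
        (List.map (fun i => (letter i).toList) L).reverse.flatten ++ ((letter i).toList ++ hn) := by
      simp
    rw [hl]
    exact h1.trans h

theorem leads_commit (l : List Γ') (hn ho : List E) :
    (background c a b code letter).Leads 1
      (bgMem code letter (.dec1 0) (mainStack (Γ'.cons :: l)) hn ho)
      ⟨.ready, mainStack l, [], hn⟩ := by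
  have := Prog.Leads.single (P := background c a b code letter) (s := .dec1 0)
    (S := mainStack (Γ'.cons :: l)) (hn := hn) (ho := ho) rfl
  rw [Mem.app, app_at_main (E := E) (Γ'.cons :: l) .pop] at this
  exact this

/-- The memory between rounds. -/
def restMem (code : Resp Y → Fin a) (letter : ℕ → Option E) (ct : Ctl (BgState c a b)) (N : ℕ)
    (ho : List E) : Mem K' Γ' E (background c a b code letter).St :=
  ⟨ct, mainStack (trList [N]), [], ho⟩

/-- When the code has halted, the entry `i` stands on the main stack as a block of `i` digits
`bit0`. The moment `mid` is singled out because this height forces the memory to have at least `i`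
cells. Decoding then consumes the first component and leaves the history. -/
theorem leads_output {N : ℕ} {i : ℕ} {L : List ℕ} (h : [unaryCode (i :: L), N] ∈ c.eval [N])
    (hL : ∀ i ∈ L, i ≤ b) (ho : List E) :
    ∃ n n' mid, (background c a b code letter).Leads n
        (bgMem code letter (startState c a b) (mainStack (trList [N])) [] ho) mid ∧
      (background c a b code letter).Leads n' mid
        (restMem code letter .ready N (L.map fun i => (letter i).toList).reverse.flatten) ∧
      i ≤ (mid.stk K'.main).length := by
  obtain ⟨n, h1⟩ := leads_eval (a := a) (b := b) (code := code) (letter := letter) h ho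
  have hl : trList [unaryCode (i :: L), N]
      = List.replicate i Γ'.bit0 ++ Γ'.bit1 :: (unaryBits L ++ Γ'.cons :: trList [N]) := by
    simp [trNat_unaryCode, unaryBits]
  rw [hl] at h1
  obtain ⟨n', h3⟩ := leads_letters (code := code) (letter := letter) (c := c) L hL
    (Γ'.cons :: trList [N]) [] ho
  rw [List.append_nil] at h3
  refine ⟨n, _, _, h1, ((leads_dec0 _ _ _).trans h3).trans (leads_commit _ _ _), ?_⟩
  simp [bgMem, mainStack]

variable (c a b code letter) in
-- The empty history has code `0`, which has no digits, so pushing a single separator prepares the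
-- input.
theorem leads_boot {i : ℕ} {L : List ℕ} (h : [unaryCode (i :: L), 0] ∈ c.eval [0])
    (hL : ∀ i ∈ L, i ≤ b) :
    ∃ n n' mid, (background c a b code letter).Leads n ⟨.run .boot, fun _ => [], [], []⟩ mid ∧
      (background c a b code letter).Leads n' mid
        (restMem code letter .ready 0 (L.map fun i => (letter i).toList).reverse.flatten) ∧
      i ≤ (mid.stk K'.main).length := by
  obtain ⟨n, n', mid, h1, h2, h3⟩ := leads_output (a := a) (b := b) (code := code)
    (letter := letter) h hL []
  refine ⟨1 + n, n', mid, Prog.Leads.trans ?_ h1, h2, h3⟩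
  have hS : (fun _ => []) = mainStack [] := by funext k; cases k <;> rfl
  rw [hS]
  refine leads_single rfl ?_ rfl rfl
  rw [app_at_main]
  simp [StackOp.app]

/-- The newest answer sits at the least significant end of the code, which is the top of the stack;
appending it needs only pushes. -/
theorem leads_entry {r : Resp Y} {N i : ℕ} {L : List ℕ}
    (h : [unaryCode (i :: L), 2 ^ (code r : ℕ) * (2 * N + 1)] ∈
      c.eval [2 ^ (code r : ℕ) * (2 * N + 1)])
    (hL : ∀ i ∈ L, i ≤ b) (ho : List E) :
    ∃ n n' mid, (background c a b code letter).Leads n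
        (restMem code letter (.run ((background c a b code letter).entry r)) N ho) mid ∧
      (background c a b code letter).Leads n' mid
        (restMem code letter .ready (2 ^ (code r : ℕ) * (2 * N + 1))
          (L.map fun i => (letter i).toList).reverse.flatten) ∧
      i ≤ (mid.stk K'.main).length := by
  obtain ⟨n, n', mid, h1, h2, h3⟩ := leads_output (a := a) (b := b) (code := code)
    (letter := letter) h hL ho
  have h4 : (background c a b code letter).Leads 1
      (restMem code letter (.run ((background c a b code letter).entry r)) N ho)
      (bgMem code letter (.app1 (code r)) (mainStack (Γ'.bit1 :: trList [N])) [] ho) :=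
    leads_single rfl (app_at_main (trList [N]) (.push Γ'.bit1)) rfl rfl
  have h5 := leads_app1 (c := c) (b := b) (code := code) (letter := letter) (code r : ℕ) (code r).2
    (Γ'.bit1 :: trList [N]) ho
  have hl : List.replicate (code r : ℕ) Γ'.bit0 ++ Γ'.bit1 :: trList [N]
      = trList [2 ^ (code r : ℕ) * (2 * N + 1)] := by
    simp [trNat_two_pow_mul, trNat_two_mul_add_one]
  rw [hl] at h5
  exact ⟨_, n', mid, (h4.trans h5).trans h1, h2, h3⟩

end Background

end AutoLearn

namespace AutoLearn

/-! ### Computability of the background computation -/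

section Computability

theorem primrec_alternate {α : Type*} [Primcodable α] : Primrec (alternate (α := α)) := by
  have h : ∀ l : List α, l.foldr (fun a p => (a :: p.2, p.1)) ([], []) = alternate l := by
    intro l
    induction l with
    | nil => rfl
    | cons a l ih => rw [List.foldr_cons, ih]; rfl
  refine (Primrec.list_foldr Primrec.id (Primrec.const (([], []) : List α × List α))
    (h := fun _ p => (p.1 :: p.2.2, p.2.1)) ?_).of_eq h
  have : Primrec fun q : List α × α × List α × List α => (q.2.1 :: q.2.2.2, q.2.2.1) :=
    Primrec.pair (Primrec.list_cons.comp (Primrec.fst.comp Primrec.snd)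
      (Primrec.snd.comp (Primrec.snd.comp Primrec.snd)))
      (Primrec.fst.comp (Primrec.snd.comp Primrec.snd))
  exact this.to₂

theorem primrec_sieve {α : Type*} [Primcodable α] : Primrec (sieve (α := α)) := by
  have hs : Primrec (fun q : (List α × List (List α)) × Option α => sieveStep q.1 q.2) := by
    have h1 : Primrec (fun q : (List α × List (List α)) × Option α => q.1.1) :=
      Primrec.fst.comp Primrec.fst
    have h2 : Primrec (fun q : (List α × List (List α)) × Option α => q.1.2) :=
      Primrec.snd.comp Primrec.fst
    have ha := primrec_alternate.comp h1
    have hn : Primrec (fun q : (List α × List (List α)) × Option α =>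
        ((alternate q.1.1).2, q.1.2 ++ [(alternate q.1.1).1])) :=
      Primrec.pair (Primrec.snd.comp ha) (Primrec.list_append.comp h2
        (Primrec.list_cons.comp (Primrec.fst.comp ha) (Primrec.const [])))
    have hsm : Primrec₂ (fun (q : (List α × List (List α)) × Option α) (a : α) =>
        (q.1.1 ++ [a], q.1.2)) :=
      (Primrec.pair (Primrec.list_append.comp (h1.comp Primrec.fst)
        (Primrec.list_cons.comp Primrec.snd (Primrec.const []))) (h2.comp Primrec.fst)).to₂
    refine (Primrec.option_casesOn Primrec.snd hn hsm).of_eq ?_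
    rintro ⟨st, _ | a⟩ <;> rfl
  exact Primrec.list_foldl Primrec.id (Primrec.const _) (hs.comp Primrec.snd).to₂

theorem primrec_readOut {β : Type*} [Primcodable β] :
    Primrec (readOut (Prod.fst : β × β → β) Prod.snd) := by
  have : Primrec fun q : List (List (β × β)) × List (β × β) =>
      q.2.map Prod.fst ++ (q.2.map Prod.snd).reverse :=
    Primrec.list_append.comp (Primrec.list_map Primrec.snd (Primrec.fst.comp Primrec.snd).to₂)
      (Primrec.list_reverse.comp
        (Primrec.list_map Primrec.snd (Primrec.snd.comp Primrec.snd).to₂))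
  exact Primrec.list_flatMap Primrec.id this.to₂

theorem primrec_answerStream {Y : Type} [Primcodable Y] : Primrec (answerStream (Y := Y)) := by
  have h : Primrec (List.reduceOption (α := Option (Y × Y))) :=
    Primrec.listFilterMap Primrec.id Primrec.snd.to₂
  exact primrec_readOut.comp (Primrec.snd.comp (primrec_sieve.comp h))

theorem primrec_splitStream {α : Type*} [Primcodable α] : Primrec (splitStream (α := α)) := by
  have hs : Primrec (fun q : (List (List α) × List α) × Option α => splitStep q.1 q.2) := by
    have h1 : Primrec (fun q : (List (List α) × List α) × Option α => q.1.1) :=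
      Primrec.fst.comp Primrec.fst
    have h2 : Primrec (fun q : (List (List α) × List α) × Option α => q.1.2) :=
      Primrec.snd.comp Primrec.fst
    have hn : Primrec (fun q : (List (List α) × List α) × Option α =>
        (q.1.1 ++ [q.1.2], ([] : List α))) :=
      Primrec.pair (Primrec.list_append.comp h1
        (Primrec.list_cons.comp h2 (Primrec.const []))) (Primrec.const _)
    have hsm : Primrec₂ (fun (q : (List (List α) × List α) × Option α) (a : α) =>
        (q.1.1, q.1.2 ++ [a])) :=
      (Primrec.pair (h1.comp Primrec.fst) (Primrec.list_append.comp (h2.comp Primrec.fst)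
        (Primrec.list_cons.comp Primrec.snd (Primrec.const [])))).to₂
    refine (Primrec.option_casesOn Primrec.snd hn hsm).of_eq ?_
    rintro ⟨st, _ | a⟩ <;> rfl
  exact Primrec.fst.comp
    (Primrec.list_foldl Primrec.id (Primrec.const _) (hs.comp Primrec.snd).to₂)

theorem primrec_unaryCode : Primrec unaryCode := by
  have h : ∀ l : List ℕ, l.foldr (fun i n => (fun x => 2 * x)^[i] (2 * n + 1)) 0 = unaryCode l := by
    intro l
    induction l with
    | nil => rfl
    | cons i l ih =>
      rw [List.foldr_cons, ih, unaryCode]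
      generalize 2 * unaryCode l + 1 = n
      induction i with
      | zero => simp
      | succ i ih => rw [Function.iterate_succ_apply', ih, pow_succ]; ring
  refine (Primrec.list_foldr Primrec.id (Primrec.const 0)
    (h := fun _ p => (fun x => 2 * x)^[p.1] (2 * p.2 + 1)) ?_).of_eq h
  have : Primrec fun q : List ℕ × ℕ × ℕ => (fun x => 2 * x)^[q.2.1] (2 * q.2.2 + 1) :=
    Primrec.nat_iterate (h := fun _ x => 2 * x) (Primrec.fst.comp Primrec.snd)
      (Primrec.succ.comp (Primrec.nat_mul.comp (Primrec.const 2)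
        (Primrec.snd.comp Primrec.snd)))
      (Primrec.nat_mul.comp (Primrec.const 2) Primrec.snd).to₂
  exact this.to₂

/-- An unbounded search over all lists inverts the coding: it ends because `h` itself is among them,
and injectivity identifies what it finds. The input is kept as a second output, since the next
answer will be appended to it. -/
theorem exists_code_of_computable {F : List ℕ → ℕ} (hF : Computable F) :
    ∃ c : Turing.ToPartrec.Code, ∀ h, [F h, unaryCode h] ∈ c.eval [unaryCode h] := by
  have hp : Partrec fun N : ℕ => (Nat.rfind fun k =>
      Part.some (decide (unaryCode (Denumerable.ofNat (List ℕ) k) = N))).map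
        fun k => F (Denumerable.ofNat (List ℕ) k) := by
    refine Partrec.map (Partrec.rfind ?_) ?_
    · have : Primrec fun p : ℕ × ℕ => decide (unaryCode (Denumerable.ofNat (List ℕ) p.2) = p.1) :=
        (PrimrecRel.comp Primrec.eq (primrec_unaryCode.comp ((Primrec.ofNat (List ℕ)).comp
          Primrec.snd)) Primrec.fst).decide
      exact this.to_comp.to₂.partrec₂
    · exact (hF.comp ((Computable.ofNat (List ℕ)).comp Computable.snd)).to₂
  obtain ⟨c, hc⟩ := Turing.ToPartrec.Code.exists_code (Nat.Partrec'.part_iff₁.2 hp)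
  refine ⟨.cons c .id, fun h => ?_⟩
  have h1 := hc (unaryCode h ::ᵥ List.Vector.nil)
  have h2 : F h ∈ (Nat.rfind fun k =>
      Part.some (decide (unaryCode (Denumerable.ofNat (List ℕ) k) = unaryCode h))).map
        fun k => F (Denumerable.ofNat (List ℕ) k) := by
    obtain ⟨k, hk, -⟩ := Nat.rfind_min' (p := fun k =>
      decide (unaryCode (Denumerable.ofNat (List ℕ) k) = unaryCode h)) (m := Encodable.encode h)
      (by simp)
    refine (Part.mem_map_iff _).2 ⟨k, hk, ?_⟩
    have := Nat.rfind_spec hk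
    have := unaryCode_injective (by simpa using this)
    rw [this]
  have h3 : c.eval [unaryCode h] = pure [F h] := by
    have h1' : c.eval [unaryCode h] = pure <$> _ := h1
    rw [h1', List.Vector.head_cons, Part.eq_some_iff.2 h2]
    simp
  simp [h3]

variable {A B S : Type*} (M : S × List A → S × List B) (m₀ : S)

/-- The conjecture after a list of data. -/
def guess (l : List (List A)) : List B :=
  match l.length with
  | 0 => []
  | k + 1 => conjecture M m₀ (fun i => l[i]?.getD []) k

theorem computable_guess [Primcodable A] [Primcodable B] [Primcodable S] (hM : Computable M) :
    Computable (guess M m₀) := by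
  have hget : Computable₂ (fun (l : List (List A)) (i : ℕ) => l[i]?.getD []) :=
    (Computable.option_getD Computable.list_getElem? (Computable.const []).to₂)
  have hmem : Computable₂ fun (l : List (List A)) (k : ℕ) =>
      memory M m₀ (fun i => l[i]?.getD []) k := by
    refine (Computable.nat_rec (f := fun p : List (List A) × ℕ => p.2) (g := fun _ => m₀)
      (h := fun p q => (M (q.2, p.1[q.1]?.getD [])).1) Computable.snd (Computable.const _) ?_).of_eq ?_
    · have : Computable fun r : (List (List A) × ℕ) × ℕ × S =>
          (M (r.2.2, r.1.1[r.2.1]?.getD [])).1 :=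
        Computable.fst.comp (hM.comp (Computable.pair (Computable.snd.comp Computable.snd)
          (hget.comp (Computable.fst.comp Computable.fst) (Computable.fst.comp Computable.snd))))
      exact this.to₂
    · rintro ⟨l, k⟩
      induction k with
      | zero => rfl
      | succ k ih => exact congrArg (fun m => (M (m, l[k]?.getD [])).1) ih
  have hcon : Computable₂ fun (l : List (List A)) (k : ℕ) =>
      conjecture M m₀ (fun i => l[i]?.getD []) k :=
    Computable.snd.comp (hM.comp (Computable.pair hmem hget))
  refine (Computable.nat_casesOn Computable.list_length (Computable.const []) hcon).of_eq ?_
  intro l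
  simp only [guess]
  cases l.length <;> rfl

/-- The conjecture that is computed from the answers. -/
def answerGuess {A' : Type} (d : A' → A) (rs : List (Resp (Option A'))) : List B :=
  guess M m₀ ((splitStream (answerStream rs)).map (List.map d))

/-- The codes of the answers, the last one first. -/
def history {Y : Type} [Encodable Y] (rs : List (Resp Y)) : List ℕ :=
  (rs.map Encodable.encode).reverse

/-- The first entry is the gate for the coming round, `rs.length` being the number of answers. The
letters are reversed because decoding puts each one in front of the earlier ones. -/
theorem exists_background_code {a : ℕ} [Primcodable A] [Primcodable B] [Primcodable S] [Finite B]
    (hM : Computable M) (d : Fin a → A) (eb : B → ℕ) {g : ℕ → ℕ} (hg : Computable g) :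
    ∃ c : Turing.ToPartrec.Code, ∀ rs : List (Resp (Option (Fin a))),
      [unaryCode (g (2 ^ (rs.length + 5)) :: ((answerGuess M m₀ d rs).map eb).reverse),
        unaryCode (history rs)] ∈ c.eval [unaryCode (history rs)] := by
  have hdec : Primrec fun h : List ℕ => (h.map fun i =>
      ((Encodable.decode i : Option (Resp (Option (Fin a)))).getD none)).reverse :=
    Primrec.list_reverse.comp (Primrec.list_map Primrec.id
      (Primrec.option_getD.comp (Primrec.decode.comp Primrec.snd) (Primrec.const none)).to₂)
  have hag : Computable (answerGuess M m₀ d) :=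
    (computable_guess M m₀ hM).comp (Primrec.list_map (primrec_splitStream.comp primrec_answerStream)
      (Primrec.list_map Primrec.snd ((Primrec.dom_finite d).comp Primrec.snd).to₂).to₂).to_comp
  have hpow : Primrec fun n : ℕ => 2 ^ n := by
    refine (Primrec.nat_iterate Primrec.id (Primrec.const 1) (h := fun _ x => 2 * x)
      (Primrec.nat_mul.comp (Primrec.const 2) Primrec.snd).to₂).of_eq fun n => ?_
    induction n with
    | zero => rfl
    | succ n ih =>
      simp only [id] at ih ⊢
      rw [Function.iterate_succ_apply', ih, pow_succ]; ring
  have hmb : Primrec fun l : List B => (l.map eb).reverse :=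
    Primrec.list_reverse.comp (Primrec.list_map Primrec.id
      ((Primrec.dom_finite eb).comp Primrec.snd).to₂)
  have hF : Computable fun h : List ℕ => unaryCode (g (2 ^ (h.length + 5)) ::
      ((answerGuess M m₀ d (h.map fun i =>
        ((Encodable.decode i : Option (Resp (Option (Fin a)))).getD none)).reverse).map eb).reverse) := by
    refine primrec_unaryCode.to_comp.comp (Computable.list_cons.comp ?_ ?_)
    · exact hg.comp ((hpow.comp (Primrec.nat_add.comp Primrec.list_length
        (Primrec.const 5))).to_comp)
    · exact hmb.to_comp.comp (hag.comp hdec.to_comp)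
  obtain ⟨c, hc⟩ := exists_code_of_computable hF
  refine ⟨c, fun rs => ?_⟩
  have := hc (history rs)
  have h1 : ((history rs).map fun i =>
        ((Encodable.decode i : Option (Resp (Option (Fin a)))).getD none)).reverse = rs := by
    rw [history, List.map_reverse, List.reverse_reverse, List.map_map]
    conv_rhs => rw [← List.map_id rs]
    refine List.map_congr_left fun r _ => ?_
    simp
  rw [h1] at this
  simpa [history] using this

end Computability

end AutoLearn

namespace AutoLearn

/-! ### Invariants of the cycles -/

section Invariant

variable {K Γ E A' : Type}

/-- The background program computes from the answers, which are represented on the stacks by `Sf`, the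
hypothesis `hypo`; on the way, some stack has a height of at least `gate s`, where `s` is the number
of answers. -/
structure Simulates (P : Prog K Γ E (Option A')) (Sf : List (Resp (Option A')) → K → List Γ)
    (hypo : List (Resp (Option A')) → List E) (gate : ℕ → ℕ) : Prop where
  boot : ∃ k j κ, P.Leads k (Mem.init P) ⟨.ready, Sf [], [], hypo []⟩ ∧ j ≤ k ∧
    gate 0 ≤ ((P.micro^[j] (Mem.init P)).stk κ).length
  entry : ∀ rs r ho, ∃ k j κ, P.Leads k ⟨.run (P.entry r), Sf rs, [], ho⟩
      ⟨.ready, Sf (rs ++ [r]), [], hypo (rs ++ [r])⟩ ∧ j ≤ k ∧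
    gate (rs.length + 1) ≤ ((P.micro^[j] ⟨.run (P.entry r), Sf rs, [], ho⟩).stk κ).length
  hypo_nil : hypo [] = []
  commit : ∀ s tops, (P.δ s tops).2.cm = true → (P.δ s tops).1 = none

/-- The memory after a cycle in which the symbols of the datum have been stored, with control state
`ct` afterwards. -/
noncomputable def Prog.next (P : Prog K Γ E (Option A')) (m : Mem K Γ E P.St) (ct : Ctl P.St) (n : ℕ) :
    Mem K Γ E P.St :=
  m.app (P.decide ct (m.cellOf 0).tr (roomAt m n)).1 (P.decide ct (m.cellOf 0).tr (roomAt m n)).2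

variable {P : Prog K Γ E (Option A')} {m : Mem K Γ E P.St} {ct : Ctl P.St} {n : ℕ}

theorem Prog.next_room (h : roomAt m n = true) : P.next m ct n = P.micro { m with ctl := ct } := by
  have ht : (m.cellOf 0).tr = fun k => (m.stk k).head? := by
    funext k; exact List.head?_eq_getElem?.symm
  rw [Prog.next, h, ht]
  rfl

theorem Prog.next_of_not_room (h : roomAt m n = false) : P.next m ct n = { m with ctl := ct } := by
  rw [Prog.next, h]
  rfl

theorem Prog.next_of_ne_run (h : ∀ s, ct ≠ .run s) : P.next m ct n = { m with ctl := ct } := by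
  have : ∀ tops g, P.decide ct tops g = (ct, .idle) := by
    intro tops g
    rcases ct with _ | _ | _ | s
    · cases g <;> rfl
    · cases g <;> rfl
    · cases g <;> rfl
    · exact absurd rfl (h s)
  rw [Prog.next, this]
  rfl

open Classical in
-- A memory that fits into fewer cells leaves the last one empty; so each growth of `n` allows a
-- step of the program.
theorem Mem.Fits.room (h : m.Fits n) {n' : ℕ} (hn : n < n') : roomAt m n' = true := by
  obtain ⟨k, rfl⟩ : ∃ k, n' = k + 1 := ⟨n' - 1, by omega⟩
  exact decide_eq_true ⟨fun κ => List.getElem?_eq_none ((h.stk κ).trans (by omega)),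
    List.getElem?_eq_none (h.hn.trans (by omega))⟩

open Classical in
theorem room_of_roomAt (h : roomAt m n = true) : m.Room n := by
  rcases n with _ | n
  · simp [roomAt] at h
  · have h := of_decide_eq_true h
    exact ⟨fun κ => Nat.lt_succ_of_le (List.getElem?_eq_none_iff.1 (h.1 κ)),
      Nat.lt_succ_of_le (List.getElem?_eq_none_iff.1 h.2)⟩

theorem StackOp.length_app {Γ : Type} (op : StackOp Γ) (l : List Γ) :
    (op.app l).length ≤ l.length + 1 := by
  cases op <;> simp [StackOp.app]
  omega

theorem Mem.Fits.app (h : m.Fits n) (hr : m.Room n) (o : Ops K Γ E) : (m.app ct o).Fits n := by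
  refine ⟨fun κ => ((o.st κ).length_app _).trans (hr.1 κ), ?_, ?_⟩
  · have h1 : o.hp.toList.length ≤ 1 := by cases o.hp <;> simp
    have := hr.2
    cases hc : o.cm <;> simp [Mem.app, hc]
    omega
  · have := h.hn
    have := h.ho
    cases hc : o.cm <;> simp [Mem.app, hc] <;> omega

theorem Mem.Fits.next (h : m.Fits n) : (P.next m ct n).Fits n := by
  cases hr : roomAt m n
  · rw [Prog.next_of_not_room hr]
    exact ⟨h.stk, h.hn, h.ho⟩
  · exact h.app (room_of_roomAt hr) _

variable (Sf : List (Resp (Option A')) → K → List Γ) (hypo : List (Resp (Option A')) → List E)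
  (gate : ℕ → ℕ)

/-- The background program is between rounds, or on its way there. -/
def BgInv (n : ℕ) (m : Mem K Γ E P.St) (rs : List (Resp (Option A'))) : Prop :=
  (∃ s, m.ctl = .run s ∧ ∃ m₀ k j κ i, P.Leads k m₀ ⟨.ready, Sf rs, [], hypo rs⟩ ∧ j ≤ k ∧
    gate rs.length ≤ ((P.micro^[j] m₀).stk κ).length ∧ i < k ∧ m = P.micro^[i] m₀ ∧
    ∀ i' ≤ i, (P.micro^[i'] m₀).Fits n) ∨
  ((∀ s, m.ctl ≠ .run s) ∧ m.stk = Sf rs ∧ m.hn = [] ∧ m.ho = hypo rs ∧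
    (m.ctl = .ready → gate rs.length ≤ n))

variable {Sf hypo gate} {rs : List (Resp (Option A'))}

/-- All memories on the way have fitted, including the one whose stack is at least as high as the
gate. So when the program gets ready, the gate is at most `n`, although the two numbers were never
compared. -/
theorem BgInv.micro {s : P.St} (h : BgInv Sf hypo gate n m rs) (hs : m.ctl = .run s)
    (hf : (P.micro m).Fits n) : BgInv Sf hypo gate n (P.micro m) rs := by
  rcases h with ⟨_, _, m₀, k, j, κ, i, hL, hj, hg, hi, hm, hfit⟩ | ⟨h, _⟩
  · have hm' : P.micro m = P.micro^[i + 1] m₀ := by rw [Function.iterate_succ_apply', ← hm]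
    have hfit' : ∀ i' ≤ i + 1, (P.micro^[i'] m₀).Fits n := by
      intro i' hi'
      rcases hi'.lt_or_eq with h | rfl
      · exact hfit i' (by omega)
      · rwa [← hm']
    rcases Nat.lt_or_ge (i + 1) k with h | h
    · obtain ⟨s', hs'⟩ := hL.2 (i + 1) h
      exact Or.inl ⟨s', by rw [hm']; exact hs', m₀, k, j, κ, i + 1, hL, hj, hg, h, hm', hfit'⟩
    · obtain rfl : k = i + 1 := by omega
      rw [hm', hL.1]
      exact Or.inr ⟨by simp, rfl, rfl, rfl, fun _ => hg.trans ((hfit' j hj).stk κ)⟩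
  · exact absurd hs (h s)

theorem BgInv.mono (h : BgInv Sf hypo gate n m rs) {n' : ℕ} (hn : n ≤ n') :
    BgInv Sf hypo gate n' m rs := by
  rcases h with ⟨s, hs, m₀, k, j, κ, i, hL, hj, hg, hi, hm, hfit⟩ | ⟨h, h1, h2, h3, h4⟩
  · exact Or.inl ⟨s, hs, m₀, k, j, κ, i, hL, hj, hg, hi, hm, fun i' hi' => (hfit i' hi').mono hn⟩
  · exact Or.inr ⟨h, h1, h2, h3, fun h => (h4 h).trans hn⟩

variable (Sf hypo gate) in
/-- The invariant of the cycles. -/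
structure Inv (n : ℕ) (m : Mem K Γ E P.St) (t : Tape (WCell (Option A'))) (st : List (Option A'))
    (rs : List (Resp (Option A'))) (G : Ghost) : Prop where
  fits : m.Fits n
  work : WorkInv m.ctl t st rs G
  bg : BgInv Sf hypo gate n m rs
  gates : ∀ j < G.cls.length, gate j ≤ n
  zero : n = 0 → m = Mem.init P ∧ G.cls = []
  ho : m.ho = hypo rs ∨ m.ho = hypo rs.dropLast

/-- The beginning of a cycle: either the round ends, or nothing changes. -/
structure Turns (ct : Ctl P.St) (t : Tape (WCell (Option A'))) (G : Ghost) (ct₀ : Ctl P.St)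
    (t₀ : Tape (WCell (Option A'))) (G₀ : Ghost) : Prop where
  ctl : (ct₀ = ct ∧ t₀ = t ∧ G₀ = G ∧ ¬ (ct = .ready ∧ t.read = .blank)) ∨
    (ct = .ready ∧ t.read = .blank ∧ ct₀ = .left ∧ G₀.cls.length = G.cls.length + 1)
  V_le : G.V ≤ G₀.V
  m_eq : G₀.m = G.m
  tags_le : tags (kind t.cell) G.V <+: tags (kind t₀.cell) G₀.V

variable (P) in
/-- How a cycle changes the memory, the work tape, the answers and the bookkeeping data. -/
def CycleStep (n' : ℕ) (m : Mem K Γ E P.St) (t : Tape (WCell (Option A')))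
    (rs : List (Resp (Option A'))) (G : Ghost) (m' : Mem K Γ E P.St) (t' : Tape (WCell (Option A')))
    (rs' : List (Resp (Option A'))) (G' : Ghost) : Prop :=
  ∃ ct₀ t₀ G₀ ct₁, Turns m.ctl t G ct₀ t₀ G₀ ∧ Evolves P.entry ct₀ rs t₀ G₀ ct₁ rs' t' G' ∧
    (ct₁ = .left → G'.D.length < G₀.D.length) ∧ (ct₁ ≠ .left → G'.D ≠ []) ∧
    m' = P.next m ct₁ n'

variable {t : Tape (WCell (Option A'))} {st : List (Option A')} {G : Ghost}

theorem Inv.turns (I : Inv Sf hypo gate n m t st rs G) :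
    ∃ G₀, Turns m.ctl t G (turnAct m.ctl t.read).1
        (t.act (turnAct m.ctl t.read).2.1 (turnAct m.ctl t.read).2.2) G₀ ∧
      WorkInv (turnAct m.ctl t.read).1
        (t.act (turnAct m.ctl t.read).2.1 (turnAct m.ctl t.read).2.2) st rs G₀ := by
  by_cases h : m.ctl = .ready ∧ t.read = .blank
  · have ht : turnAct m.ctl t.read = (.left, some (.turn, false), .left) := by rw [h.1, h.2]; rfl
    have hw := I.work
    rw [h.1] at hw
    obtain ⟨G', h1, h2, h3, h4, h5⟩ := hw.turn h.2
    rw [ht]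
    exact ⟨G', ⟨Or.inr ⟨h.1, h.2, rfl, h2⟩, h3, h4, h5⟩, h1⟩
  · have ht : turnAct m.ctl t.read = (m.ctl, t.read.keep, .stay) := by
      rcases hc : m.ctl with _ | _ | _ | s <;> rcases hr : t.read with _ | _ | a <;>
        first | rfl | exact absurd ⟨hc, hr⟩ h
    rw [ht, Tape.act_keep]
    exact ⟨G, ⟨Or.inl ⟨rfl, rfl, rfl, h⟩, le_rfl, rfl, List.prefix_rfl⟩, I.work⟩

theorem WorkInv.count_eq (I : WorkInv ct t st rs G) (h1 : ct ≠ .left) (h2 : ct ≠ .right) :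
    rs.length = G.cls.length := by
  rcases I with ⟨h, I⟩ | ⟨I, _⟩
  · exact absurd h h1
  · exact I.count h2

theorem WorkInv.count_le (I : WorkInv ct t st rs G) : rs.length ≤ G.cls.length := by
  rcases I with ⟨h, I⟩ | ⟨I, _⟩
  · have := I.count; omega
  · by_cases h : ct = .right
    · have := I.count_right h; omega
    · exact (I.count h).le

theorem WorkInv.congr (I : WorkInv ct t st rs G) (h1 : ct ≠ .left) (h2 : ct ≠ .right)
    {ct' : Ctl P.St} (h3 : ct' ≠ .left) (h4 : ct' ≠ .right) : WorkInv ct' t st rs G := by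
  rcases I with ⟨h, I⟩ | ⟨I, hD⟩
  · exact absurd h h1
  · exact Or.inr ⟨⟨I.core, I.marks, h3, fun h => absurd h h4, fun h => absurd h h4,
      fun _ => I.count h2⟩, hD⟩

theorem Prog.micro_ctl {s : P.St} (hs : m.ctl = .run s) :
    (∃ s', (P.micro m).ctl = .run s') ∨ (P.micro m).ctl = .ready := by
  simp only [Prog.micro, Prog.decide, hs, Mem.app]
  split
  · exact Or.inl ⟨_, rfl⟩
  · exact Or.inr rfl

theorem Simulates.next_ho (hP : Simulates P Sf hypo gate) {s : P.St} (hs : m.ctl = .run s) :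
    (P.micro m).ho = m.ho ∨ (P.micro m).ctl = .ready := by
  cases hc : (P.δ s (fun k => (m.stk k).head?)).2.cm
  · left
    simp only [Prog.micro, Prog.decide, hs, Mem.app, hc]
    rfl
  · right
    have h := hP.commit _ _ hc
    simp only [Prog.micro, Prog.decide, hs, Mem.app, h]

/-- A round ends only in the state `ready`, and then there are as many answers as classes; so the
gate just passed is the one for the new class. -/
theorem Inv.gates_turns (I : Inv Sf hypo gate n m t st rs G) {ct₀ t₀ G₀}
    (hT : Turns m.ctl t G ct₀ t₀ G₀) : ∀ j < G₀.cls.length, gate j ≤ n := by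
  rcases hT.ctl with ⟨_, _, h, _⟩ | ⟨h1, _, _, h2⟩
  · rw [h]; exact I.gates
  · intro j hj
    have hc := I.work.count_eq (by simp [h1]) (by simp [h1])
    rcases Nat.lt_or_ge j G.cls.length with h | h
    · exact I.gates j h
    · obtain rfl : j = rs.length := by omega
      rcases I.bg with ⟨s, hs, _⟩ | ⟨_, _, _, _, hb⟩
      · rw [h1] at hs; cases hs
      · exact hb h1

/-- While the head moves left or searches, the program is at rest with `Sf rs` on its stacks, as
both activities share one control state. An answer thus starts the next computation from the right
memory. -/
theorem Inv.bg_next (hP : Simulates P Sf hypo gate) (I : Inv Sf hypo gate n m t st rs G) {n' : ℕ}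
    (hn : n ≤ n') {ct₁ : Ctl P.St} {t' rs' G'} {ct₀ t₀ G₀}
    (hT : Turns m.ctl t G ct₀ t₀ G₀) (hE : Evolves P.entry ct₀ rs t₀ G₀ ct₁ rs' t' G') :
    BgInv Sf hypo gate n' { m with ctl := ct₁ } rs' ∧ (m.ho = hypo rs' ∨ m.ho = hypo rs'.dropLast) := by
  have hrest : ct₀ = .left ∨ ct₀ = .right → (∀ s, m.ctl ≠ .run s) ∧ m.stk = Sf rs ∧ m.hn = [] ∧
      m.ho = hypo rs := by
    intro h
    rcases I.bg with ⟨s, hs, _⟩ | ⟨h1, h2, h3, h4, _⟩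
    · rcases hT.ctl with ⟨h', _⟩ | ⟨h', _⟩
      · rw [hs] at h'; rw [h'] at h; simp at h
      · rw [hs] at h'; cases h'
    · exact ⟨h1, h2, h3, h4⟩
  rcases hE.ev with ⟨h1, rfl, _⟩ | ⟨h0, rfl, rfl, _⟩ | ⟨h0, r, rfl, rfl, _⟩
  · refine ⟨?_, I.ho⟩
    rcases hT.ctl with ⟨h', _⟩ | ⟨h', _, h'', _⟩
    · rw [h1, h']; exact I.bg.mono hn
    · obtain ⟨_, h2, h3, h4⟩ := hrest (Or.inl h'')
      rw [h1, h'']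
      exact Or.inr ⟨by simp, h2, h3, h4, by simp⟩
  · obtain ⟨_, h2, h3, h4⟩ := hrest (Or.inl h0)
    exact ⟨Or.inr ⟨by simp, h2, h3, h4, by simp⟩, I.ho⟩
  · obtain ⟨_, h2, h3, h4⟩ := hrest h0
    refine ⟨Or.inl ⟨_, rfl, ?_⟩, Or.inr (by rw [List.dropLast_concat]; exact h4)⟩
    obtain ⟨k, j, κ, hL, hj, hg⟩ := hP.entry rs r m.ho
    have hm : (⟨.run (P.entry r), m.stk, m.hn, m.ho⟩ : Mem K Γ E P.St)
        = ⟨.run (P.entry r), Sf rs, [], m.ho⟩ := by rw [h2, h3]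
    refine ⟨_, k, j, κ, 0, hL, hj, by simpa using hg, ?_, hm, ?_⟩
    · rcases Nat.eq_zero_or_pos k with rfl | h
      · have := congrArg Mem.ctl hL.1
        simp at this
      · exact h
    · intro i' hi'
      obtain rfl : i' = 0 := by omega
      have hf := I.fits.mono hn
      rw [Function.iterate_zero, id, ← hm]
      exact ⟨hf.stk, hf.hn, hf.ho⟩

/-- After the changes on the work tape, at most one step of the program is made, provided that there
is room; otherwise the memory stays and the step is tried again in a later cycle. -/
theorem Inv.step (hP : Simulates P Sf hypo gate) (I : Inv Sf hypo gate n m t st rs G) {n' : ℕ}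
    (hn : n ≤ n') {ct₁ : Ctl P.St} {t' st' rs' G'} {ct₀ t₀ G₀}
    (hT : Turns m.ctl t G ct₀ t₀ G₀) (hE : Evolves P.entry ct₀ rs t₀ G₀ ct₁ rs' t' G')
    (hW : WorkInv ct₁ t' st' rs' G') :
    Inv Sf hypo gate n' (P.next m ct₁ n') t' st' rs' G' := by
  have hf : (P.next m ct₁ n').Fits n' := (I.fits.mono hn).next
  obtain ⟨hb, hho⟩ := I.bg_next hP hn hT hE
  -- With no cell at all the program waits in `boot`, and no round can end.
  have hzero : n' = 0 → P.next m ct₁ n' = Mem.init P ∧ G'.cls = [] := by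
    rintro rfl
    obtain ⟨hm, hc⟩ := I.zero (by omega)
    subst hm
    rcases hT.ctl with ⟨h1, _, h2, _⟩ | ⟨h', _⟩
    · refine ⟨?_, by rw [hE.cls_eq, h2, hc]⟩
      rcases hE.ev with ⟨h3, _⟩ | ⟨h3, _⟩ | ⟨h3, _⟩
      · rw [h3, h1]; rfl
      · rw [h3] at h1; cases h1
      · rw [h1] at h3; simp [Mem.init] at h3
    · cases h'
  have hgates : ∀ j < G'.cls.length, gate j ≤ n' := by
    rw [hE.cls_eq]
    exact fun j hj => (I.gates_turns hT j hj).trans hn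
  by_cases hrun : roomAt m n' = true ∧ ∃ s, ct₁ = .run s
  · obtain ⟨hr, s, hs⟩ := hrun
    have hnext := P.next_room (ct := ct₁) hr
    rw [hnext] at hf hzero ⊢
    have hb' := hb.micro hs hf
    refine ⟨hf, ?_, hb', hgates, hzero, ?_⟩
    · have hc := P.micro_ctl (m := { m with ctl := ct₁ }) hs
      refine hW.congr (by simp [hs]) (by simp [hs]) ?_ ?_ <;>
        rcases hc with ⟨s', h⟩ | h <;> simp [h]
    · rcases hP.next_ho (m := { m with ctl := ct₁ }) hs with h | h
      · rw [h]; exact hho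
      · rcases hb' with ⟨s', hs', _⟩ | ⟨_, _, _, h', _⟩
        · rw [h] at hs'; cases hs'
        · exact Or.inl h'
  · have hnext : P.next m ct₁ n' = { m with ctl := ct₁ } := by
      by_cases h : roomAt m n' = true
      · exact P.next_of_ne_run fun s hs => hrun ⟨h, s, hs⟩
      · exact P.next_of_not_room (by simpa using h)
    rw [hnext] at hf hzero ⊢
    exact ⟨hf, hW, hb, hgates, hzero, hho⟩

section Machine

universe u v

variable {A : Type u} {B : Type v} [Finite K] [Finite Γ] [Finite E] [Finite A']

theorem Inv.cycle (hP : Simulates P Sf hypo gate) (I : Inv Sf hypo gate n m t st rs G)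
    (ea : A → A') (eb : E → B) (x : List A) :
    ∃ T m' t' rs' G' s,
      (machine P ea eb).Cycle ⟨m.toList n, fun _ => t⟩ x T (m'.ho.map eb)
        ⟨m'.toList (max n x.length), fun _ => t'⟩ ∧
      (∀ s ≤ T, ∀ j, max n x.length < j → ((machine P ea eb).steps s
        ((machine P ea eb).load ⟨m.toList n, fun _ => t⟩ x)).base.cell j = none) ∧
      T ≤ 3 * max n x.length + 6 + (x.length + 1) * (3 * gapSize s + 2) ∧
      (∀ j < s, gate j ≤ n) ∧ (n = 0 → s = 0) ∧
      Inv Sf hypo gate (max n x.length) m' t' (st ++ (x.map (fun a => some (ea a)) ++ [none])) rs' G' ∧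
      CycleStep P (max n x.length) m t rs G m' t' rs' G' := by
  obtain ⟨G₀, hT, hW⟩ := I.turns
  obtain ⟨y, l, hyl⟩ : ∃ y l, x.map (fun a => some (ea a)) ++ [none] = y :: l := by
    cases x <;> simp
  have hlen : l.length = x.length := by
    have := congrArg List.length hyl
    simpa using this.symm
  obtain ⟨k, ct₁, t', rs', G', hr, hk, hW', hE, hD, hD'⟩ := hW.stores P.entry l y
  rw [← hyl] at hr hW'
  have I' := I.step hP (le_max_left n x.length) hT hE hW'
  obtain ⟨hc, hb⟩ := machine_cycle (eb := eb) I.fits (fun h => (I.zero h).1) rfl hr rfl I'.fits.ho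
  refine ⟨_, _, t', rs', G', G₀.cls.length, hc, hb, ?_, I.gates_turns hT, ?_, I',
    _, _, G₀, ct₁, hT, hE, hD, hD', rfl⟩
  · rw [hlen] at hk; omega
  · intro h
    obtain ⟨h1, h2⟩ := I.zero h
    rcases hT.ctl with ⟨_, _, h3, _⟩ | ⟨h3, _⟩
    · rw [h3, h2]; rfl
    · rw [h1] at h3; cases h3

end Machine

end Invariant

end AutoLearn

namespace AutoLearn

/-! ### Executions and their times -/

section Execution

variable {K Γ E A' : Type} (P : Prog K Γ E (Option A'))
  (Sf : List (Resp (Option A')) → K → List Γ) (hypo : List (Resp (Option A')) → List E)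
  (gate : ℕ → ℕ)

/-- The data of an execution before one of the cycles. -/
structure Moment where
  n : ℕ
  m : Mem K Γ E P.St
  t : Tape (WCell (Option A'))
  st : List (Option A')
  rs : List (Resp (Option A'))
  G : Ghost

variable {P}

/-- The invariant holds at the moment `σ`. -/
def Moment.Valid (σ : Moment P) : Prop := Inv Sf hypo gate σ.n σ.m σ.t σ.st σ.rs σ.G

/-- The moment `σ'` comes after `σ`, in a cycle with datum `x`. -/
structure Moment.Succ (x : List A') (σ σ' : Moment P) : Prop where
  n_eq : σ'.n = max σ.n x.length
  st_eq : σ'.st = σ.st ++ (x.map some ++ [none])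
  step : CycleStep P σ'.n σ.m σ.t σ.rs σ.G σ'.m σ'.t σ'.rs σ'.G

/-- A sequence of moments in an execution with data `T`. -/
structure IsExecution (T : ℕ → List A') (σ : ℕ → Moment P) : Prop where
  zero : σ 0 = ⟨0, Mem.init P, Tape.ofList [], [], [], ⟨0, 0, [], [], [], []⟩⟩
  valid : ∀ i, (σ i).Valid Sf hypo gate
  succ : ∀ i, Moment.Succ (T i) (σ i) (σ (i + 1))

variable {Sf hypo gate}

theorem Simulates.inv_init (hP : Simulates P Sf hypo gate) :
    Inv Sf hypo gate 0 (Mem.init P) (Tape.ofList []) [] [] ⟨0, 0, [], [], [], []⟩ := by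
  have hf : (Mem.init P).Fits 0 := ⟨fun _ => le_rfl, le_rfl, le_rfl⟩
  refine ⟨hf, WorkInv.init (by simp [Mem.init]) (by simp [Mem.init]), Or.inl ⟨_, rfl, ?_⟩, by simp,
    fun _ => ⟨rfl, rfl⟩, Or.inl hP.hypo_nil.symm⟩
  obtain ⟨k, j, κ, hL, hj, hg⟩ := hP.boot
  refine ⟨_, k, j, κ, 0, hL, hj, hg, ?_, rfl, ?_⟩
  · rcases Nat.eq_zero_or_pos k with rfl | h
    · have := congrArg Mem.ctl hL.1
      simp [Mem.init] at this
    · exact h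
  · intro i hi
    obtain rfl : i = 0 := by omega
    exact hf

universe u v

variable {A : Type u} {B : Type v} [Finite K] [Finite Γ] [Finite E] [Finite A']

/-- The snapshot of the learner at a moment. -/
noncomputable def Moment.snapshot (σ : Moment P) (ea : A → A') (eb : E → B) :
    (machine P ea eb).Snapshot := ⟨σ.m.toList σ.n, fun _ => σ.t⟩

theorem Simulates.exists_execution (hP : Simulates P Sf hypo gate) (ea : A → A') (eb : E → B)
    (T : ℕ → List A) :
    ∃ (σ : ℕ → Moment P) (time s : ℕ → ℕ),
      IsExecution Sf hypo gate (fun i => (T i).map ea) σ ∧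
      (machine P ea eb).IsRun T (fun i => (σ i).snapshot ea eb) (fun i => (σ (i + 1)).m.ho.map eb)
        time ∧
      ∀ i, (∀ k ≤ time i, ∀ j, (σ (i + 1)).n < j → ((machine P ea eb).steps k
          ((machine P ea eb).load ((σ i).snapshot ea eb) (T i))).base.cell j = none) ∧
        time i ≤ 3 * (σ (i + 1)).n + 6 + ((T i).length + 1) * (3 * gapSize (s i) + 2) ∧
        (∀ j < s i, gate j ≤ (σ (i + 1)).n) ∧ ((σ (i + 1)).n = 0 → s i = 0) := by
  have key : ∀ (σ : {σ : Moment P // σ.Valid Sf hypo gate}) (x : List A),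
      ∃ (σ' : {σ : Moment P // σ.Valid Sf hypo gate}) (time s : ℕ),
        Moment.Succ (x.map ea) σ.1 σ'.1 ∧
        (machine P ea eb).Cycle (σ.1.snapshot ea eb) x time (σ'.1.m.ho.map eb)
          (σ'.1.snapshot ea eb) ∧
        (∀ k ≤ time, ∀ j, σ'.1.n < j → ((machine P ea eb).steps k
          ((machine P ea eb).load (σ.1.snapshot ea eb) x)).base.cell j = none) ∧
        time ≤ 3 * σ'.1.n + 6 + (x.length + 1) * (3 * gapSize s + 2) ∧
        (∀ j < s, gate j ≤ σ'.1.n) ∧ (σ'.1.n = 0 → s = 0) := by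
    rintro ⟨⟨n, m, t, st, rs, G⟩, I⟩ x
    obtain ⟨T, m', t', rs', G', s, h1, h2, h3, h4, h5, h6, h7⟩ := Inv.cycle hP I ea eb x
    refine ⟨⟨⟨max n x.length, m', t', _, rs', G'⟩, h6⟩, T, s, ⟨?_, ?_, h7⟩, h1, h2, h3,
      fun j hj => (h4 j hj).trans (le_max_left _ _), fun h => h5 ?_⟩
    · simp
    · simp
    · change max n x.length = 0 at h
      change n = 0
      omega
  choose nxt time s h using key
  let σ : ℕ → {σ : Moment P // σ.Valid Sf hypo gate} := fun i =>
    Nat.rec ⟨⟨0, Mem.init P, Tape.ofList [], [], [], ⟨0, 0, [], [], [], []⟩⟩, hP.inv_init⟩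
      (fun i σ => nxt σ (T i)) i
  refine ⟨fun i => (σ i).1, fun i => time (σ i) (T i), fun i => s (σ i) (T i),
    ⟨rfl, fun i => (σ i).2, fun i => (h (σ i) (T i)).1⟩, ⟨rfl, fun i => (h (σ i) (T i)).2.1⟩,
    fun i => (h (σ i) (T i)).2.2⟩

omit [Finite K] [Finite Γ] [Finite E] [Finite A'] in
theorem IsExecution.longest_eq {T : ℕ → List A} {ea : A → A'} {σ : ℕ → Moment P}
    (h : IsExecution Sf hypo gate (fun i => (T i).map ea) σ) (i : ℕ) :
    longest T i = (σ (i + 1)).n := by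
  have h0 : (σ 0).n = 0 := by rw [h.zero]
  induction i with
  | zero => rw [(h.succ 0).n_eq, h0]; simp [longest]
  | succ i ih =>
    rw [(h.succ (i + 1)).n_eq, ← ih, longest, Finset.range_add_one, Finset.sup_insert, max_comm]
    simp [longest]

/-- For `s = j + 1` the last gate gives `2 ^ (j + 5) ≤ f n`, which covers the cost `3 * gapSize (j +
1) + 2` of a symbol. For `s = 0` this cost is `5`; only when `n < g 1`, where `f n` may vanish, is
the constant `8 * g 1 + 11` needed. -/
theorem time_le {f g : ℕ → ℕ} (hfg : ∀ m n, g m ≤ n → m ≤ f n) {n l s t : ℕ} (hl : l ≤ n)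
    (ht : t ≤ 3 * n + 6 + (l + 1) * (3 * gapSize s + 2)) (hs : ∀ j < s, g (2 ^ (j + 5)) ≤ n)
    (h0 : n = 0 → s = 0) : t ≤ (8 * g 1 + 11) * (n * f n + 1) := by
  rcases s with _ | j
  · have h1 : (l + 1) * (3 * gapSize 0 + 2) ≤ (n + 1) * 5 := Nat.mul_le_mul (by omega) le_rfl
    rcases Nat.lt_or_ge n (g 1) with h | h
    · calc t ≤ 8 * g 1 + 11 := by omega
        _ ≤ (8 * g 1 + 11) * (n * f n + 1) := Nat.le_mul_of_pos_right _ (by omega)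
    · have h2 : n * 1 ≤ n * f n := Nat.mul_le_mul le_rfl (hfg 1 n h)
      calc t ≤ 11 * (n * f n + 1) := by omega
        _ ≤ (8 * g 1 + 11) * (n * f n + 1) := Nat.mul_le_mul (by omega) le_rfl
  · have hn : 1 ≤ n := by
      rcases Nat.eq_zero_or_pos n with h | h
      · exact absurd (h0 h) (by omega)
      · exact h
    have hf := hfg _ _ (hs j (by omega))
    have hp : 2 ^ (j + 5) = 8 * 2 ^ (j + 2) := by rw [pow_add 2 j 5, pow_add 2 j 2]; ring
    have hg : 3 * gapSize (j + 1) + 2 ≤ f n := by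
      have : 1 ≤ 2 ^ (j + 2) := Nat.one_le_two_pow
      unfold gapSize
      rw [show j + 1 + 1 = j + 2 from rfl]
      omega
    have h1 : (l + 1) * (3 * gapSize (j + 1) + 2) ≤ (n + n) * f n :=
      Nat.mul_le_mul (by omega) hg
    have h2 : n * 1 ≤ n * f n :=
      Nat.mul_le_mul le_rfl ((Nat.one_le_two_pow (n := j + 5)).trans hf)
    rw [add_mul n n] at h1
    calc t ≤ 11 * (n * f n + 1) := by omega
      _ ≤ (8 * g 1 + 11) * (n * f n + 1) := Nat.mul_le_mul (by omega) le_rfl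

theorem Simulates.runsWithin {f g : ℕ → ℕ} (hP : Simulates P Sf hypo fun s => g (2 ^ (s + 5)))
    (hfg : ∀ m n, g m ≤ n → m ≤ f n) (ea : A → A') (eb : E → B) :
    (machine P ea eb).RunsWithin fun n => (8 * g 1 + 11) * (n * f n + 1) := by
  intro T
  obtain ⟨σ, time, s, hσ, hr, h⟩ := hP.exists_execution ea eb T
  refine ⟨_, _, time, hr, fun i => ?_⟩
  obtain ⟨h1, h2, h3, h4⟩ := h i
  rw [hσ.longest_eq]
  refine ⟨h1, time_le hfg ?_ h2 h3 h4⟩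
  have := (hσ.succ i).n_eq
  simp only [List.length_map] at this
  omega

end Execution

end AutoLearn

namespace AutoLearn

/-! ### Progress -/

section Progress

variable {K Γ E A' : Type} {P : Prog K Γ E (Option A')}
  {Sf : List (Resp (Option A')) → K → List Γ} {hypo : List (Resp (Option A')) → List E}
  {gate : ℕ → ℕ}

theorem WorkInv.layout {ct : Ctl P.St} {t : Tape (WCell (Option A'))} {st rs G}
    (I : WorkInv ct t st rs G) : Layout (kind t.cell) G := by
  rcases I with ⟨_, I⟩ | ⟨I, _⟩
  · obtain ⟨cls, C⟩ := I.core
    exact C.toLayout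
  · exact I.core.toLayout

/-- A cell of `D` lies behind the head and is not closed, so the search must have ended there at the
latest. Hence no cycle stops in the middle of a search. -/
theorem RightInv.ne_right {ct : Ctl P.St} {ph : Phase} {t : Tape (WCell (Option A'))} {st rs G}
    (I : RightInv ct ph t st rs G) (hD : G.D ≠ []) : ct ≠ .right := by
  intro h
  obtain ⟨p, hp⟩ := List.exists_mem_of_ne_nil _ hD
  have h1 := I.right_le h
  have h2 := I.core.D_lt p hp
  have h3 := I.core.toLayout.of_mem (Or.inl (by rw [I.core.cur_eq]; simp [hp]) : p ∈ G.cur ∨ _)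
  have h4 : (∃ y, kind t.cell p = some (.half y)) ∨ kind t.cell p = some .free := by
    rcases mem_alternate.1 hp with h | h
    · exact Or.inl (I.core.half p h)
    · exact Or.inr (I.core.free_D p h)
  rcases I.marks.closed p h3.1 (by omega) with h5 | ⟨y, z, h5⟩ <;>
    rcases h4 with ⟨w, h4⟩ | h4 <;> rw [h4] at h5 <;> cases h5

namespace IsExecution

variable {T : ℕ → List A'} {σ : ℕ → Moment P} (h : IsExecution Sf hypo gate T σ)

include h

theorem n_mono : Monotone fun i => (σ i).n :=
  monotone_nat_of_le_succ fun i => by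
    have := (h.succ i).n_eq
    omega

theorem rs_succ (i : ℕ) :
    (σ (i + 1)).rs = (σ i).rs ∨ ∃ r, (σ (i + 1)).rs = (σ i).rs ++ [r] := by
  obtain ⟨ct₀, t₀, G₀, ct₁, hT, hE, -⟩ := (h.succ i).step
  rcases hE.ev with ⟨_, h2, _⟩ | ⟨_, _, h2, _⟩ | ⟨_, r, _, h2, _⟩
  · exact Or.inl h2
  · exact Or.inl h2
  · exact Or.inr ⟨r, h2⟩

theorem rs_mono : Monotone fun i => (σ i).rs.length :=
  monotone_nat_of_le_succ fun i => by
    rcases h.rs_succ i with h | ⟨r, h⟩ <;> simp [h]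

theorem ctl_zero : (σ 0).m.ctl = .run P.boot := by rw [h.zero]; rfl

omit h in
theorem run_or_ready_of_run {i : ℕ} {ct₁ : Ctl P.St} {s : P.St} (hs : ct₁ = .run s)
    (hm : (σ (i + 1)).m = P.next (σ i).m ct₁ (σ (i + 1)).n) :
    (∃ s', (σ (i + 1)).m.ctl = .run s') ∨ (σ (i + 1)).m.ctl = .ready := by
  cases hr : roomAt (σ i).m (σ (i + 1)).n
  · rw [hm, P.next_of_not_room hr]
    exact Or.inl ⟨s, hs⟩
  · rw [hm, P.next_room hr]
    exact P.micro_ctl hs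

theorem not_right (i : ℕ) : (σ i).m.ctl ≠ .right := by
  rcases i with _ | i
  · rw [h.ctl_zero]; simp
  · obtain ⟨ct₀, t₀, G₀, ct₁, hT, hE, hD, hD', hm⟩ := (h.succ i).step
    have hv := (h.valid (i + 1)).work
    rcases hv with ⟨hl, _⟩ | ⟨I, _⟩
    · rw [hl]; simp
    · refine I.ne_right (hD' ?_)
      rintro rfl
      apply I.ct_ne
      rw [hm, P.next_of_ne_run (by simp)]

/-- What happens on the way to the left. -/
theorem of_left {i : ℕ} {t₀ : Tape (WCell (Option A'))} {G₀ : Ghost} {ct₁ : Ctl P.St}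
    (hE : Evolves P.entry .left (σ i).rs t₀ G₀ ct₁ (σ (i + 1)).rs (σ (i + 1)).t (σ (i + 1)).G)
    (hm : (σ (i + 1)).m = P.next (σ i).m ct₁ (σ (i + 1)).n) :
    (ct₁ = .left ∧ (σ (i + 1)).m.ctl = .left) ∨ (σ i).rs.length < (σ (i + 1)).rs.length := by
  rcases hE.ev with ⟨h1, _⟩ | ⟨_, h1, _⟩ | ⟨_, r, _, h2, _⟩
  · refine Or.inl ⟨h1, ?_⟩
    rw [hm, h1, P.next_of_ne_run (by simp)]
  · refine absurd ?_ (h.not_right (i + 1))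
    rw [hm, h1, P.next_of_ne_run (by simp)]
  · right; rw [h2]; simp

/-- Each cycle stores at least a separator, so a cycle that stays on the way left shortens `D`. Once
the left end is reached, the search ends with an answer within the same cycle. -/
theorem exists_answer_of_left {i : ℕ} (hl : (σ i).m.ctl = .left) :
    ∃ j > i, (σ i).rs.length < (σ j).rs.length := by
  obtain ⟨d, hd⟩ : ∃ d, (σ i).G.D.length = d := ⟨_, rfl⟩
  induction d using Nat.strong_induction_on generalizing i with
  | _ d ih =>
    obtain ⟨ct₀, t₀, G₀, ct₁, hT, hE, hD, hD', hm⟩ := (h.succ i).step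
    rcases hT.ctl with ⟨h1, h2, h3, _⟩ | ⟨h1, _⟩
    · rw [h1, hl] at hE
      rcases h.of_left hE hm with ⟨h4, h5⟩ | h4
      · have h6 := hD h4
        rw [h3, hd] at h6
        obtain ⟨j, hj, hlt⟩ := ih _ h6 h5 rfl
        exact ⟨j, by omega, (h.rs_mono (Nat.le_succ i)).trans_lt hlt⟩
      · exact ⟨i + 1, by omega, h4⟩
    · rw [hl] at h1; cases h1

/-- Each cycle brings the head closer to the end of the visited region, which grows only under the
head. -/
theorem exists_blank_of_ready {i : ℕ} (hl : (σ i).m.ctl = .ready) :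
    ∃ j ≥ i, (σ j).m.ctl = .ready ∧ (σ j).t.read = .blank := by
  obtain ⟨d, hd⟩ : ∃ d, (σ i).G.V + 1 - (σ i).t.head ≤ d := ⟨_, le_rfl⟩
  induction d generalizing i with
  | zero =>
    refine ⟨i, le_rfl, hl, ?_⟩
    rcases (h.valid i).work with ⟨h1, _⟩ | ⟨I, _⟩
    · rw [hl] at h1; cases h1
    · have h1 := I.core.blank (σ i).t.head (by omega)
      have h2 : (σ i).t.head ≠ 0 := by omega
      have h3 : (σ i).t.cell (σ i).t.head = none := by simpa [kind] using h1
      simp [Tape.read, h2, h3]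
  | succ d ih =>
    by_cases hb : (σ i).t.read = .blank
    · exact ⟨i, le_rfl, hl, hb⟩
    · obtain ⟨ct₀, t₀, G₀, ct₁, hT, hE, hD, hD', hm⟩ := (h.succ i).step
      rcases hT.ctl with ⟨h1, h2, h3, _⟩ | ⟨_, h1, _⟩
      · rw [hl] at h1
        subst h1 h2 h3
        have hc : ct₁ = .ready := by
          rcases hE.ev with ⟨h1, _⟩ | ⟨h1, _⟩ | ⟨h1, _⟩
          · exact h1
          · cases h1
          · simp at h1
        have hdef := hE.deficit (by simp)
        obtain ⟨j, hj, hj'⟩ := ih (i := i + 1)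
          (by rw [hm, hc, P.next_of_ne_run (by simp)]) (by omega)
        exact ⟨j, by omega, hj'⟩
      · exact absurd h1 hb

theorem exists_answer_of_ready {i : ℕ} (hl : (σ i).m.ctl = .ready) :
    ∃ j > i, (σ i).rs.length < (σ j).rs.length := by
  obtain ⟨j, hj, hr, hb⟩ := h.exists_blank_of_ready hl
  have hij := h.rs_mono hj
  obtain ⟨ct₀, t₀, G₀, ct₁, hT, hE, hD, hD', hm⟩ := (h.succ j).step
  rcases hT.ctl with ⟨_, _, _, h1⟩ | ⟨_, _, h1, _⟩
  · exact absurd ⟨hr, hb⟩ h1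
  · rw [h1] at hE
    rcases h.of_left hE hm with ⟨_, h5⟩ | h4
    · obtain ⟨k, hk, hlt⟩ := h.exists_answer_of_left h5
      have := h.rs_mono (Nat.le_succ j)
      exact ⟨k, by omega, hij.trans_lt (this.trans_lt hlt)⟩
    · exact ⟨j + 1, by omega, hij.trans_lt h4⟩

variable (hn : ∀ N, ∃ i, N ≤ (σ i).n)

include hn

/-- A running program can be delayed only by lack of room, which ends when `n` exceeds its present
value. -/
theorem exists_micro {i : ℕ} {s : P.St} (hs : (σ i).m.ctl = .run s) :
    ∃ j ≥ i, (σ (j + 1)).m = P.micro (σ i).m := by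
  by_contra hno
  push Not at hno
  have hstep : ∀ j, (σ j).m = (σ i).m →
      (σ (j + 1)).m = P.next (σ i).m (.run s) (σ (j + 1)).n := by
    intro j hj
    obtain ⟨ct₀, t₀, G₀, ct₁, hT, hE, hD, hD', hm⟩ := (h.succ j).step
    rw [← hj] at hs
    rcases hT.ctl with ⟨h1, _⟩ | ⟨h1, _⟩
    · rw [h1, hs] at hE
      rcases hE.ev with ⟨h1, _⟩ | ⟨h1, _⟩ | ⟨h1, _⟩
      · rw [hm, h1, hj]
      · cases h1
      · simp at h1
    · rw [hs] at h1; cases h1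
  have hsame : ({ (σ i).m with ctl := .run s } : Mem K Γ E P.St) = (σ i).m := by rw [← hs]
  have hconst : ∀ j ≥ i, (σ j).m = (σ i).m := by
    intro j hj
    induction j, hj using Nat.le_induction with
    | base => rfl
    | succ j hj ih =>
      have h1 := hstep j ih
      cases hr : roomAt (σ i).m (σ (j + 1)).n
      · rw [h1, P.next_of_not_room hr, hsame]
      · rw [P.next_room hr, hsame] at h1
        exact absurd h1 (hno j hj)
  obtain ⟨k, hk⟩ := hn ((σ i).n + 1)
  have hj := h.n_mono (show k ≤ max i k + 1 by omega)
  have h1 := hstep _ (hconst (max i k) (le_max_left _ _))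
  rw [P.next_room ((h.valid i).fits.room (by simp only at hj; omega)), hsame] at h1
  exact hno _ (le_max_left _ _) h1

theorem exists_ready_of_run {i : ℕ} {s : P.St} (hs : (σ i).m.ctl = .run s) :
    ∃ j ≥ i, (σ j).m.ctl = .ready := by
  have key : ∀ r i (m₀ m₁ : Mem K Γ E P.St) (k : ℕ), P.Leads (k + r) m₀ m₁ → m₁.ctl = .ready →
      (σ i).m = P.micro^[k] m₀ → ∃ j ≥ i, (σ j).m.ctl = .ready := by
    intro r
    induction r with
    | zero =>
      intro i m₀ m₁ k hL h1 hm
      exact ⟨i, le_rfl, by rw [hm]; have := hL.1; rw [add_zero] at this; rw [this, h1]⟩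
    | succ r ih =>
      intro i m₀ m₁ k hL h1 hm
      obtain ⟨s, hs⟩ := hL.2 k (by omega)
      rw [← hm] at hs
      obtain ⟨j, hj, hj'⟩ := h.exists_micro hn hs
      rw [hm, ← Function.iterate_succ_apply' (f := P.micro)] at hj'
      obtain ⟨j', h2, h3⟩ := ih (j + 1) m₀ m₁ (k + 1)
        (by rwa [show k + 1 + r = k + (r + 1) by omega]) h1 hj'
      exact ⟨j', by omega, h3⟩
  rcases (h.valid i).bg with ⟨_, _, m₀, k, j, κ, i₀, hL, _, _, hi, hm, _⟩ | ⟨h1, _⟩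
  · obtain ⟨r, rfl⟩ := Nat.exists_eq_add_of_le hi.le
    exact key r i m₀ _ i₀ hL rfl hm
  · exact absurd hs (h1 s)

theorem exists_answer (i : ℕ) : ∃ j > i, (σ i).rs.length < (σ j).rs.length := by
  rcases hc : (σ i).m.ctl with _ | _ | _ | s
  · exact h.exists_answer_of_left hc
  · exact absurd hc (h.not_right i)
  · exact h.exists_answer_of_ready hc
  · obtain ⟨j, hj, hr⟩ := h.exists_ready_of_run hn hc
    obtain ⟨k, hk, hlt⟩ := h.exists_answer_of_ready hr
    exact ⟨k, by omega, (h.rs_mono hj).trans_lt hlt⟩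

theorem exists_le_rs (N : ℕ) : ∃ i, N ≤ (σ i).rs.length := by
  induction N with
  | zero => exact ⟨0, Nat.zero_le _⟩
  | succ N ih =>
    obtain ⟨i, hi⟩ := ih
    obtain ⟨j, _, hj⟩ := h.exists_answer hn i
    exact ⟨j, by omega⟩

theorem exists_event (i : ℕ) : ∃ j ≥ i, (σ j).rs.length < (σ (j + 1)).rs.length := by
  by_contra hno
  push Not at hno
  have hle : ∀ j ≥ i, (σ j).rs.length ≤ (σ i).rs.length := by
    intro j hj
    induction j, hj using Nat.le_induction with
    | base => exact le_rfl
    | succ j hj ih => exact (hno j hj).trans ih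
  obtain ⟨j, hj, hlt⟩ := h.exists_answer hn i
  have := hle j hj.le
  omega

omit hn in
theorem marked_succ (i : ℕ) : (σ (i + 1)).G.m = (σ i).G.m ∨ (σ (i + 1)).G.m = (σ i).G.m + 1 := by
  obtain ⟨ct₀, t₀, G₀, ct₁, hT, hE, -⟩ := (h.succ i).step
  rw [← hT.m_eq]
  rcases hE.ev with ⟨_, _, h2⟩ | ⟨_, _, _, h2⟩ | ⟨_, r, _, _, h2, h3⟩
  · exact Or.inl h2
  · exact Or.inl h2
  · by_cases hr : r = none
    · exact Or.inl (h2 hr).1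
    · exact Or.inr (h3 hr)

omit hn in
theorem marked_mono : Monotone fun i => (σ i).G.m :=
  monotone_nat_of_le_succ fun i => by
    rcases h.marked_succ i with h | h <;> simp [h]

omit hn in
theorem tags_mono {i j : ℕ} (hij : i ≤ j) : (σ i).G.V ≤ (σ j).G.V ∧
    tags (kind (σ i).t.cell) (σ i).G.V <+: tags (kind (σ j).t.cell) (σ j).G.V := by
  induction j, hij using Nat.le_induction with
  | base => exact ⟨le_rfl, List.prefix_rfl⟩
  | succ j _ ih =>
    obtain ⟨ct₀, t₀, G₀, ct₁, hT, hE, -⟩ := (h.succ j).step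
    exact ⟨ih.1.trans (hT.V_le.trans hE.V_le), ih.2.trans (hT.tags_le.trans hE.tags_le)⟩

omit hn in
theorem event_cases {i : ℕ} (hi : (σ i).rs.length < (σ (i + 1)).rs.length)
    (hm : (σ (i + 1)).G.m = (σ i).G.m) : (σ i).G.m + 1 ∈ (σ (i + 1)).G.cur := by
  obtain ⟨ct₀, t₀, G₀, ct₁, hT, hE, -⟩ := (h.succ i).step
  rw [← hT.m_eq] at hm ⊢
  rcases hE.ev with ⟨_, h1, _⟩ | ⟨_, _, h1, _⟩ | ⟨_, r, _, _, h2, h3⟩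
  · rw [h1] at hi; omega
  · rw [h1] at hi; omega
  · by_cases hr : r = none
    · exact (h2 hr).2
    · have := h3 hr; omega

/-- Otherwise each further answer shows that the cell `m + 1` is still available. But every class
halves the number of available cells up to `m + 1`, and there are at least as many classes as
answers, whose number is unbounded. -/
theorem exists_marked_lt (i : ℕ) : ∃ j > i, (σ i).G.m < (σ j).G.m := by
  by_contra hno
  push Not at hno
  have hconst : ∀ j ≥ i, (σ j).G.m = (σ i).G.m := by
    intro j hj
    refine le_antisymm ?_ (h.marked_mono hj)
    rcases hj.eq_or_lt with rfl | hj
    · exact le_rfl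
    · exact hno j hj
  have hev : ∀ j ≥ i, (σ j).rs.length < (σ (j + 1)).rs.length →
      (σ i).G.m + 1 ∈ (σ (j + 1)).G.cur := by
    intro j hj hlt
    have := h.event_cases hlt (by rw [hconst j hj, hconst (j + 1) (by omega)])
    rwa [hconst j hj] at this
  obtain ⟨j, hj, hlt⟩ := h.exists_event hn i
  have hL := (h.valid (j + 1)).work.layout
  have hpV := (hL.of_mem (Or.inl (hev j hj hlt))).2.1
  -- The number of candidates up to `m + 1` times two to the number of classes cannot increase any
  -- more.
  obtain ⟨c, hc⟩ : ∃ c, ((sieve (tags (kind (σ (j + 1)).t.cell) (σ (j + 1)).G.V)).1.filter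
    (· ≤ (σ i).G.m + 1)).length * 2 ^ ((sieve (tags (kind (σ (j + 1)).t.cell)
      (σ (j + 1)).G.V)).2.length) = c := ⟨_, rfl⟩
  obtain ⟨k₀, hk₀⟩ := h.exists_le_rs hn c
  obtain ⟨k, hk, hlt'⟩ := h.exists_event hn (max (j + 1) k₀)
  have hmem := hev k (by omega) hlt'
  have hL' := (h.valid (k + 1)).work.layout
  obtain ⟨hV, l', hl'⟩ := h.tags_mono (show j + 1 ≤ k + 1 by omega)
  -- The cell `m + 1` has been visited by moment `j + 1`, so candidates that are added later lie
  -- beyond it.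
  have hq : ∀ q, some q ∈ l' → (σ i).G.m + 1 < q := by
    intro q hq
    obtain ⟨a, ha⟩ := List.getElem?_of_mem hq
    have h1 : (tags (kind (σ (k + 1)).t.cell) (σ (k + 1)).G.V)[(σ (j + 1)).G.V + a]?
        = some (some q) := by
      rw [← hl', List.getElem?_append_right (by simp [length_tags]), length_tags]
      simpa using ha
    have hlt : (σ (j + 1)).G.V + a < (σ (k + 1)).G.V := by
      have := (List.getElem?_eq_some_iff.1 h1).1
      rwa [length_tags] at this
    simp only [tags, List.getElem?_map, List.getElem?_range hlt, Option.map_some,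
      Option.some.injEq] at h1
    have h2 : q = (σ (j + 1)).G.V + a + 1 := by
      by_cases ht : kind (σ (k + 1)).t.cell ((σ (j + 1)).G.V + a + 1) = some .turn
      · rw [tagAt_eq_none.2 ht] at h1; cases h1
      · rw [tagAt_of_ne ht] at h1
        exact (Option.some.inj h1).symm
    omega
  have hs := length_filter_sieve l' (by rw [hl']; exact sorted_tags _ _) hq
  rw [hc, hl', hL'.sieve_eq] at hs
  have h1 : 1 ≤ ((σ (k + 1)).G.cur.filter (· ≤ (σ i).G.m + 1)).length :=
    List.length_pos_of_mem (List.mem_filter.2 ⟨hmem, by simp⟩)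
  have h2 := (h.valid (k + 1)).work.count_le
  have h3 := h.rs_mono (show k₀ ≤ k by omega)
  have h4 : (σ (k + 1)).G.cls.length < 2 ^ (σ (k + 1)).G.cls.length := Nat.lt_two_pow_self
  have h5 := Nat.mul_le_mul h1 (le_refl (2 ^ (σ (k + 1)).G.cls.length))
  simp only at h3 hs h5
  omega

theorem exists_le_marked (N : ℕ) : ∃ i, N ≤ (σ i).G.m := by
  induction N with
  | zero => exact ⟨0, Nat.zero_le _⟩
  | succ N ih =>
    obtain ⟨i, hi⟩ := ih
    obtain ⟨j, _, hj⟩ := h.exists_marked_lt hn i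
    exact ⟨j, by omega⟩

omit hn in
theorem st_eq (i : ℕ) : (σ i).st = streamOf ((List.range i).map T) := by
  induction i with
  | zero => rw [h.zero]; rfl
  | succ i ih =>
    rw [(h.succ i).st_eq, ih, List.range_succ, List.map_append, List.map_singleton,
      streamOf_concat]

omit hn in
-- The way left yields no answers and no marks. So the answers agree with those at an earlier moment
-- off the way left, where all classes are complete.
theorem exists_not_left (i : ℕ) :
    ∃ j ≤ i, (σ j).m.ctl ≠ .left ∧ (σ j).rs = (σ i).rs ∧ (σ j).G.m = (σ i).G.m := by
  induction i with
  | zero => exact ⟨0, le_rfl, by rw [h.ctl_zero]; simp, rfl, rfl⟩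
  | succ i ih =>
    by_cases hl : (σ (i + 1)).m.ctl = .left
    · obtain ⟨j, hj, h1, h2, h3⟩ := ih
      obtain ⟨ct₀, t₀, G₀, ct₁, hT, hE, hD, hD', hm⟩ := (h.succ i).step
      rw [← hT.m_eq] at h3
      rcases hE.ev with ⟨_, h4, h5⟩ | ⟨_, _, h4, h5⟩ | ⟨_, r, h4, _⟩
      · exact ⟨j, by omega, h1, h2.trans h4.symm, h3.trans h5.symm⟩
      · exact ⟨j, by omega, h1, h2.trans h4.symm, h3.trans h5.symm⟩
      · rcases run_or_ready_of_run h4 hm with ⟨s, h5⟩ | h5 <;> rw [hl] at h5 <;> cases h5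
    · exact ⟨i + 1, le_rfl, hl, rfl, rfl⟩

omit h hn in
theorem streamOf_prefix {a b : ℕ} (hab : a ≤ b) :
    streamOf ((List.range a).map T) <+: streamOf ((List.range b).map T) := by
  induction b, hab using Nat.le_induction with
  | base => exact List.prefix_rfl
  | succ b _ ih =>
    rw [List.range_succ, List.map_append, List.map_singleton, streamOf_concat]
    exact ih.trans (List.prefix_append _ _)

/-- Choose a moment `i₁` with at least as many answers, hence classes, as the first `N` data have
stream symbols. Once all cells visited by then have been read, each of these classes supplies a
symbol, so the recovered prefix covers the first `N` data. -/
theorem eventually_items (N : ℕ) : ∃ i₀, ∀ i ≥ i₀, ∃ k ≥ N,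
    splitStream (answerStream (σ i).rs) = (List.range k).map T := by
  obtain ⟨i₁, h1⟩ := h.exists_le_rs hn (streamOf ((List.range N).map T)).length
  -- One more than `V` ensures that the moment `j` below does not precede `i₁`, as no unvisited cell
  -- has been read.
  obtain ⟨i₀, h0⟩ := h.exists_le_marked hn ((σ i₁).G.V + 1)
  refine ⟨i₀, fun i hi => ?_⟩
  obtain ⟨j, hj, hl, hrs, hm⟩ := h.exists_not_left i
  have hmi := h.marked_mono hi
  simp only at hmi
  rcases (h.valid j).work with ⟨h2, _⟩ | ⟨I, _⟩
  · exact absurd h2 hl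
  have hj1 : i₁ ≤ j := by
    by_contra hlt
    have h2 := (h.tags_mono (show j ≤ i₁ by omega)).1
    have h3 := I.marks.m_le
    omega
  have hlen := I.le_length_answerStream (h.tags_mono hj1).2 (by omega)
  rw [(h.valid i₁).work.layout.sieve_eq] at hlen
  have hcls := (h.valid i₁).work.count_le
  have hpre := I.answerStream_prefix
  rw [hrs] at hlen hpre
  rw [h.st_eq] at hpre
  have h2 : streamOf ((List.range N).map T) <+: answerStream (σ i).rs :=
    List.prefix_of_prefix_length_le (streamOf_prefix (le_max_left N j))
      (hpre.trans (streamOf_prefix (le_max_right N j))) (by simp only at hlen; omega)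
  have h3 := splitStream_prefix h2
  have h4 := splitStream_prefix hpre
  rw [splitStream_streamOf] at h3 h4
  refine ⟨(splitStream (answerStream (σ i).rs)).length, by simpa using h3.length_le, ?_⟩
  have h5 := List.prefix_iff_eq_take.1 h4
  have h6 : (splitStream (answerStream (σ i).rs)).length ≤ j := by simpa using h4.length_le
  conv_lhs => rw [h5]
  rw [← List.map_take, List.take_range, min_eq_left h6]

omit hn in
theorem exists_dropLast (i : ℕ) : (σ i).rs = [] ∨ ∃ j, (σ j).rs = (σ i).rs.dropLast := by
  induction i with
  | zero => rw [h.zero]; exact Or.inl rfl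
  | succ i ih =>
    rcases h.rs_succ i with h1 | ⟨r, h1⟩
    · rw [h1]; exact ih
    · exact Or.inr ⟨i, by rw [h1, List.dropLast_concat]⟩

/-- If the hypotheses computed from the answers are eventually constant, then so are the outputs. -/
theorem eventually_ho {d : List E} {i₀ : ℕ} (hd : ∀ i ≥ i₀, hypo (σ i).rs = d) :
    ∃ i₁, ∀ i ≥ i₁, (σ i).m.ho = d := by
  -- With two more answers, even the list without its last answer belongs to a moment after `i₀`.
  obtain ⟨i₂, h2⟩ := h.exists_le_rs hn ((σ i₀).rs.length + 2)
  refine ⟨max i₀ i₂, fun i hi => ?_⟩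
  rcases (h.valid i).ho with h1 | h1
  · rw [h1]; exact hd i (by omega)
  · rw [h1]
    have hlen : (σ i₂).rs.length ≤ (σ i).rs.length := h.rs_mono (show i₂ ≤ i by omega)
    rcases h.exists_dropLast i with h3 | ⟨j, hj⟩
    · rw [h3, List.length_nil] at hlen; omega
    · rw [← hj]
      refine hd j ?_
      by_contra hlt
      have h4 : (σ j).rs.length ≤ (σ i₀).rs.length := h.rs_mono (show j ≤ i₀ by omega)
      rw [hj, List.length_dropLast] at h4
      omega

end IsExecution

end Progress

end AutoLearn

namespace AutoLearn

/-! ### The learner -/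

section Congr

variable {A B S : Type*} {M : S × List A → S × List B} {m₀ : S}

theorem memory_congr {T T' : ℕ → List A} {k : ℕ} (h : ∀ i < k, T i = T' i) :
    memory M m₀ T k = memory M m₀ T' k := by
  induction k with
  | zero => rfl
  | succ k ih => rw [memory, memory, ih fun i hi => h i (by omega), h k (by omega)]

theorem guess_map_range (T : ℕ → List A) (k : ℕ) :
    guess M m₀ ((List.range (k + 1)).map T) = conjecture M m₀ T k := by
  have hT : ∀ i ≤ k, ((List.range (k + 1)).map T)[i]?.getD [] = T i := by
    intro i hi
    simp [List.getElem?_range (show i < k + 1 by omega)]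
  rw [guess]
  simp only [List.length_map, List.length_range]
  rw [conjecture, conjecture, hT k le_rfl, memory_congr fun i hi => hT i hi.le]

end Congr

section Background

open Turing.PartrecToTM2

instance : Finite K' :=
  Finite.of_injective (β := Fin 4) (fun | .main => 0 | .rev => 1 | .aux => 2 | .stack => 3)
    (by intro x y; cases x <;> cases y <;> simp)

theorem stmtStep_cm {E : Type} (q : Turing.TM2.Stmt (fun _ : K' => Γ') Λ' (Option Γ'))
    (v : Option Γ') (tops : K' → Option Γ') : (stmtStep (E := E) tr v tops q).2.cm = false := by
  cases q <;> rfl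

theorem background_commit {c : Turing.ToPartrec.Code} {a b : ℕ} {E Y : Type}
    {code : Resp Y → Fin a} {letter : ℕ → Option E} (s : (background c a b code letter).St)
    (tops : K' → Option Γ') (h : ((background c a b code letter).δ s tops).2.cm = true) :
    ((background c a b code letter).δ s tops).1 = none := by
  have key : ∀ s : BgState c a b, ((background c a b code letter).δ s tops).2.cm = true →
      ((background c a b code letter).δ s tops).1 = none := by
    intro s
    cases s with
    | tm q v =>
      intro h
      have := stmtStep_cm (E := E) q.1 v tops
      exact absurd (h.symm.trans this) (by simp)
    | app1 j => obtain ⟨_ | j, hj⟩ := j <;> intro h <;> cases h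
    | dec0 =>
      simp only [background]
      split <;> intro h <;> cases h
    | dec1 j =>
      simp only [background]
      split <;> intro h <;> first | rfl | cases h
    | _ => intro h; cases h
  exact key s h

/-- The letter number `i`. -/
def finLetter (b i : ℕ) : Option (Fin b) := if h : i < b then some ⟨i, h⟩ else none

theorem flatten_finLetter {B : Type*} {b : ℕ} (e : B → Fin b) (l : List B) :
    (((l.map fun x => (e x : ℕ)).reverse.map fun i =>
      (finLetter b i).toList).reverse).flatten = l.map e := by
  rw [List.map_reverse, List.reverse_reverse, List.map_map]
  have : (fun i => (finLetter b i).toList) ∘ (fun x => (e x : ℕ)) = fun x => [e x] := by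
    funext x
    simp [finLetter]
  rw [this]
  induction l <;> simp_all

/-- Between rounds the main stack holds the code of the history. There are only finitely many
possible answers, so their encodings are bounded and fit into the finite control. Adding an answer
to the history acts on codes as `N ↦ 2 ^ code r * (2 * N + 1)`. -/
theorem exists_simulates {A B S : Type*} [Primcodable A] [Primcodable B] [Primcodable S]
    [Finite B] {M : S × List A → S × List B} (m₀ : S) (hM : Computable M) {a b : ℕ}
    (d : Fin a → A) (e : B → Fin b) {g : ℕ → ℕ} (hg : Computable g) :
    ∃ (P : Prog K' Γ' (Fin b) (Option (Fin a))) (Sf : List (Resp (Option (Fin a))) → K' → List Γ'),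
      Simulates P Sf (fun rs => (answerGuess M m₀ d rs).map e) fun s => g (2 ^ (s + 5)) := by
  obtain ⟨c, hc⟩ := exists_background_code M m₀ hM d (fun x => (e x : ℕ)) hg
  obtain ⟨N, code, hcode⟩ : ∃ (N : ℕ) (code : Resp (Option (Fin a)) → Fin N),
      ∀ r, (code r : ℕ) = Encodable.encode r := by
    obtain ⟨N, hN⟩ := (Set.finite_range (Encodable.encode (α := Resp (Option (Fin a))))).bddAbove
    exact ⟨N + 1, fun r => ⟨_, Nat.lt_succ_of_le (hN ⟨r, rfl⟩)⟩, fun r => rfl⟩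
  have hL : ∀ rs, ∀ i ∈ ((answerGuess M m₀ d rs).map fun x => (e x : ℕ)).reverse, i ≤ b := by
    intro rs i hi
    obtain ⟨x, -, rfl⟩ := List.mem_map.1 (List.mem_reverse.1 hi)
    exact (e x).2.le
  refine ⟨background c N b code (finLetter b),
    fun rs => mainStack (trList [unaryCode (history rs)]), ?_, ?_, rfl, background_commit⟩
  · obtain ⟨n, n', mid, h1, h2, h3⟩ := leads_boot c N b code (finLetter b) (hc []) (hL [])
    rw [flatten_finLetter] at h2
    exact ⟨_, n, K'.main, h1.trans h2, Nat.le_add_right _ _,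
      h3.trans_eq (congrArg (fun m => (m.stk K'.main).length) h1.1).symm⟩
  · intro rs r ho
    have h := hc (rs ++ [r])
    have hr : unaryCode (history (rs ++ [r])) =
        2 ^ (code r : ℕ) * (2 * unaryCode (history rs) + 1) := by
      simp [history, unaryCode, hcode]
    rw [hr] at h
    obtain ⟨n, n', mid, h1, h2, h3⟩ := leads_entry (b := b) (r := r) (code := code)
      (letter := finLetter b) h (hL (rs ++ [r])) ho
    rw [flatten_finLetter] at h2
    rw [List.length_append, List.length_singleton] at h3
    refine ⟨_, n, K'.main, ?_, Nat.le_add_right n n',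
      h3.trans_eq (congrArg (fun m => (m.stk K'.main).length) h1.1).symm⟩
    rw [hr]
    exact h1.trans h2

end Background

/-! ### Convergence on texts -/

section Learning

variable {A B S : Type*} [Finite A] {K Γ E A' : Type} [Finite K] [Finite Γ] [Finite E] [Finite A']

theorem IsText.exists_length_ge {T : ℕ → List A} {X : Language A} (hT : IsText T X)
    (hinf : {x | x ∈ X}.Infinite) (N : ℕ) : ∃ i, N ≤ (T i).length := by
  by_contra hno
  push Not at hno
  refine hinf ((List.finite_length_lt A N).subset fun x hx => ?_)
  obtain ⟨i, rfl⟩ := (hT x).1 hx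
  exact hno i

/-- The lengths of the data are unbounded, so progress is guaranteed. The answers eventually encode
initial segments of the text beyond the point where `M` has converged, and each guess computed from
them is the final conjecture. -/
theorem Simulates.learns {P : Prog K Γ E (Option A')} {Sf : List (Resp (Option A')) → K → List Γ}
    {gate : ℕ → ℕ} {M : S × List A → S × List B} {m₀ : S} (ea : A ≃ A') (e : B ≃ E)
    (hP : Simulates P Sf (fun rs => (answerGuess M m₀ ea.symm rs).map e) gate)
    {I : Language B} {L : List B → Language A} (hinf : ∀ e ∈ I, {x | x ∈ L e}.Infinite)
    (hlearn : MapLearns M m₀ I L) : (machine P ea e.symm).Learns I L := by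
  intro e₀ he₀ T hT
  obtain ⟨σ, time, -, hσ, hrun, -⟩ := hP.exists_execution ea e.symm T
  have hn : ∀ N, ∃ i, N ≤ (σ i).n := by
    intro N
    obtain ⟨i, hi⟩ := hT.exists_length_ge (hinf e₀ he₀) N
    refine ⟨i + 1, hi.trans ?_⟩
    rw [(hσ.succ i).n_eq, List.length_map]
    exact le_max_right _ _
  obtain ⟨d, hd, hLd, k, hk⟩ := hlearn e₀ he₀ T hT
  obtain ⟨i₀, h0⟩ := hσ.eventually_items hn (k + 1)
  have hguess : ∀ i ≥ i₀, (answerGuess M m₀ ea.symm (σ i).rs).map e = d.map e := by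
    intro i hi
    obtain ⟨j, hj, hs⟩ := h0 i hi
    obtain ⟨j, rfl⟩ := Nat.exists_eq_add_of_le' (show 1 ≤ j by omega)
    have hT' : ((List.range (j + 1)).map fun i => (T i).map ea).map (List.map ea.symm) =
        (List.range (j + 1)).map T := by
      simp [Function.comp_def]
    rw [answerGuess, hs, hT', guess_map_range, hk j (by omega)]
  obtain ⟨i₁, h1⟩ := hσ.eventually_ho hn (d := d.map e) hguess
  refine ⟨_, _, _, hrun, d, hd, hLd, i₁, fun j hj => ?_⟩
  simp only
  -- The hypothesis of cycle `j` is read off the memory after this cycle.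
  rw [h1 (j + 1) (by omega)]
  simp

end Learning

end AutoLearn

theorem theorem4p1 {A : Type*} {B : Type*} [Finite A] [Finite B] [Primcodable A] [Primcodable B]
    (I : Language B) (L : List B → Language A)
    (hauto : AutoLearn.IsAutomaticFamily I L)
    (hinf : ∀ e ∈ I, {x | x ∈ L e}.Infinite)
    {S : Type*} [Primcodable S] (M : S × List A → S × List B) (m₀ : S)
    (hM : Computable M) (hlearn : AutoLearn.MapLearns M m₀ I L)
    (f g : ℕ → ℕ) (hf : Computable f) (hg : Computable g)
    (hfg : ∀ m n, g m ≤ n → m ≤ f n) :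
    ∃ N : AutoLearn.Learner A B 1, N.Learns I L ∧
      ∃ C : ℕ, N.RunsWithin (fun n => C * (n * f n + 1)) := by
  obtain ⟨_, ⟨ea⟩⟩ := Finite.exists_equiv_fin A
  obtain ⟨_, ⟨e⟩⟩ := Finite.exists_equiv_fin B
  obtain ⟨P, Sf, hP⟩ := AutoLearn.exists_simulates m₀ hM ea.symm e hg
  exact ⟨_, hP.learns ea e hinf hlearn, _, hP.runsWithin hfg ea e.symm⟩
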